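/- **Setting.** Let $G$ be a finite-dimensional real Lie group (without boundary) with Lie algebra $\mathfrak g$, and let $\langle\cdot,\cdot\rangle$ be a symmetric $\mathrm{Ad}(G)$-invariant bilinear form on $\mathfrak g$ (for instance the suitably normalised Killing form of a compact simple Lie group). All maps on $[0,1]^k$ are smooth up to the boundary, and products of group-valued maps are pointwise. Put * $P_0G=\{p:[0,1]\to G,\ p(0)=1\}$, $\quad L_0G=\{p\in P_0G,\ p(1)=1\}$, $\quad P_0\mathfrak g=\{V:[0,1]\to\mathfrak g,\ V(0)=0\}$, $\quad L_0\mathfrak g=\{\gamma\in P_0\mathfrak g,\ \gamma(1)=0\}$; * $P_0L_0G$, the group of maps $f:(s,r)\mapsto f(s,r)\in G$ on $[0,1]^2$ with $f(0,r)=f(s,0)=f(s,1)=1$, and $\flat f=f(1,\cdot)\in L_0G$. On $P_0L_0G\times U(1)$ consider the group structure $$(f_1,z_1)(f_2,z_2)=\Bigl(f_1f_2,\;z_1z_2\exp\Bigl(-\tfrac{i}{2\pi}\int_0^1\!dr\int_0^1\!ds\,\langle f_1^{-1}\partial_sf_1,\,(\partial_rf_2)f_2^{-1}\rangle\Bigr)\Bigr).$$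 A *disc* is a smooth map $F:[0,1]^3\to G$, $(u,s,r)\mapsto F(u,s,r)$, equal to $1$ whenever $u=0$, or $s\in\{0,1\}$, or $r\in\{0,1\}$; its boundary is $F(1,\cdot,\cdot)\in P_0L_0G$, and $$\int_F\omega=\tfrac{i}{2\pi}\int du\,ds\,dr\,\langle F^{-1}\partial_uF,\ \partial_r(F^{-1}\partial_sF)\rangle .$$ Let $N\subseteq P_0L_0G\times U(1)$ be the set of all $\bigl(f,\exp\int_F\omega\bigr)$, where $F$ is a disc with boundary $f$. Let $\widehat{L_0G}=(P_0L_0G\times U(1))/N$, and define $t:\widehat{L_0G}\to P_0G$ and an action $\triangleright$ of $P_0G$ on $\widehat{L_0G}$ by $$t[(f,z)]=\flat f,\qquad g\triangleright[(f,z)]=\Bigl[\Bigl(gfg^{-1},\ z\exp\Bigl(\tfrac{i}{2\pi}\int_0^1\!dr\int_0^1\!ds\,\langle f^{-1}\partial_sf,\,g^{-1}\partial_rg\rangle\Bigr)\Bigr)\Bigr].$$ On the Lie algebra side, use the pointwise bracket on $P_0\mathfrak g$, and on $\widehat{L_0\mathfrak g}=L_0\mathfrak g\oplus\mathfrak u(1)$,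 $\mathfrak u(1)=i\mathbb R$, put $$[(\gamma_1,q_1),(\gamma_2,q_2)]=\Bigl([\gamma_1,\gamma_2],-\tfrac{i}{2\pi}\int_0^1\langle\gamma_1,\partial_r\gamma_2\rangle dr\Bigr),\qquad t(\gamma,q)=\gamma,$$ $$g\triangleright(\gamma,q)=\Bigl(g\gamma g^{-1},\,q+\tfrac{i}{2\pi}\int_0^1\langle\gamma,g^{-1}\partial_rg\rangle dr\Bigr),\qquad V\triangleright(\gamma,q)=\Bigl([V,\gamma],\,\tfrac{i}{2\pi}\int_0^1\langle\partial_rV,\gamma\rangle dr\Bigr).$$ A smooth curve in $P_0G$ through $1$ is a curve $\varepsilon\mapsto c_\varepsilon$ ($\varepsilon\in\mathbb R$) with $c_0=1$ and $c_\varepsilon(r)$ jointly smooth; its tangent vector is $V(r)=\partial_\varepsilon|_0c_\varepsilon(r)$. A smooth curve in $\widehat{L_0G}$ through $1$ is the image of a smooth curve $(f_\varepsilon,z_\varepsilon)$ in $P_0L_0G\times U(1)$ through the unit; its tangent vector is $(\partial_\varepsilon|_0\flat f_\varepsilon,\ \partial_\varepsilon|_0z_\varepsilon)\in L_0\mathfrak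 g\oplus\mathfrak u(1)$. Fix a smooth $\wp:[0,1]\to\mathbb R$ with $\wp(0)=0$, $\wp(1)=1$, and let $P:P_0\mathfrak g\to L_0\mathfrak g$, $P(V)=V-\wp\,V(1)$. Define, for $g\in P_0G$ and $V,V_1,V_2\in P_0\mathfrak g$, $$\kappa(g,V)=P(gVg^{-1}-V),\qquad \hat\kappa(g,V)=\Bigl(\kappa(g,V),\ \tfrac{i}{2\pi}\int_0^1\langle g^{-1}\partial_rg,V\rangle dr\Bigr)\in L_0\mathfrak g\oplus\mathfrak u(1),$$ $$\hat\kappa(V_1,V_2)=\Bigl(P([V_1,V_2]),\ \tfrac{i}{2\pi}\int_0^1\langle\partial_rV_1,V_2\rangle dr\Bigr).$$ **Proposition.** 1. $N$ is a normal subgroup of $P_0L_0G\times U(1)$, and $t$ and $\triangleright$ are well defined and make $\mathsf{String}(G)=(\widehat{L_0G}\xrightarrow{\,t\,}P_0G,\triangleright)$ a crossed module of groups, that is, $t$ is a homomorphism, $\triangleright$ is an action by automorphisms, $t(g\triangleright h)=g\,t(h)\,g^{-1}$ and $t(h_1)\triangleright h_2=h_1h_2h_1^{-1}$. 2. Every element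 of $P_0\mathfrak g$ and of $\widehat{L_0\mathfrak g}$ is the tangent vector of a smooth curve through $1$ in $P_0G$ and in $\widehat{L_0G}$, respectively; and $V\mapsto gVg^{-1}$, $(\gamma,q)\mapsto\gamma$ and $(\gamma,q)\mapsto g\triangleright(\gamma,q)$ are linear and are the derivatives at $1$ of the conjugation by $g$, of $t$ and of the action of $g$: these send a curve with a given tangent vector to a curve with the image tangent vector. If $\int_F\omega\in2\pi i\mathbb Z$ for all discs $F$ with constant boundary $1$, then a curve in $\widehat{L_0G}$ has at most one tangent vector. 3. $\hat\kappa(g,V)$ is an adjustment of $\mathsf{String}(G)$: it is linear in $V$, and for all $h\in\widehat{L_0G}$, $g_1,g_2\in P_0G$ and $V\in P_0\mathfrak g$ $$\hat\kappa(t(h),V)=h(V\triangleright h^{-1}),\qquad \hat\kappa(g_2g_1,V)=g_2\triangleright\hat\kappa(g_1,V)+\hat\kappa\bigl(g_2,\ g_1Vg_1^{-1}-t(\hat\kappa(g_1,V))\bigr).$$ Here the first equation means that for every smooth curve $c_\varepsilon$ in $P_0G$ through $1$ with tangent vector $V$, the curve $h\,(c_\varepsilon\triangleright h^{-1})$ in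 $\widehat{L_0G}$ is smooth through $1$ with tangent vector $\hat\kappa(t(h),V)$. 4. It linearises to $\hat\kappa(V_1,V_2)$: for every smooth curve $c_\varepsilon$ in $P_0G$ through $1$ with tangent vector $V_1$ and all $V_2\in P_0\mathfrak g$, $W\in\widehat{L_0\mathfrak g}$, as $\varepsilon\to0$, $$\tfrac1\varepsilon(c_\varepsilon V_2c_\varepsilon^{-1}-V_2)\to[V_1,V_2],\qquad \tfrac1\varepsilon(c_\varepsilon\triangleright W-W)\to V_1\triangleright W,\qquad \tfrac1\varepsilon\hat\kappa(c_\varepsilon,V_2)\to\hat\kappa(V_1,V_2),$$ with uniform convergence of all $r$-derivatives of the paths and loops. 5. $(\widehat{L_0\mathfrak g}\xrightarrow{\,t\,}P_0\mathfrak g,\triangleright)$ is a crossed module of Lie algebras, and $\hat\kappa(V_1,V_2)$ is an infinitesimal adjustment of it: it is bilinear, and for all $W\in\widehat{L_0\mathfrak g}$, $V,V_1,V_2,V_3\in P_0\mathfrak g$, $\hat\kappa(t(W),V)=-V\triangleright W$ and $$\hat\kappa([V_1,V_2],V_3)=V_1\triangleright\hat\kappa(V_2,V_3)-V_2\triangleright\hat\kappa(V_1,V_3)+\hat\kappa(V_1,[V_2,V_3])-\hat\kappa(V_2,[V_1,V_3])-\hat\kappa(V_1,t(\hat\kappa(V_2,V_3)))+\hat\kappa(V_2,t(\hat\kappa(V_1,V_3))).$$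 -/

import Mathlib

open scoped Manifold ContDiff Topology
open Set Filter MeasureTheory

noncomputable section

namespace StringTwoGroup

section Calculus

/-! ### Calculus on a Lie group

`G` is a Lie group with model space `E`. In Mathlib every tangent space of `G`, in particular the
Lie algebra `T₁G = GroupLieAlgebra I G`, is definitionally the vector space `E` (read in the
preferred chart at the point), so elements of the Lie algebra are written as elements of `E`. -/

variable {E : Type*} [NormedAddCommGroup E] [NormedSpace ℝ E]
  {H : Type*} [TopologicalSpace H] (I : ModelWithCorners ℝ E H)

/-- The derivative `∂p/∂t` of a map `p` from `[0,1]` to a manifold; for `I = 𝓘(ℝ, E)` this is the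
usual derivative (one-sided at the end points) of a map from `[0,1]` to `E`. -/
def vel {M : Type*} [TopologicalSpace M] [ChartedSpace H M]
    (p : unitInterval → M) (t : unitInterval) : E :=
  mfderiv (𝓡∂ 1) I p t 1

/-- The derivative at `0` of a map from `ℝ` to a manifold. -/
def velZero {M : Type*} [TopologicalSpace M] [ChartedSpace H M] (p : ℝ → M) : E :=
  mfderiv 𝓘(ℝ, ℝ) I p 0 1

variable {G : Type*} [TopologicalSpace G] [ChartedSpace H G] [Group G]

/-- The left logarithmic derivative `p⁻¹ ∂p/∂t`, with values in the Lie algebra. -/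
def leftLog (p : unitInterval → G) (t : unitInterval) : E :=
  vel I (fun t' => (p t)⁻¹ * p t') t

/-- The right logarithmic derivative `(∂p/∂t) p⁻¹`, with values in the Lie algebra. -/
def rightLog (p : unitInterval → G) (t : unitInterval) : E :=
  vel I (fun t' => p t' * (p t)⁻¹) t

/-- The adjoint action `X ↦ g X g⁻¹` of `G` on its Lie algebra. -/
def Ad (g : G) : E →L[ℝ] E :=
  mfderiv I I (fun x => g * x * g⁻¹) 1

variable (G) in
/-- The Lie bracket of the Lie algebra of `G`. -/
def bracket (X Y : E) : E :=
  Bracket.bracket (L := GroupLieAlgebra I G) (M := GroupLieAlgebra I G) X Y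

variable {I} [LieGroup I ∞ G]

theorem inTC_one {M : Type*} {E' H' : Type*} [NormedAddCommGroup E'] [NormedSpace ℝ E'] [TopologicalSpace H']
   {J : ModelWithCorners ℝ E' H'} [TopologicalSpace M] [ChartedSpace H' M] [IsManifold J 1 M]
   {N : Type*} (f : N → M) (g : N → G) (φ : N → E' →L[ℝ] E) (x₀ x : N) (h0 : g x₀ = 1) (h : g x = 1)
   (hx : f x ∈ (chartAt H' (f x₀)).source) :
   inTangentCoordinates J I f g φ x₀ x = φ x ∘L (tangentBundleCore J M).coordChange (achart H' (f x₀)) (achart H' (f x)) (f x) := by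
  rw [inTangentCoordinates_eq f g φ hx (by rw [h, h0]; exact mem_chart_source H 1), h, h0]
  ext v
  simp only [ContinuousLinearMap.comp_apply]
  exact (tangentBundleCore I G).coordChange_self (achart H (1:G)) 1 (mem_chart_source H 1) _

theorem contMDiff_Ad_apply {N : Type*} {E' H' : Type*} [NormedAddCommGroup E'] [NormedSpace ℝ E'] [TopologicalSpace H']
   {J : ModelWithCorners ℝ E' H'} [TopologicalSpace N] [ChartedSpace H' N] [IsManifold J 1 N]
   {g : N → G} {V : N → E} (hg : ContMDiff J I ∞ g) (hV : ContMDiff J 𝓘(ℝ, E) ∞ V) :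
   ContMDiff J 𝓘(ℝ, E) ∞ (fun n => Ad I (g n) (V n)) := by
  intro x₀
  have hf : ContMDiff (J.prod I) I ∞ (Function.uncurry (fun (n:N) (x:G) => g n * x * (g n)⁻¹)) := by
    have h1 : ContMDiff (J.prod I) I ∞ (fun p : N × G => g p.1) := hg.comp contMDiff_fst
    exact (h1.mul contMDiff_snd).mul h1.inv
  have := ContMDiffAt.mfderiv_apply (m := ∞) (n := ∞) (I := I) (I' := I) (J := J) (J' := J) (x₀ := x₀) (fun (n:N) (x:G) => g n * x * (g n)⁻¹) (fun _ => 1) id V hf.contMDiffAt contMDiffAt_const contMDiffAt_id hV.contMDiffAt (by simp)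
  refine this.congr_of_eventuallyEq (Eventually.of_forall fun n => ?_)
  refine Eq.trans ?_ (DFunLike.congr_fun (inTC_one (J := I) (I := I) (fun _ : N => (1 : G))
    (fun n => g n * 1 * (g n)⁻¹) (fun n => Ad I (g n)) x₀ n (by simp) (by simp)
    (mem_chart_source H (1 : G))) (V n)).symm
  exact congrArg (Ad I (g n))
    ((tangentBundleCore I G).coordChange_self (achart H (1 : G)) 1 (mem_chart_source H 1) _).symm

theorem contMDiff_logAux {N : Type*} {E' H' : Type*} [NormedAddCommGroup E'] [NormedSpace ℝ E'] [TopologicalSpace H']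
   {J : ModelWithCorners ℝ E' H'} [TopologicalSpace N] [ChartedSpace H' N] [IsManifold J 1 N]
   {Ψ : N → unitInterval → G} {τ : N → unitInterval}
   (hΨ : ContMDiff (J.prod (𝓡∂ 1)) I ∞ (Function.uncurry Ψ)) (hτ : ContMDiff J (𝓡∂ 1) ∞ τ)
   (h1 : ∀ n, Ψ n (τ n) = 1) :
   ContMDiff J 𝓘(ℝ, E) ∞ (fun n => vel I (Ψ n) (τ n)) := by
  intro x₀
  have hf : ContMDiffOn (J.prod 𝓘(ℝ, ℝ)) I ∞ (Function.uncurry (fun (n:N) => Ψ n ∘ projIcc (0:ℝ) 1 zero_le_one)) (univ ×ˢ Icc 0 1) := by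
    refine hΨ.comp_contMDiffOn (f := fun p : N × ℝ => (p.1, projIcc (0:ℝ) 1 zero_le_one p.2)) ?_
    refine contMDiffOn_fst.prodMk ?_
    exact contMDiffOn_projIcc.comp contMDiffOn_snd (fun p hp => hp.2)
  have hτ' : ContMDiff J 𝓘(ℝ, ℝ) ∞ (fun n => (τ n : ℝ)) := contMDiff_subtypeVal_Icc.comp hτ
  have := ContMDiffWithinAt.mfderivWithin (m := ∞) (n := ∞) (I := 𝓘(ℝ, ℝ)) (I' := I) (J := J) (x₀ := x₀) (f := fun n => Ψ n ∘ projIcc (0:ℝ) 1 zero_le_one) (g := fun n => (τ n : ℝ)) (t := univ) (u := Icc 0 1) (hf _ ⟨mem_univ _, (τ x₀).2⟩) hτ'.contMDiffAt.contMDiffWithinAt (mem_univ _) (fun n _ => (τ n).2) (by simp) (uniqueDiffOn_Icc zero_lt_one).uniqueMDiffOn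
  rw [contMDiffWithinAt_univ] at this
  have h2 := this.clm_apply (contMDiffAt_const (c := (1:ℝ)))
  refine h2.congr_of_eventuallyEq (Eventually.of_forall fun n => ?_)
  refine Eq.trans ?_ (DFunLike.congr_fun (inTC_one (J := 𝓘(ℝ, ℝ)) (I := I)
    (fun n : N => (τ n : ℝ)) (fun n => (Ψ n ∘ projIcc (0 : ℝ) 1 zero_le_one) (τ n))
    (fun n => mfderiv[Icc (0 : ℝ) 1] (Ψ n ∘ projIcc (0 : ℝ) 1 zero_le_one) (τ n : ℝ))
    x₀ n (by simp [h1]) (by simp [h1]) (mem_univ _)) 1).symm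
  refine (mfderivWithin_comp_projIcc_one (f := Ψ n) (w := τ n)).symm.trans ?_
  refine congrArg (mfderiv[Icc (0 : ℝ) 1] (Ψ n ∘ projIcc (0 : ℝ) 1 zero_le_one) (τ n : ℝ)) ?_
  exact ((tangentBundleCore 𝓘(ℝ, ℝ) ℝ).coordChange_self (achart ℝ (τ n : ℝ)) _
    (mem_chart_source ℝ _) _).symm

theorem contMDiff_leftLog {N : Type*} {E' H' : Type*} [NormedAddCommGroup E'] [NormedSpace ℝ E'] [TopologicalSpace H']
   {J : ModelWithCorners ℝ E' H'} [TopologicalSpace N] [ChartedSpace H' N] [IsManifold J 1 N]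
   {Φ : N → unitInterval → G} {τ : N → unitInterval}
   (hΦ : ContMDiff (J.prod (𝓡∂ 1)) I ∞ (Function.uncurry Φ)) (hτ : ContMDiff J (𝓡∂ 1) ∞ τ) :
   ContMDiff J 𝓘(ℝ, E) ∞ (fun n => leftLog I (Φ n) (τ n)) := by
  refine contMDiff_logAux (Ψ := fun n t' => (Φ n (τ n))⁻¹ * Φ n t') ?_ hτ (by simp)
  have h1 : ContMDiff (J.prod (𝓡∂ 1)) I ∞ (fun p : N × unitInterval => Φ p.1 (τ p.1)) :=
    hΦ.comp (contMDiff_fst.prodMk (hτ.comp contMDiff_fst))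
  exact h1.inv.mul hΦ

theorem contMDiff_rightLog {N : Type*} {E' H' : Type*} [NormedAddCommGroup E'] [NormedSpace ℝ E'] [TopologicalSpace H']
   {J : ModelWithCorners ℝ E' H'} [TopologicalSpace N] [ChartedSpace H' N] [IsManifold J 1 N]
   {Φ : N → unitInterval → G} {τ : N → unitInterval}
   (hΦ : ContMDiff (J.prod (𝓡∂ 1)) I ∞ (Function.uncurry Φ)) (hτ : ContMDiff J (𝓡∂ 1) ∞ τ) :
   ContMDiff J 𝓘(ℝ, E) ∞ (fun n => rightLog I (Φ n) (τ n)) := by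
  refine contMDiff_logAux (Ψ := fun n t' => Φ n t' * (Φ n (τ n))⁻¹) ?_ hτ (by simp)
  have h1 : ContMDiff (J.prod (𝓡∂ 1)) I ∞ (fun p : N × unitInterval => Φ p.1 (τ p.1)) :=
    hΦ.comp (contMDiff_fst.prodMk (hτ.comp contMDiff_fst))
  exact hΦ.mul h1.inv

theorem contMDiff_bracket [FiniteDimensional ℝ E] {N : Type*} {E' H' : Type*} [NormedAddCommGroup E'] [NormedSpace ℝ E'] [TopologicalSpace H']
   {J : ModelWithCorners ℝ E' H'} [TopologicalSpace N] [ChartedSpace H' N] [IsManifold J 1 N]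
   {V W : N → E} (hV : ContMDiff J 𝓘(ℝ, E) ∞ V) (hW : ContMDiff J 𝓘(ℝ, E) ∞ W) :
   ContMDiff J 𝓘(ℝ, E) ∞ (fun n => bracket I G (V n) (W n)) := by
  have : LieGroup I (minSmoothness ℝ 3) G := LieGroup.of_le (n := ∞) (by
    rw [minSmoothness_of_isRCLikeNormedField]; exact ENat.LEInfty.out)
  have : CompleteSpace E := FiniteDimensional.complete ℝ E
  let b : E →ₗ[ℝ] E →ₗ[ℝ] E := LinearMap.mk₂ ℝ (bracket I G)
    (fun x y z => add_lie (L := GroupLieAlgebra I G) (M := GroupLieAlgebra I G) x y z)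
    (fun c x y => smul_lie (R := ℝ) (L := GroupLieAlgebra I G) (M := GroupLieAlgebra I G) c x y)
    (fun x y z => lie_add (L := GroupLieAlgebra I G) (M := GroupLieAlgebra I G) x y z)
    (fun c x y => lie_smul (R := ℝ) (L := GroupLieAlgebra I G) (M := GroupLieAlgebra I G) c x y)
  let b' : E →L[ℝ] E →L[ℝ] E := b.toContinuousBilinearMap
  have h : ContMDiff J 𝓘(ℝ, E) ∞ (fun n => b' (V n) (W n)) :=
    ((b'.contMDiff (n := ∞)).comp hV).clm_apply hW
  exact h

theorem vel_mul_of_eq_one {a b : unitInterval → G} {t : unitInterval}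
    (ha : MDifferentiableAt (𝓡∂ 1) I a t) (hb : MDifferentiableAt (𝓡∂ 1) I b t)
    (ha1 : a t = 1) (hb1 : b t = 1) :
    vel I (fun t' => a t' * b t') t = vel I a t + vel I b t := by
  have hm : MDifferentiableAt (I.prod I) I (fun p : G × G => p.1 * p.2) (a t, b t) :=
    (contMDiff_mul I ∞).mdifferentiableAt (by simp)
  have h : mfderiv (𝓡∂ 1) I (fun t' => a t' * b t') t = _ :=
    mfderiv_comp t hm (ha.prodMk hb)
  rw [vel, h, mfderiv_prodMk ha hb]
  refine (mfderiv_prod_eq_add_apply hm).trans ?_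
  refine congrArg₂ (fun x y : E => x + y) ?_ ?_
  · have : (fun z : G => z * (a t, b t).2) = id := by ext z; simp [hb1]
    rw [this, mfderiv_id]
    rfl
  · have : (fun z : G => (a t, b t).1 * z) = id := by ext z; simp [ha1]
    rw [this, mfderiv_id]
    rfl

theorem vel_conj_of_eq_one {a : unitInterval → G} {t : unitInterval} (g : G)
    (ha : MDifferentiableAt (𝓡∂ 1) I a t) (ha1 : a t = 1) :
    vel I (fun t' => g * a t' * g⁻¹) t = Ad I g (vel I a t) := by
  have hm : MDifferentiableAt I I (fun x : G => g * x * g⁻¹) (a t) :=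
    ((contMDiff_const.mul contMDiff_id).mul contMDiff_const : ContMDiff I I ∞ _).mdifferentiableAt
      (by simp)
  have h : mfderiv (𝓡∂ 1) I (fun t' => g * a t' * g⁻¹) t = _ := mfderiv_comp t hm ha
  rw [vel, h, ha1]
  rfl

theorem leftLog_mul {p q : unitInterval → G} (hp : ContMDiff (𝓡∂ 1) I ∞ p)
    (hq : ContMDiff (𝓡∂ 1) I ∞ q) (t : unitInterval) :
    leftLog I (fun t' => p t' * q t') t = Ad I (q t)⁻¹ (leftLog I p t) + leftLog I q t := by
  have hp' : ContMDiff (𝓡∂ 1) I ∞ (fun t' => (p t)⁻¹ * p t') := contMDiff_const.mul hp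
  have hq' : ContMDiff (𝓡∂ 1) I ∞ (fun t' => (q t)⁻¹ * q t') := contMDiff_const.mul hq
  have hc : ContMDiff (𝓡∂ 1) I ∞ (fun t' => (q t)⁻¹ * ((p t)⁻¹ * p t') * (q t)⁻¹⁻¹) :=
    (contMDiff_const.mul hp').mul contMDiff_const
  have h1 := vel_mul_of_eq_one (I := I) (t := t) (hc.mdifferentiableAt (by simp))
    (hq'.mdifferentiableAt (by simp)) (by simp) (by simp)
  have h2 := vel_conj_of_eq_one (I := I) (t := t) (q t)⁻¹ (hp'.mdifferentiableAt (by simp))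
    (by simp)
  rw [h2] at h1
  refine Eq.trans ?_ h1
  simp only [leftLog, mul_inv_rev, inv_inv, mul_assoc, mul_inv_cancel_left]

theorem rightLog_mul {p q : unitInterval → G} (hp : ContMDiff (𝓡∂ 1) I ∞ p)
    (hq : ContMDiff (𝓡∂ 1) I ∞ q) (t : unitInterval) :
    rightLog I (fun t' => p t' * q t') t = rightLog I p t + Ad I (p t) (rightLog I q t) := by
  have hp' : ContMDiff (𝓡∂ 1) I ∞ (fun t' => p t' * (p t)⁻¹) := hp.mul contMDiff_const
  have hq' : ContMDiff (𝓡∂ 1) I ∞ (fun t' => q t' * (q t)⁻¹) := hq.mul contMDiff_const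
  have hc : ContMDiff (𝓡∂ 1) I ∞ (fun t' => p t * (q t' * (q t)⁻¹) * (p t)⁻¹) :=
    (contMDiff_const.mul hq').mul contMDiff_const
  have h1 := vel_mul_of_eq_one (I := I) (t := t) (hp'.mdifferentiableAt (by simp))
    (hc.mdifferentiableAt (by simp)) (by simp) (by simp)
  have h2 := vel_conj_of_eq_one (I := I) (t := t) (p t) (hq'.mdifferentiableAt (by simp))
    (by simp)
  rw [h2] at h1
  refine Eq.trans ?_ h1
  simp only [rightLog, mul_inv_rev, mul_assoc, inv_mul_cancel_left]

theorem leftLog_const (g : G) (t : unitInterval) : leftLog I (fun _ => g) t = 0 := by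
  simp only [leftLog, vel, mfderiv_const]
  rfl

theorem rightLog_const (g : G) (t : unitInterval) : rightLog I (fun _ => g) t = 0 := by
  simp only [rightLog, vel, mfderiv_const]
  rfl
theorem bracket_zero_left [FiniteDimensional ℝ E] (X : E) :
    bracket I G 0 X = 0 := by
  have : LieGroup I (minSmoothness ℝ 3) G := LieGroup.of_le (n := ∞) (by
    rw [minSmoothness_of_isRCLikeNormedField]; exact ENat.LEInfty.out)
  have : CompleteSpace E := FiniteDimensional.complete ℝ E
  exact zero_lie (L := GroupLieAlgebra I G) (M := GroupLieAlgebra I G) X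

theorem bracket_zero_right [FiniteDimensional ℝ E] (X : E) :
    bracket I G X 0 = 0 := by
  have : LieGroup I (minSmoothness ℝ 3) G := LieGroup.of_le (n := ∞) (by
    rw [minSmoothness_of_isRCLikeNormedField]; exact ENat.LEInfty.out)
  have : CompleteSpace E := FiniteDimensional.complete ℝ E
  exact lie_zero (L := GroupLieAlgebra I G) (M := GroupLieAlgebra I G) X

theorem Ad_inv_cancel (g : G) (X : E) : Ad I g (Ad I g⁻¹ X) = X := by
  have h1 : MDifferentiableAt I I (fun x : G => g * x * g⁻¹) (g⁻¹ * 1 * g⁻¹⁻¹) :=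
    ((contMDiff_const.mul contMDiff_id).mul contMDiff_const : ContMDiff I I ∞ _).mdifferentiableAt
      (by simp)
  have h2 : MDifferentiableAt I I (fun x : G => g⁻¹ * x * g⁻¹⁻¹) 1 :=
    ((contMDiff_const.mul contMDiff_id).mul contMDiff_const : ContMDiff I I ∞ _).mdifferentiableAt
      (by simp)
  have h : mfderiv I I ((fun x : G => g * x * g⁻¹) ∘ fun x : G => g⁻¹ * x * g⁻¹⁻¹) 1 = _ :=
    mfderiv_comp 1 h1 h2
  have hid : (fun x : G => g * x * g⁻¹) ∘ (fun x : G => g⁻¹ * x * g⁻¹⁻¹) = id := by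
    ext x
    simp [mul_assoc]
  rw [hid, mfderiv_id, show g⁻¹ * (1 : G) * g⁻¹⁻¹ = 1 by simp] at h
  exact (DFunLike.congr_fun h X).symm

end Calculus

section Groups

/-! ### Path groups, loop groups and their Lie algebras -/

variable {E : Type*} [NormedAddCommGroup E] [NormedSpace ℝ E]
  {H : Type*} [TopologicalSpace H] (I : ModelWithCorners ℝ E H)
  (G : Type*) [TopologicalSpace G] [ChartedSpace H G] [Group G]

/-- A symmetric `Ad`-invariant bilinear form on the Lie algebra of `G`. -/
structure InvariantForm where
  form : E →L[ℝ] E →L[ℝ] ℝ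
  symm : ∀ X Y, form X Y = form Y X
  ad_invariant : ∀ (g : G) (X Y : E), form (Ad I g X) (Ad I g Y) = form X Y

variable [LieGroup I ∞ G]

/-- The based path group `P₀G`: smooth maps `p : [0,1] → G` with `p(0) = 1`, with the pointwise
product. -/
def PathGroup : Subgroup C^∞⟮𝓡∂ 1, unitInterval; I, G⟯ where
  carrier := {p | p 0 = 1}
  one_mem' := rfl
  mul_mem' {p q} hp hq := by
    change p 0 * q 0 = 1
    rw [show p 0 = 1 from hp, show q 0 = 1 from hq, mul_one]
  inv_mem' {p} hp := by
    change (p 0)⁻¹ = 1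
    rw [show p 0 = 1 from hp, inv_one]

/-- The group `P₀L₀G` of based paths in the based loop group: smooth maps `(s, r) ↦ f(s, r)`
(`s` the path parameter, `r` the loop parameter) with `f(0, r) = 1` and `f(s, 0) = f(s, 1) = 1`. -/
def PathLoopGroup :
    Subgroup C^∞⟮(𝓡∂ 1).prod (𝓡∂ 1), unitInterval × unitInterval; I, G⟯ where
  carrier := {f | (∀ r, f (0, r) = 1) ∧ ∀ s, f (s, 0) = 1 ∧ f (s, 1) = 1}
  one_mem' := ⟨fun _ => rfl, fun _ => ⟨rfl, rfl⟩⟩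
  mul_mem' {p q} hp hq := by
    refine ⟨fun r => ?_, fun s => ⟨?_, ?_⟩⟩
    · change p (0, r) * q (0, r) = 1
      rw [hp.1, hq.1, mul_one]
    · change p (s, 0) * q (s, 0) = 1
      rw [(hp.2 s).1, (hq.2 s).1, mul_one]
    · change p (s, 1) * q (s, 1) = 1
      rw [(hp.2 s).2, (hq.2 s).2, mul_one]
  inv_mem' {p} hp := by
    refine ⟨fun r => ?_, fun s => ⟨?_, ?_⟩⟩
    · change (p (0, r))⁻¹ = 1
      rw [hp.1, inv_one]
    · change (p (s, 0))⁻¹ = 1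
      rw [(hp.2 s).1, inv_one]
    · change (p (s, 1))⁻¹ = 1
      rw [(hp.2 s).2, inv_one]

variable {I G}

/-- The endpoint evaluation `♭ : P₀L₀G → L₀G ⊆ P₀G`, `f ↦ f(1, ·)`. -/
def endpoint (f : PathLoopGroup I G) : PathGroup I G :=
  ⟨⟨fun r => f.1 (1, r), f.1.contMDiff.comp (contMDiff_const.prodMk contMDiff_id)⟩, (f.2.2 1).1⟩

/-- The conjugation `(g f g⁻¹)(s, r) = g(r) f(s, r) g(r)⁻¹` of `f ∈ P₀L₀G` by `g ∈ P₀G`. -/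
def conj (g : PathGroup I G) (f : PathLoopGroup I G) : PathLoopGroup I G :=
  ⟨⟨fun x => g.1 x.2 * f.1 x * (g.1 x.2)⁻¹,
    ((g.1.contMDiff.comp contMDiff_snd).mul f.1.contMDiff).mul
      (g.1.contMDiff.comp contMDiff_snd).inv⟩, by
    refine ⟨fun r => ?_, fun s => ⟨?_, ?_⟩⟩
    · change g.1 r * f.1 (0, r) * (g.1 r)⁻¹ = 1
      rw [f.2.1, mul_one, mul_inv_cancel]
    · change g.1 0 * f.1 (s, 0) * (g.1 0)⁻¹ = 1
      rw [(f.2.2 s).1, mul_one, mul_inv_cancel]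
    · change g.1 1 * f.1 (s, 1) * (g.1 1)⁻¹ = 1
      rw [(f.2.2 s).2, mul_one, mul_inv_cancel]⟩

variable (E) in
/-- `P₀𝔤`: smooth maps `V : [0,1] → 𝔤` with `V(0) = 0`. -/
def PathAlgebra : Submodule ℝ C^∞⟮𝓡∂ 1, unitInterval; 𝓘(ℝ, E), E⟯ where
  carrier := {V | V 0 = 0}
  zero_mem' := rfl
  add_mem' {V W} hV hW := by
    change V 0 + W 0 = 0
    rw [show V 0 = 0 from hV, show W 0 = 0 from hW, add_zero]
  smul_mem' c V hV := by
    change c • V 0 = 0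
    rw [show V 0 = 0 from hV, smul_zero]

variable (E) in
/-- `L₀𝔤`: smooth maps `γ : [0,1] → 𝔤` with `γ(0) = γ(1) = 0`. -/
def LoopAlgebra : Submodule ℝ C^∞⟮𝓡∂ 1, unitInterval; 𝓘(ℝ, E), E⟯ where
  carrier := {γ | γ 0 = 0 ∧ γ 1 = 0}
  zero_mem' := ⟨rfl, rfl⟩
  add_mem' {V W} hV hW := by
    refine ⟨?_, ?_⟩
    · change V 0 + W 0 = 0
      rw [hV.1, hW.1, add_zero]
    · change V 1 + W 1 = 0
      rw [hV.2, hW.2, add_zero]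
  smul_mem' c V hV := by
    refine ⟨?_, ?_⟩
    · change c • V 0 = 0
      rw [hV.1, smul_zero]
    · change c • V 1 = 0
      rw [hV.2, smul_zero]

/-- The adjoint action of `P₀G` on `P₀𝔤`, `(g V g⁻¹)(r) = g(r) V(r) g(r)⁻¹`. -/
def adPath (g : PathGroup I G) (V : PathAlgebra E) : PathAlgebra E :=
  ⟨⟨fun r => Ad I (g.1 r) (V.1 r), contMDiff_Ad_apply g.1.contMDiff V.1.contMDiff⟩, by
    change Ad I (g.1 0) (V.1 0) = 0
    rw [show V.1 0 = 0 from V.2, map_zero]⟩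

/-- The adjoint action of `P₀G` on `L₀𝔤`. -/
def adLoop (g : PathGroup I G) (γ : LoopAlgebra E) : LoopAlgebra E :=
  ⟨⟨fun r => Ad I (g.1 r) (γ.1 r), contMDiff_Ad_apply g.1.contMDiff γ.1.contMDiff⟩, by
    refine ⟨?_, ?_⟩
    · change Ad I (g.1 0) (γ.1 0) = 0
      rw [γ.2.1, map_zero]
    · change Ad I (g.1 1) (γ.1 1) = 0
      rw [γ.2.2, map_zero]⟩

/-- The map `P = id - ℘ · ♭ : P₀𝔤 → L₀𝔤`, where `℘(0) = 0` and `℘(1) = 1`. -/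
def loopPart (wp : C^∞⟮𝓡∂ 1, unitInterval; 𝓘(ℝ, ℝ), ℝ⟯) (h0 : wp 0 = 0) (h1 : wp 1 = 1)
    (V : PathAlgebra E) : LoopAlgebra E :=
  ⟨⟨fun r => V.1 r - wp r • V.1 1, V.1.contMDiff.sub (wp.contMDiff.smul contMDiff_const)⟩, by
    refine ⟨?_, ?_⟩
    · change V.1 0 - wp 0 • V.1 1 = 0
      rw [show V.1 0 = 0 from V.2, h0, zero_smul, sub_zero]
    · change V.1 1 - wp 1 • V.1 1 = 0
      rw [h1, one_smul, sub_self]⟩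

/-- The path-loop adjustment `κ(g, V) = P(g V g⁻¹ - V)`. -/
def kappa (wp : C^∞⟮𝓡∂ 1, unitInterval; 𝓘(ℝ, ℝ), ℝ⟯) (h0 : wp 0 = 0) (h1 : wp 1 = 1)
    (g : PathGroup I G) (V : PathAlgebra E) : LoopAlgebra E :=
  loopPart wp h0 h1 (adPath g V - V)

section Bracket

variable [FiniteDimensional ℝ E]

variable (I G) in
/-- The pointwise Lie bracket of `P₀𝔤`. -/
def pathBracket (V W : PathAlgebra E) : PathAlgebra E :=
  ⟨⟨fun r => bracket I G (V.1 r) (W.1 r), contMDiff_bracket V.1.contMDiff W.1.contMDiff⟩, by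
    change bracket I G (V.1 0) (W.1 0) = 0
    rw [show V.1 0 = 0 from V.2]
    exact bracket_zero_left _⟩

variable (I G) in
/-- The pointwise Lie bracket `[V, γ] ∈ L₀𝔤` of `V ∈ P₀𝔤` and `γ ∈ L₀𝔤`. -/
def pathLoopBracket (V : PathAlgebra E) (γ : LoopAlgebra E) : LoopAlgebra E :=
  ⟨⟨fun r => bracket I G (V.1 r) (γ.1 r), contMDiff_bracket V.1.contMDiff γ.1.contMDiff⟩, by
    refine ⟨?_, ?_⟩
    · change bracket I G (V.1 0) (γ.1 0) = 0
      rw [γ.2.1]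
      exact bracket_zero_right _
    · change bracket I G (V.1 1) (γ.1 1) = 0
      rw [γ.2.2]
      exact bracket_zero_right _⟩

end Bracket

/-- The inclusion `L₀𝔤 → P₀𝔤`. -/
def loopIncl (γ : LoopAlgebra E) : PathAlgebra E := ⟨γ.1, γ.2.1⟩

end Groups

section Extension

/-! ### The Kac-Moody central extension of the loop group

The Lie algebra `𝔲(1) = iℝ` is `skewAdjoint ℂ`, and the circle group is `Circle`. -/

/-- The element `i x` of `𝔲(1) = iℝ`. -/
def imag (x : ℝ) : skewAdjoint ℂ := ⟨x * Complex.I, by simp [skewAdjoint.mem_iff]⟩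

variable {E : Type*} [NormedAddCommGroup E] [NormedSpace ℝ E]
  {H : Type*} [TopologicalSpace H] {I : ModelWithCorners ℝ E H}
  {G : Type*} [TopologicalSpace G] [ChartedSpace H G] [Group G] [LieGroup I ∞ G]

/-- `-(1/2π) ∫ dr ∫ ds ⟨f₁⁻¹ ∂f₁/∂s, (∂f₂/∂r) f₂⁻¹⟩`. -/
def logCocycle (B : InvariantForm I G) (f₁ f₂ : PathLoopGroup I G) : ℝ :=
  -(1 / (2 * Real.pi)) * ∫ x : unitInterval × unitInterval,
    B.form (leftLog I (fun s => f₁.1 (s, x.2)) x.1) (rightLog I (fun r => f₂.1 (x.1, r)) x.2)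

/-- The group cocycle
`c(f₁, f₂) = exp (-(i/2π) ∫ dr ∫ ds ⟨f₁⁻¹ ∂f₁/∂s, (∂f₂/∂r) f₂⁻¹⟩)`. -/
def cocycle (B : InvariantForm I G) (f₁ f₂ : PathLoopGroup I G) : Circle :=
  Circle.exp (logCocycle B f₁ f₂)

/-- The set `P₀L₀G × U(1)`, on which the form defines the product below. -/
@[ext]
structure ExtPath (B : InvariantForm I G) where
  path : PathLoopGroup I G
  phase : Circle

theorem integrable_logs (B : InvariantForm I G) (f₁ f₂ : PathLoopGroup I G)
    (φ : unitInterval × unitInterval → E → E)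
    (hφ : ∀ V : unitInterval × unitInterval → E,
      ContMDiff ((𝓡∂ 1).prod (𝓡∂ 1)) 𝓘(ℝ, E) ∞ V →
        ContMDiff ((𝓡∂ 1).prod (𝓡∂ 1)) 𝓘(ℝ, E) ∞ (fun x => φ x (V x))) :
    Integrable (fun x : unitInterval × unitInterval =>
      B.form (leftLog I (fun s => f₁.1 (s, x.2)) x.1)
        (φ x (rightLog I (fun r => f₂.1 (x.1, r)) x.2))) := by
  have h1 : ContMDiff ((𝓡∂ 1).prod (𝓡∂ 1)) 𝓘(ℝ, E) ∞
      (fun x : unitInterval × unitInterval => leftLog I (fun s => f₁.1 (s, x.2)) x.1) := by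
    refine contMDiff_leftLog (Φ := fun (x : unitInterval × unitInterval) s => f₁.1 (s, x.2))
      ?_ contMDiff_fst
    exact f₁.1.contMDiff.comp (contMDiff_snd.prodMk (contMDiff_snd.comp contMDiff_fst))
  have h2 : ContMDiff ((𝓡∂ 1).prod (𝓡∂ 1)) 𝓘(ℝ, E) ∞
      (fun x : unitInterval × unitInterval => rightLog I (fun r => f₂.1 (x.1, r)) x.2) := by
    refine contMDiff_rightLog (Φ := fun (x : unitInterval × unitInterval) r => f₂.1 (x.1, r))
      ?_ contMDiff_snd
    exact f₂.1.contMDiff.comp ((contMDiff_fst.comp contMDiff_fst).prodMk contMDiff_snd)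
  have h3 : Continuous (fun x : unitInterval × unitInterval =>
      B.form (leftLog I (fun s => f₁.1 (s, x.2)) x.1)
        (φ x (rightLog I (fun r => f₂.1 (x.1, r)) x.2))) :=
    (B.form.continuous.comp h1.continuous).clm_apply (hφ _ h2).continuous
  exact h3.integrable_of_hasCompactSupport (HasCompactSupport.of_compactSpace _)

theorem logCocycle_cocycle (B : InvariantForm I G) (f₁ f₂ f₃ : PathLoopGroup I G) :
    logCocycle B f₁ f₂ + logCocycle B (f₁ * f₂) f₃ =
      logCocycle B f₁ (f₂ * f₃) + logCocycle B f₂ f₃ := by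
  have smS (f : PathLoopGroup I G) (r : unitInterval) :
      ContMDiff (𝓡∂ 1) I ∞ (fun s => f.1 (s, r)) :=
    f.1.contMDiff.comp (contMDiff_id.prodMk contMDiff_const)
  have smR (f : PathLoopGroup I G) (s : unitInterval) :
      ContMDiff (𝓡∂ 1) I ∞ (fun r => f.1 (s, r)) :=
    f.1.contMDiff.comp (contMDiff_const.prodMk contMDiff_id)
  have hid : ∀ V : unitInterval × unitInterval → E,
      ContMDiff ((𝓡∂ 1).prod (𝓡∂ 1)) 𝓘(ℝ, E) ∞ V →
        ContMDiff ((𝓡∂ 1).prod (𝓡∂ 1)) 𝓘(ℝ, E) ∞ (fun x => V x) := fun V hV => hV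
  have i12 := integrable_logs B f₁ f₂ (fun _ X => X) hid
  have i23 := integrable_logs B f₂ f₃ (fun _ X => X) hid
  have i13 := integrable_logs B f₁ f₃ (fun x X => Ad I (f₂.1 x) X)
    (fun V hV => contMDiff_Ad_apply f₂.1.contMDiff hV)
  have e1 : ∀ x : unitInterval × unitInterval,
      B.form (leftLog I (fun s => (f₁ * f₂).1 (s, x.2)) x.1)
        (rightLog I (fun r => f₃.1 (x.1, r)) x.2) =
      B.form (leftLog I (fun s => f₁.1 (s, x.2)) x.1)
        (Ad I (f₂.1 x) (rightLog I (fun r => f₃.1 (x.1, r)) x.2)) +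
      B.form (leftLog I (fun s => f₂.1 (s, x.2)) x.1)
        (rightLog I (fun r => f₃.1 (x.1, r)) x.2) := by
    intro x
    have h := leftLog_mul (smS f₁ x.2) (smS f₂ x.2) x.1
    have h' : leftLog I (fun s => (f₁ * f₂).1 (s, x.2)) x.1 = _ := h
    rw [h', map_add, add_apply]
    congr 1
    rw [← B.ad_invariant (f₂.1 x)]
    congr 2
    exact Ad_inv_cancel _ _
  have e2 : ∀ x : unitInterval × unitInterval,
      B.form (leftLog I (fun s => f₁.1 (s, x.2)) x.1)
        (rightLog I (fun r => (f₂ * f₃).1 (x.1, r)) x.2) =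
      B.form (leftLog I (fun s => f₁.1 (s, x.2)) x.1)
        (rightLog I (fun r => f₂.1 (x.1, r)) x.2) +
      B.form (leftLog I (fun s => f₁.1 (s, x.2)) x.1)
        (Ad I (f₂.1 x) (rightLog I (fun r => f₃.1 (x.1, r)) x.2)) := by
    intro x
    have h := rightLog_mul (smR f₂ x.1) (smR f₃ x.1) x.2
    have h' : rightLog I (fun r => (f₂ * f₃).1 (x.1, r)) x.2 = _ := h
    rw [h', map_add]
  simp only [logCocycle, e1, e2]
  rw [integral_add i13 i23, integral_add i12 i13]
  ring

theorem logCocycle_one_left (B : InvariantForm I G) (f : PathLoopGroup I G) :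
    logCocycle B 1 f = 0 := by
  have h (x : unitInterval × unitInterval) :
      leftLog I (fun s => (1 : PathLoopGroup I G).1 (s, x.2)) x.1 = 0 := leftLog_const 1 _
  simp only [logCocycle, h]
  simp

theorem logCocycle_one_right (B : InvariantForm I G) (f : PathLoopGroup I G) :
    logCocycle B f 1 = 0 := by
  have h (x : unitInterval × unitInterval) :
      rightLog I (fun r => (1 : PathLoopGroup I G).1 (x.1, r)) x.2 = 0 := rightLog_const 1 _
  simp only [logCocycle, h]
  simp

/-- The group structure `(f₁, z₁)(f₂, z₂) = (f₁ f₂, z₁ z₂ c(f₁, f₂))` on `P₀L₀G × U(1)`. -/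
instance (B : InvariantForm I G) : Group (ExtPath B) where
  mul x y := ⟨x.path * y.path, x.phase * y.phase * cocycle B x.path y.path⟩
  one := ⟨1, 1⟩
  inv x := ⟨x.path⁻¹, (x.phase * cocycle B x.path x.path⁻¹)⁻¹⟩
  mul_assoc x y z := by
    refine ExtPath.ext (mul_assoc _ _ _) ?_
    change x.phase * y.phase * cocycle B x.path y.path * z.phase *
        cocycle B (x.path * y.path) z.path =
      x.phase * (y.phase * z.phase * cocycle B y.path z.path) *
        cocycle B x.path (y.path * z.path)
    have h : cocycle B x.path y.path * cocycle B (x.path * y.path) z.path =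
        cocycle B x.path (y.path * z.path) * cocycle B y.path z.path := by
      simp only [cocycle, ← Circle.exp_add, logCocycle_cocycle]
    calc _ = x.phase * y.phase * z.phase *
          (cocycle B x.path y.path * cocycle B (x.path * y.path) z.path) := by
          simp only [mul_assoc, mul_comm, mul_left_comm]
      _ = _ := by
          rw [h]
          simp only [mul_assoc, mul_comm, mul_left_comm]
  one_mul x := by
    refine ExtPath.ext (one_mul _) ?_
    change 1 * x.phase * cocycle B 1 x.path = x.phase
    simp [cocycle, logCocycle_one_left]
  mul_one x := by
    refine ExtPath.ext (mul_one _) ?_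
    change x.phase * 1 * cocycle B x.path 1 = x.phase
    simp [cocycle, logCocycle_one_right]
  inv_mul_cancel x := by
    refine ExtPath.ext (inv_mul_cancel _) ?_
    change (x.phase * cocycle B x.path x.path⁻¹)⁻¹ * x.phase * cocycle B x.path⁻¹ x.path = 1
    have h : cocycle B x.path⁻¹ x.path = cocycle B x.path x.path⁻¹ := by
      have := logCocycle_cocycle B x.path x.path⁻¹ x.path
      rw [mul_inv_cancel, inv_mul_cancel, logCocycle_one_left, logCocycle_one_right] at this
      rw [cocycle, cocycle]
      congr 1
      linarith
    rw [h, mul_assoc, inv_mul_cancel]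

variable (I) in
/-- A disc in `L₀G`: a smooth map `(u, s, r) ↦ F(u, s, r) ∈ G` such that each `F(u, s, ·)` is a
based loop, and `(u, s) ↦ F(u, s, ·)` is the constant loop `1` on the three sides `u = 0`, `s = 0`,
`s = 1` of the unit square. Its boundary is the based loop `s ↦ F(1, s, ·)` in `L₀G`. -/
def IsDisc (F : C^∞⟮(𝓡∂ 1).prod ((𝓡∂ 1).prod (𝓡∂ 1)),
    unitInterval × unitInterval × unitInterval; I, G⟯) : Prop :=
  (∀ s r, F (0, s, r) = 1) ∧ (∀ u r, F (u, 0, r) = 1 ∧ F (u, 1, r) = 1) ∧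
    ∀ u s, F (u, s, 0) = 1 ∧ F (u, s, 1) = 1

/-- `(1/i) ∫_F ω`, the integral over a disc of the left-invariant two-form `ω` on `L₀G` whose
value on `β₁, β₂ ∈ L₀𝔤` is `(i/2π) ∫ dr ⟨β₁(r), ∂β₂/∂r⟩`. -/
def discIntegral (B : InvariantForm I G) (F : C^∞⟮(𝓡∂ 1).prod ((𝓡∂ 1).prod (𝓡∂ 1)),
    unitInterval × unitInterval × unitInterval; I, G⟯) : ℝ :=
  1 / (2 * Real.pi) * ∫ x : unitInterval × unitInterval × unitInterval,
    B.form (leftLog I (fun u => F (u, x.2.1, x.2.2)) x.1)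
      (vel 𝓘(ℝ, E) (fun r => leftLog I (fun s => F (x.1, s, r)) x.2.1) x.2.2)

/-- The form is integral if the holonomy `exp (-∫_F ω)` depends only on the boundary of the disc
`F`, that is, if `∫_F ω ∈ 2πiℤ` for every disc with constant boundary. -/
def InvariantForm.IsIntegral (B : InvariantForm I G) : Prop :=
  ∀ F, IsDisc I F → (∀ s r, F (1, s, r) = (1 : G)) → Circle.exp (discIntegral B F) = 1

/-- The set `N` of all `(f, exp (∫_F ω))`, where `f ∈ L₀L₀G` is the boundary of a disc `F`. -/
def holonomySet (B : InvariantForm I G) : Set (ExtPath B) :=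
  {x | ∃ F, IsDisc I F ∧ (∀ s r, F (1, s, r) = x.path.1 (s, r)) ∧
    x.phase = Circle.exp (discIntegral B F)}

/-- The Kac-Moody extension `(P₀L₀G × U(1)) / N` of the loop group. The quotient is taken by the
normal subgroup generated by `N`; that this is `N` itself is part of the theorem. -/
abbrev LoopExt (B : InvariantForm I G) : Type _ :=
  ExtPath B ⧸ Subgroup.normalClosure (holonomySet B)

/-- The class `[(f, z)]`. -/
def cls (B : InvariantForm I G) (x : ExtPath B) : LoopExt B := QuotientGroup.mk x

/-- `g ▷ (f, z) = (g f g⁻¹, z exp ((i/2π) ∫ dr ∫ ds ⟨f⁻¹ ∂f/∂s, g⁻¹ ∂g/∂r⟩))`. -/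
def actExt (B : InvariantForm I G) (g : PathGroup I G) (x : ExtPath B) : ExtPath B :=
  ⟨conj g x.path, x.phase * Circle.exp (1 / (2 * Real.pi) *
    ∫ y : unitInterval × unitInterval,
      B.form (leftLog I (fun s => x.path.1 (s, y.2)) y.1) (leftLog I g.1 y.2))⟩

end Extension

section CrossedModules

/-! ### Crossed modules and adjustments -/

/-- A crossed module of groups `(t : H → G, ▷)`. -/
structure CrossedModule (H G : Type*) [Group H] [Group G] where
  t : H →* G
  act : G →* MulAut H
  t_act : ∀ g h, t (act g h) = g * t h * g⁻¹
  peiffer : ∀ h₁ h₂, act (t h₁) h₂ = h₁ * h₂ * h₁⁻¹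

variable {H G 𝔥 𝔤 : Type*} [Group H] [Group G]
  [AddCommGroup 𝔥] [Module ℝ 𝔥] [AddCommGroup 𝔤] [Module ℝ 𝔤]

/-- Let `velH c W` and `velG c V` express that `c` is a smooth curve through `1` in `H` and `G` with
tangent vector `W ∈ 𝔥` and `V ∈ 𝔤`. Every element of `𝔥` and `𝔤` is such a tangent vector, and
`Ad g : 𝔤 → 𝔤`, `tL : 𝔥 → 𝔤` and `actL g : 𝔥 → 𝔥` are the linear maps that are the derivatives at
`1` of the conjugation by `g`, of `t` and of the action of `g`. -/
structure IsLinearisation (X : CrossedModule H G) (velH : (ℝ → H) → 𝔥 → Prop)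
    (velG : (ℝ → G) → 𝔤 → Prop) (Ad : G → 𝔤 → 𝔤) (tL : 𝔥 → 𝔤) (actL : G → 𝔥 → 𝔥) : Prop where
  exists_velH : ∀ W, ∃ c, velH c W
  exists_velG : ∀ V, ∃ c, velG c V
  linear_Ad : ∀ g, IsLinearMap ℝ (Ad g)
  linear_t : IsLinearMap ℝ tL
  linear_act : ∀ g, IsLinearMap ℝ (actL g)
  deriv_Ad : ∀ g c V, velG c V → velG (fun ε => g * c ε * g⁻¹) (Ad g V)
  deriv_t : ∀ c W, velH c W → velG (fun ε => X.t (c ε)) (tL W)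
  deriv_act : ∀ g c W, velH c W → velH (fun ε => X.act g (c ε)) (actL g W)

/-- `κ : G × 𝔤 → 𝔥` is an adjustment of the crossed module: it is linear in `𝔤` and satisfies
`κ(t(h), V) = h (V ▷ h⁻¹)` and `κ(g₂ g₁, V) = g₂ ▷ κ(g₁, V) + κ(g₂, g₁ V g₁⁻¹ - t(κ(g₁, V)))`.
Here `h (V ▷ h⁻¹) ∈ 𝔥` is the derivative of `g ↦ h (g ▷ h⁻¹)` at `g = 1` in the direction `V`. -/
structure IsAdjustment (X : CrossedModule H G) (velH : (ℝ → H) → 𝔥 → Prop)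
    (velG : (ℝ → G) → 𝔤 → Prop) (Ad : G → 𝔤 → 𝔤) (tL : 𝔥 → 𝔤) (actL : G → 𝔥 → 𝔥)
    (κ : G → 𝔤 → 𝔥) : Prop where
  linear : ∀ g, IsLinearMap ℝ (κ g)
  on_image : ∀ h V c, velG c V → velH (fun ε => h * X.act (c ε) h⁻¹) (κ (X.t h) V)
  on_mul : ∀ g₂ g₁ V,
    κ (g₂ * g₁) V = actL g₂ (κ g₁ V) + κ g₂ (Ad g₁ V - tL (κ g₁ V))

/-- `f` is bilinear. -/
def IsBilinear {U V W : Type*} [AddCommGroup U] [Module ℝ U] [AddCommGroup V] [Module ℝ V]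
    [AddCommGroup W] [Module ℝ W] (f : U → V → W) : Prop :=
  (∀ u, IsLinearMap ℝ (f u)) ∧ ∀ v, IsLinearMap ℝ (fun u => f u v)

/-- `b` is a Lie bracket on the real vector space `V`. -/
structure IsLieBracket {V : Type*} [AddCommGroup V] [Module ℝ V] (b : V → V → V) : Prop where
  bilinear : IsBilinear b
  alternating : ∀ x, b x x = 0
  jacobi : ∀ x y z, b x (b y z) = b (b x y) z + b y (b x z)

/-- `(t : 𝔥 → 𝔤, ▷)` is a crossed module of Lie algebras, where `bH` and `bG` are the brackets. -/
structure IsLieCrossedModule (bH : 𝔥 → 𝔥 → 𝔥) (bG : 𝔤 → 𝔤 → 𝔤) (t : 𝔥 → 𝔤)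
    (act : 𝔤 → 𝔥 → 𝔥) : Prop where
  lie_H : IsLieBracket bH
  lie_G : IsLieBracket bG
  linear_t : IsLinearMap ℝ t
  bilinear_act : IsBilinear act
  t_bracket : ∀ W₁ W₂, t (bH W₁ W₂) = bG (t W₁) (t W₂)
  bracket_act : ∀ V₁ V₂ W, act (bG V₁ V₂) W = act V₁ (act V₂ W) - act V₂ (act V₁ W)
  act_bracket : ∀ V W₁ W₂, act V (bH W₁ W₂) = bH (act V W₁) W₂ + bH W₁ (act V W₂)
  t_act : ∀ V W, t (act V W) = bG V (t W)
  peiffer : ∀ W₁ W₂, act (t W₁) W₂ = bH W₁ W₂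

/-- `κ : 𝔤 × 𝔤 → 𝔥` is an (infinitesimal) adjustment of a crossed module of Lie algebras. -/
structure IsLieAdjustment (bG : 𝔤 → 𝔤 → 𝔤) (t : 𝔥 → 𝔤) (act : 𝔤 → 𝔥 → 𝔥)
    (κ : 𝔤 → 𝔤 → 𝔥) : Prop where
  bilinear : IsBilinear κ
  on_image : ∀ W V, κ (t W) V = -act V W
  on_bracket : ∀ V₁ V₂ V₃, κ (bG V₁ V₂) V₃ =
    act V₁ (κ V₂ V₃) - act V₂ (κ V₁ V₃) + κ V₁ (bG V₂ V₃) - κ V₂ (bG V₁ V₃)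
      - κ V₁ (t (κ V₂ V₃)) + κ V₂ (t (κ V₁ V₃))

end CrossedModules

section StringTwoGroup

/-! ### The string 2-group, its Lie algebra data and the map `κ̂` -/

variable {E : Type*} [NormedAddCommGroup E] [NormedSpace ℝ E]
  {H : Type*} [TopologicalSpace H] {I : ModelWithCorners ℝ E H}
  {G : Type*} [TopologicalSpace G] [ChartedSpace H G] [Group G] [LieGroup I ∞ G]

/-- `X` is the string 2-group model `String(G) = ((P₀L₀G × U(1)) / N → P₀G, ▷)`, with
`t[(f, z)] = ♭(f)` and `g ▷ [(f, z)] = [g ▷ (f, z)]`. As every element is a class `[(f, z)]`,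
these formulas determine `X`. -/
def IsStringTwoGroup (B : InvariantForm I G) (X : CrossedModule (LoopExt B) (PathGroup I G)) :
    Prop :=
  (∀ x, X.t (cls B x) = endpoint x.path) ∧ ∀ g x, X.act g (cls B x) = cls B (actExt B g x)

/-- `c` is a smooth curve in `P₀G` with `c(0) = 1` and tangent vector `V ∈ P₀𝔤` at `ε = 0`. -/
def HasVelPath (c : ℝ → PathGroup I G) (V : PathAlgebra E) : Prop :=
  ContMDiff (𝓘(ℝ, ℝ).prod (𝓡∂ 1)) I ∞ (fun x : ℝ × unitInterval => (c x.1).1 x.2) ∧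
    c 0 = 1 ∧ ∀ r, V.1 r = velZero I (fun ε => (c ε).1 r)

variable (E) in
/-- `L₀𝔤 ⊕ 𝔲(1)`, the underlying vector space of the Lie algebra of `(P₀L₀G × U(1)) / N`. -/
abbrev LoopExtAlgebra : Type _ := LoopAlgebra E × skewAdjoint ℂ

/-- `c` is a smooth curve in `(P₀L₀G × U(1)) / N` with `c(0) = 1` and tangent vector
`W ∈ L₀𝔤 ⊕ 𝔲(1)` at `ε = 0`: it lifts to a smooth curve in `P₀L₀G × U(1)` through `1`, with tangent
vector `(γ, q) ∈ P₀L₀𝔤 ⊕ 𝔲(1)`, and `W = (♭(γ), q)` is the class of `(γ, q)` modulo the Lie algebra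
`L₀L₀𝔤 ⊕ 0` of `N`. -/
def HasVelExt (B : InvariantForm I G) (c : ℝ → LoopExt B) (W : LoopExtAlgebra E) : Prop :=
  ∃ x : ℝ → ExtPath B,
    ContMDiff (𝓘(ℝ, ℝ).prod ((𝓡∂ 1).prod (𝓡∂ 1))) I ∞
      (fun y : ℝ × unitInterval × unitInterval => (x y.1).path.1 y.2) ∧
    ContDiff ℝ ∞ (fun ε => ((x ε).phase : ℂ)) ∧
    x 0 = 1 ∧ (∀ ε, c ε = cls B (x ε)) ∧
    (∀ r, W.1.1 r = velZero I (fun ε => (x ε).path.1 (1, r))) ∧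
    (W.2 : ℂ) = deriv (fun ε => ((x ε).phase : ℂ)) 0

/-- The linearisation `t(γ, q) = γ` of `t`. -/
def tAlg (W : LoopExtAlgebra E) : PathAlgebra E := loopIncl W.1

/-- The linearisation `g ▷ (γ, q) = (g γ g⁻¹, q + (i/2π) ∫ dr ⟨γ, g⁻¹ ∂g/∂r⟩)` of the action of
`g ∈ P₀G`. -/
def actGroupAlg (B : InvariantForm I G) (g : PathGroup I G) (W : LoopExtAlgebra E) :
    LoopExtAlgebra E :=
  (adLoop g W.1, W.2 + imag (1 / (2 * Real.pi) *
    ∫ r : unitInterval, B.form (W.1.1 r) (leftLog I g.1 r)))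

/-- The map `κ̂(g, V) = (κ(g, V), (i/2π) ∫ dr ⟨g⁻¹ ∂g/∂r, V⟩)`. -/
def kappaHat (B : InvariantForm I G) (wp : C^∞⟮𝓡∂ 1, unitInterval; 𝓘(ℝ, ℝ), ℝ⟯)
    (h0 : wp 0 = 0) (h1 : wp 1 = 1) (g : PathGroup I G) (V : PathAlgebra E) :
    LoopExtAlgebra E :=
  (kappa wp h0 h1 g V, imag (1 / (2 * Real.pi) *
    ∫ r : unitInterval, B.form (leftLog I g.1 r) (V.1 r)))

/-- Convergence of maps `[0,1] → 𝔤` in the Fréchet topology of `C^∞([0,1], 𝔤)`: all derivatives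
converge uniformly. -/
def SmoothTendsto {α : Type*} (l : Filter α) (u : α → unitInterval → E) (γ : unitInterval → E) :
    Prop :=
  ∀ k : ℕ, TendstoUniformly (fun a => (vel 𝓘(ℝ, E))^[k] (u a)) ((vel 𝓘(ℝ, E))^[k] γ) l

/-- Convergence in `P₀𝔤`. -/
def TendstoPath {α : Type*} (l : Filter α) (u : α → PathAlgebra E) (V : PathAlgebra E) : Prop :=
  SmoothTendsto l (fun a => ⇑(u a).1) ⇑V.1

/-- Convergence in `L₀𝔤 ⊕ 𝔲(1)`. -/
def TendstoExt {α : Type*} (l : Filter α) (u : α → LoopExtAlgebra E) (W : LoopExtAlgebra E) :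
    Prop :=
  SmoothTendsto l (fun a => ⇑(u a).1.1) ⇑W.1.1 ∧ Tendsto (fun a => (u a).2) l (𝓝 W.2)

variable [FiniteDimensional ℝ E]

/-- The Lie bracket `[(γ₁, q₁), (γ₂, q₂)] = ([γ₁, γ₂], -(i/2π) ∫ dr ⟨γ₁, ∂γ₂/∂r⟩)`. -/
def bracketExt (B : InvariantForm I G) (W₁ W₂ : LoopExtAlgebra E) : LoopExtAlgebra E :=
  (pathLoopBracket I G (loopIncl W₁.1) W₂.1, imag (-(1 / (2 * Real.pi)) *
    ∫ r : unitInterval, B.form (W₁.1.1 r) (vel 𝓘(ℝ, E) W₂.1.1 r)))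

/-- The action `V ▷ (γ, q) = ([V, γ], (i/2π) ∫ dr ⟨∂V/∂r, γ⟩)` of `P₀𝔤`. -/
def actAlg (B : InvariantForm I G) (V : PathAlgebra E) (W : LoopExtAlgebra E) :
    LoopExtAlgebra E :=
  (pathLoopBracket I G V W.1, imag (1 / (2 * Real.pi) *
    ∫ r : unitInterval, B.form (vel 𝓘(ℝ, E) V.1 r) (W.1.1 r)))

/-- The infinitesimal map `κ̂(V₁, V₂) = (P[V₁, V₂], (i/2π) ∫ dr ⟨∂V₁/∂r, V₂⟩)`. -/
def kappaHatAlg (B : InvariantForm I G) (wp : C^∞⟮𝓡∂ 1, unitInterval; 𝓘(ℝ, ℝ), ℝ⟯)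
    (h0 : wp 0 = 0) (h1 : wp 1 = 1) (V₁ V₂ : PathAlgebra E) : LoopExtAlgebra E :=
  (loopPart wp h0 h1 (pathBracket I G V₁ V₂), imag (1 / (2 * Real.pi) *
    ∫ r : unitInterval, B.form (vel 𝓘(ℝ, E) V₁.1 r) (V₂.1 r)))

end StringTwoGroup

end StringTwoGroup

end

open StringTwoGroup

/-!
The analytic core is the Polyakov-Wiegmann formula `discDensity_mul`: for maps `F₁, F₂ : [0,1]³ → G`
the integrand of `∫ ω` over `F₁ F₂` is the sum of the integrands over `F₁` and `F₂`, up to total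
derivatives. It is a pointwise computation with logarithmic derivatives, which rests on three facts.
The derivative of `g ↦ Ad g X` at `1` is the Lie bracket (`mfderiv_Ad_apply`); this is shown by
writing `g X = (Ad g X) g` in the chart at `1` and using the symmetry of the second derivative of
the product. Hence the form is invariant in the infinitesimal sense (`InvariantForm.form_bracket`),
and the Maurer-Cartan equation holds (`vel_leftLog_eq_vel_leftLog_add`). Integrated over the cube
(`cubeIntegral_mul`), the total derivatives become values of the cocycle on the faces.

All group-theoretic claims follow from this multiplicativity. For two discs it says that `N` is
closed under products; for a disc and a map independent of `u` it says that `N` is normal and stable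
under the action of `P₀G`. A homotopy of paths in the loop group with fixed ends identifies its two
ends up to the phase `exp ∫ ω` (`div_mem_holonomySet`), and the Peiffer identity is the case of the
homotopy `h f₂ h⁻¹`, where `h` contracts `f₁` to its end point
(`actExt_endpoint_div_mem_holonomySet`). The phase of the action is itself a value of the cocycle
(`squareCocycle_inv`), so that `▷` is an action by automorphisms because of the cocycle identity
(`squareCocycle_cocycle`).

Curves with a given tangent vector are constructed in the chart at `1` (`exists_curve_velZero_eq`).
Two lifts of a curve in the extension differ by a curve `k_ε` in `N`; if the form is integral, the
phase of `k_ε` is the integral over the disc `k_{uε}`, and this vanishes to second order in `ε`, so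
the tangent vector is unique (`HasVelExt.unique`).

The phase of the curve `h (c_ε ▷ h⁻¹)` is a sum of cocycles. Its derivative is the integral over
the square of the exterior derivative of the one-form `⟨f⁻¹ df, V⟩`, and Stokes' theorem
(`integral_form_leftLog_eq`) turns it into the integral over `[0,1]` in the definition of the
adjustment (`hasVelExt_mul_act_inv`). The limits hold with all derivatives since the difference
quotients of a smooth family on the compact interval converge uniformly and differentiation in `r`
commutes with differentiation in `ε` (`smoothTendsto_slope`).

On the Lie algebra side everything reduces to the pairing `∫ ⟨∂V, W⟩`: it is antisymmetric when one
entry is a loop, by integration by parts (`velPairing_comm`), and satisfies a cocycle identity by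
invariance of the form (`velPairing_pathBracket`). In particular the bracket of the central
extension is the action through `t` (`bracketExt_eq_actAlg`).
-/

namespace StringTwoGroup

/-! ### Calculus on the unit interval -/

section IntervalCalculus

variable {F F₁ F₂ F₃ : Type*} [NormedAddCommGroup F] [NormedSpace ℝ F]
  [NormedAddCommGroup F₁] [NormedSpace ℝ F₁] [NormedAddCommGroup F₂] [NormedSpace ℝ F₂]
  [NormedAddCommGroup F₃] [NormedSpace ℝ F₃]

/-- `f : [0,1] → F` has derivative `f'` at `t` (one-sided at the end points). -/
def HasVelAt (f : unitInterval → F) (f' : F) (t : unitInterval) : Prop :=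
  HasDerivWithinAt (f ∘ projIcc (0 : ℝ) 1 zero_le_one) f' (Icc 0 1) t

/-- The velocity of a map on `[0,1]` is the derivative within `[0,1]` of its constant extension to
`ℝ`; this transfers the calculus of functions on subsets of `ℝ` to the manifold with boundary
`[0,1]`. -/
theorem vel_eq_derivWithin (f : unitInterval → F) (t : unitInterval) :
    vel 𝓘(ℝ, F) f t = derivWithin (f ∘ projIcc (0 : ℝ) 1 zero_le_one) (Icc 0 1) t := by
  have h := mfderivWithin_comp_projIcc_one (I := 𝓘(ℝ, F)) (f := f) (w := t)
  rw [mfderivWithin_eq_fderivWithin] at h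
  exact h.symm

theorem HasVelAt.vel_eq {f : unitInterval → F} {f' : F} {t : unitInterval} (h : HasVelAt f f' t) :
    vel 𝓘(ℝ, F) f t = f' := by
  rw [vel_eq_derivWithin]
  exact h.derivWithin (uniqueDiffOn_Icc zero_lt_one _ t.2)

theorem hasVelAt_of_mdifferentiableAt {f : unitInterval → F} {t : unitInterval}
    (h : MDifferentiableAt (𝓡∂ 1) 𝓘(ℝ, F) f t) : HasVelAt f (vel 𝓘(ℝ, F) f t) t := by
  rw [vel_eq_derivWithin]
  refine DifferentiableWithinAt.hasDerivWithinAt ?_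
  exact (mdifferentiableWithinAt_comp_projIcc_iff.2 h).differentiableWithinAt

theorem hasVelAt_of_contMDiff {f : unitInterval → F} (h : ContMDiff (𝓡∂ 1) 𝓘(ℝ, F) ∞ f)
    (t : unitInterval) : HasVelAt f (vel 𝓘(ℝ, F) f t) t :=
  hasVelAt_of_mdifferentiableAt (h.mdifferentiableAt (by simp))

theorem hasVelAt_const (c : F) (t : unitInterval) : HasVelAt (fun _ => c) 0 t :=
  hasDerivWithinAt_const _ _ _

theorem HasVelAt.add {f g : unitInterval → F} {f' g' : F} {t : unitInterval}
    (hf : HasVelAt f f' t) (hg : HasVelAt g g' t) : HasVelAt (fun t => f t + g t) (f' + g') t :=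
  HasDerivWithinAt.add hf hg

theorem HasVelAt.neg {f : unitInterval → F} {f' : F} {t : unitInterval}
    (hf : HasVelAt f f' t) : HasVelAt (fun t => -f t) (-f') t :=
  HasDerivWithinAt.neg hf

theorem HasVelAt.clm (L : F →L[ℝ] F₁) {f : unitInterval → F} {f' : F}
    {t : unitInterval} (hf : HasVelAt f f' t) : HasVelAt (fun t => L (f t)) (L f') t :=
  L.hasFDerivAt.comp_hasDerivWithinAt _ hf

theorem HasVelAt.bilin (b : F₁ →L[ℝ] F₂ →L[ℝ] F₃) {f : unitInterval → F₁} {g : unitInterval → F₂}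
    {f' : F₁} {g' : F₂} {t : unitInterval} (hf : HasVelAt f f' t) (hg : HasVelAt g g' t) :
    HasVelAt (fun t => b (f t) (g t)) (b f' (g t) + b (f t) g') t := by
  have h := (b.hasFDerivAt.comp_hasDerivWithinAt _ hf).clm_apply hg
  simpa [HasVelAt, Function.comp_def] using h

section Joint

variable {N E' H' : Type*} [NormedAddCommGroup E'] [NormedSpace ℝ E'] [TopologicalSpace H']
  {J : ModelWithCorners ℝ E' H'} [TopologicalSpace N] [ChartedSpace H' N] [IsManifold J 1 N]

theorem contMDiff_vel {Ψ : N → unitInterval → F} {τ : N → unitInterval}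
    (hΨ : ContMDiff (J.prod (𝓡∂ 1)) 𝓘(ℝ, F) ∞ (Function.uncurry Ψ))
    (hτ : ContMDiff J (𝓡∂ 1) ∞ τ) :
    ContMDiff J 𝓘(ℝ, F) ∞ (fun n => vel 𝓘(ℝ, F) (Ψ n) (τ n)) := by
  intro x₀
  have hf : ContMDiffOn (J.prod 𝓘(ℝ, ℝ)) 𝓘(ℝ, F) ∞
      (Function.uncurry (fun (n : N) => Ψ n ∘ projIcc (0:ℝ) 1 zero_le_one)) (univ ×ˢ Icc 0 1) := by
    refine hΨ.comp_contMDiffOn (f := fun p : N × ℝ => (p.1, projIcc (0:ℝ) 1 zero_le_one p.2)) ?_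
    refine contMDiffOn_fst.prodMk ?_
    exact contMDiffOn_projIcc.comp contMDiffOn_snd (fun p hp => hp.2)
  have hτ' : ContMDiff J 𝓘(ℝ, ℝ) ∞ (fun n => (τ n : ℝ)) := contMDiff_subtypeVal_Icc.comp hτ
  have := ContMDiffWithinAt.mfderivWithin (m := ∞) (n := ∞) (I := 𝓘(ℝ, ℝ)) (I' := 𝓘(ℝ, F)) (J := J)
    (x₀ := x₀) (f := fun n => Ψ n ∘ projIcc (0:ℝ) 1 zero_le_one) (g := fun n => (τ n : ℝ))
    (t := univ) (u := Icc 0 1) (hf _ ⟨mem_univ _, (τ x₀).2⟩) hτ'.contMDiffAt.contMDiffWithinAt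
    (mem_univ _) (fun n _ => (τ n).2) (by simp) (uniqueDiffOn_Icc zero_lt_one).uniqueMDiffOn
  rw [contMDiffWithinAt_univ] at this
  have h2 := this.clm_apply (contMDiffAt_const (c := (1:ℝ)))
  refine h2.congr_of_eventuallyEq (Eventually.of_forall fun n => ?_)
  refine Eq.trans ?_ (DFunLike.congr_fun (congrFun (inTangentCoordinates_model_space
    (I := 𝓘(ℝ, ℝ)) (fun n : N => (τ n : ℝ)) (fun n => (Ψ n ∘ projIcc (0 : ℝ) 1 zero_le_one) (τ n))
    (fun n => mfderiv[Icc (0 : ℝ) 1] (Ψ n ∘ projIcc (0 : ℝ) 1 zero_le_one) (τ n : ℝ)) x₀) n) 1).symm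
  exact (mfderivWithin_comp_projIcc_one (f := Ψ n) (w := τ n)).symm

theorem contMDiff_deriv {Ψ : N → ℝ → F} {τ : N → ℝ}
    (hΨ : ContMDiff (J.prod 𝓘(ℝ, ℝ)) 𝓘(ℝ, F) ∞ (Function.uncurry Ψ))
    (hτ : ContMDiff J 𝓘(ℝ, ℝ) ∞ τ) :
    ContMDiff J 𝓘(ℝ, F) ∞ (fun n => deriv (Ψ n) (τ n)) := by
  intro x₀
  have := ContMDiffAt.mfderiv (m := ∞) (n := ∞) (I := 𝓘(ℝ, ℝ)) (I' := 𝓘(ℝ, F)) (J := J)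
    (x₀ := x₀) Ψ τ hΨ.contMDiffAt hτ.contMDiffAt (by simp)
  have h2 := this.clm_apply (contMDiffAt_const (c := (1:ℝ)))
  refine h2.congr_of_eventuallyEq (Eventually.of_forall fun n => ?_)
  simp only [inTangentCoordinates_model_space, mfderiv_eq_fderiv]
  exact fderiv_apply_one_eq_deriv.symm

end Joint

/-- Mixed partial derivatives within a product of two convex sets of reals commute. -/
theorem derivWithin_comm {f : ℝ × ℝ → F} {s t : Set ℝ} (hs : Convex ℝ s)
    (hs' : (interior s).Nonempty) (ht : Convex ℝ t) (ht' : (interior t).Nonempty) {x₀ y₀ : ℝ}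
    (hx : x₀ ∈ s) (hy : y₀ ∈ t) (hf : ContDiffWithinAt ℝ ∞ f (s ×ˢ t) (x₀, y₀)) :
    derivWithin (fun x => derivWithin (fun y => f (x, y)) t y₀) s x₀ =
      derivWithin (fun y => derivWithin (fun x => f (x, y)) s x₀) t y₀ := by
  have us : UniqueDiffOn ℝ s := uniqueDiffOn_convex hs hs'
  have ut : UniqueDiffOn ℝ t := uniqueDiffOn_convex ht ht'
  have u : UniqueDiffOn ℝ (s ×ˢ t) := us.prod ut
  have hmem : ((x₀, y₀) : ℝ × ℝ) ∈ s ×ˢ t := ⟨hx, hy⟩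
  have hsym : IsSymmSndFDerivWithinAt ℝ f (s ×ˢ t) (x₀, y₀) := by
    refine hf.isSymmSndFDerivWithinAt ?_ u ?_ hmem
    · rw [minSmoothness_of_isRCLikeNormedField]; exact ENat.LEInfty.out
    · have hc : Convex ℝ (s ×ˢ t) := hs.prod ht
      have hne : (interior (s ×ˢ t)).Nonempty := by
        rw [interior_prod_eq]; exact hs'.prod ht'
      rw [hc.closure_interior_eq_closure_of_nonempty_interior hne]
      exact subset_closure hmem
  have hev : ∀ᶠ p in 𝓝[s ×ˢ t] (x₀, y₀), DifferentiableWithinAt ℝ f (s ×ˢ t) p := by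
    have h1 : ContDiffWithinAt ℝ 1 f (s ×ˢ t) (x₀, y₀) := hf.of_le (by exact_mod_cast le_top)
    have := h1.eventually (by decide)
    rw [insert_eq_of_mem hmem] at this
    exact this.mono fun p hp => hp.differentiableWithinAt (by simp)
  have hd : DifferentiableWithinAt ℝ (fderivWithin ℝ f (s ×ˢ t)) (s ×ˢ t) (x₀, y₀) :=
    (hf.fderivWithin_right (m := ∞) u (by simp) hmem).differentiableWithinAt (by simp)
  have cx : ∀ y ∈ t, ∀ x, HasFDerivWithinAt (fun x : ℝ => ((x, y) : ℝ × ℝ))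
      (ContinuousLinearMap.inl ℝ ℝ ℝ) s x ∧ MapsTo (fun x : ℝ => ((x, y) : ℝ × ℝ)) s (s ×ˢ t) :=
    fun y hy x => ⟨(hasFDerivAt_prodMk_left x y).hasFDerivWithinAt, fun x hx => ⟨hx, hy⟩⟩
  have cy : ∀ x ∈ s, ∀ y, HasFDerivWithinAt (fun y : ℝ => ((x, y) : ℝ × ℝ))
      (ContinuousLinearMap.inr ℝ ℝ ℝ) t y ∧ MapsTo (fun y : ℝ => ((x, y) : ℝ × ℝ)) t (s ×ˢ t) :=
    fun x hx y => ⟨(hasFDerivAt_prodMk_right x y).hasFDerivWithinAt, fun y hy => ⟨hx, hy⟩⟩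
  have e1 : ∀ᶠ x in 𝓝[s] x₀, derivWithin (fun y => f (x, y)) t y₀ =
      fderivWithin ℝ f (s ×ˢ t) (x, y₀) (0, 1) := by
    have ht1 : Tendsto (fun x : ℝ => ((x, y₀) : ℝ × ℝ)) (𝓝[s] x₀) (𝓝[s ×ˢ t] (x₀, y₀)) :=
      (cx y₀ hy x₀).1.continuousWithinAt.tendsto_nhdsWithin (cx y₀ hy x₀).2
    filter_upwards [ht1.eventually hev, self_mem_nhdsWithin] with x hx1 hx2
    have := (hx1.hasFDerivWithinAt.comp y₀ (cy x hx2 y₀).1 (cy x hx2 y₀).2).hasDerivWithinAt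
    simpa [Function.comp_def] using this.derivWithin (ut _ hy)
  have e2 : ∀ᶠ y in 𝓝[t] y₀, derivWithin (fun x => f (x, y)) s x₀ =
      fderivWithin ℝ f (s ×ˢ t) (x₀, y) (1, 0) := by
    have ht1 : Tendsto (fun y : ℝ => ((x₀, y) : ℝ × ℝ)) (𝓝[t] y₀) (𝓝[s ×ˢ t] (x₀, y₀)) :=
      (cy x₀ hx y₀).1.continuousWithinAt.tendsto_nhdsWithin (cy x₀ hx y₀).2
    filter_upwards [ht1.eventually hev, self_mem_nhdsWithin] with y hy1 hy2
    have := (hy1.hasFDerivWithinAt.comp x₀ (cx y hy2 x₀).1 (cx y hy2 x₀).2).hasDerivWithinAt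
    simpa [Function.comp_def] using this.derivWithin (us _ hx)
  rw [Filter.EventuallyEq.derivWithin_eq e1 (e1.self_of_nhdsWithin hx),
    Filter.EventuallyEq.derivWithin_eq e2 (e2.self_of_nhdsWithin hy)]
  have d1 : HasDerivWithinAt (fun x => fderivWithin ℝ f (s ×ˢ t) (x, y₀) (0, 1))
      (fderivWithin ℝ (fderivWithin ℝ f (s ×ˢ t)) (s ×ˢ t) (x₀, y₀) (1, 0) (0, 1)) s x₀ := by
    have h1 := (hd.hasFDerivWithinAt.comp x₀ (cx y₀ hy x₀).1 (cx y₀ hy x₀).2).hasDerivWithinAt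
    have h2 := (ContinuousLinearMap.apply ℝ F ((0, 1) : ℝ × ℝ)).hasFDerivAt.comp_hasDerivWithinAt
      x₀ h1
    exact h2.congr_deriv (by simp)
  have d2 : HasDerivWithinAt (fun y => fderivWithin ℝ f (s ×ˢ t) (x₀, y) (1, 0))
      (fderivWithin ℝ (fderivWithin ℝ f (s ×ˢ t)) (s ×ˢ t) (x₀, y₀) (0, 1) (1, 0)) t y₀ := by
    have h1 := (hd.hasFDerivWithinAt.comp y₀ (cy x₀ hx y₀).1 (cy x₀ hx y₀).2).hasDerivWithinAt
    have h2 := (ContinuousLinearMap.apply ℝ F ((1, 0) : ℝ × ℝ)).hasFDerivAt.comp_hasDerivWithinAt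
      y₀ h1
    exact h2.congr_deriv (by simp)
  rw [d1.derivWithin (us _ hx), d2.derivWithin (ut _ hy)]
  exact hsym (1, 0) (0, 1)

theorem convex_interior_unitInterval :
    Convex ℝ (Icc (0 : ℝ) 1) ∧ (interior (Icc (0 : ℝ) 1)).Nonempty :=
  ⟨convex_Icc _ _, by rw [interior_Icc]; exact nonempty_Ioo.2 zero_lt_one⟩

theorem vel_comm {f : unitInterval → unitInterval → F} {a b : unitInterval}
    (hf : ContMDiffAt ((𝓡∂ 1).prod (𝓡∂ 1)) 𝓘(ℝ, F) ∞ (Function.uncurry f) (a, b)) :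
    vel 𝓘(ℝ, F) (fun x => vel 𝓘(ℝ, F) (fun y => f x y) b) a =
      vel 𝓘(ℝ, F) (fun y => vel 𝓘(ℝ, F) (fun x => f x y) a) b := by
  obtain ⟨c1, c2⟩ := convex_interior_unitInterval
  have hc : ContDiffWithinAt ℝ ∞ (fun p : ℝ × ℝ => f (projIcc 0 1 zero_le_one p.1)
      (projIcc 0 1 zero_le_one p.2)) (Icc 0 1 ×ˢ Icc 0 1) ((a : ℝ), (b : ℝ)) := by
    rw [← contMDiffWithinAt_iff_contDiffWithinAt]
    refine ContMDiffAt.comp_contMDiffWithinAt_of_eq (y := (a, b)) (g := Function.uncurry f)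
      (f := fun p : ℝ × ℝ => (projIcc (0 : ℝ) 1 zero_le_one p.1, projIcc (0 : ℝ) 1 zero_le_one p.2))
      hf ?_ (by simp)
    refine ContMDiffWithinAt.prodMk ?_ ?_
    · exact (contMDiffOn_projIcc.comp (contDiff_fst (n := ∞)).contMDiff.contMDiffOn
        (fun p hp => hp.1)) _ ⟨a.2, b.2⟩
    · exact (contMDiffOn_projIcc.comp (contDiff_snd (n := ∞)).contMDiff.contMDiffOn
        (fun p hp => hp.2)) _ ⟨a.2, b.2⟩
  have h := derivWithin_comm c1 c2 c1 c2 a.2 b.2 hc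
  simp only [vel_eq_derivWithin, Function.comp_def]
  exact h

theorem deriv_vel_comm {f : ℝ → unitInterval → F} {a : ℝ} {b : unitInterval}
    (hf : ContMDiffAt (𝓘(ℝ, ℝ).prod (𝓡∂ 1)) 𝓘(ℝ, F) ∞ (Function.uncurry f) (a, b)) :
    deriv (fun x => vel 𝓘(ℝ, F) (fun y => f x y) b) a =
      vel 𝓘(ℝ, F) (fun y => deriv (fun x => f x y) a) b := by
  obtain ⟨c1, c2⟩ := convex_interior_unitInterval
  have hc : ContDiffWithinAt ℝ ∞ (fun p : ℝ × ℝ => f p.1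
      (projIcc 0 1 zero_le_one p.2)) (univ ×ˢ Icc 0 1) (a, (b : ℝ)) := by
    rw [← contMDiffWithinAt_iff_contDiffWithinAt]
    refine ContMDiffAt.comp_contMDiffWithinAt_of_eq (y := (a, b)) (g := Function.uncurry f)
      (f := fun p : ℝ × ℝ => (p.1, projIcc (0 : ℝ) 1 zero_le_one p.2))
      hf ?_ (by simp)
    refine ContMDiffWithinAt.prodMk
      (contDiff_fst (n := ∞)).contMDiff.contMDiffAt.contMDiffWithinAt ?_
    exact (contMDiffOn_projIcc.comp (contDiff_snd (n := ∞)).contMDiff.contMDiffOn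
        (fun p hp => hp.2)) _ ⟨mem_univ _, b.2⟩
  have h := derivWithin_comm convex_univ (by simp) c1 c2 (mem_univ a) b.2 hc
  simp only [vel_eq_derivWithin, Function.comp_def]
  simpa only [derivWithin_univ] using h

end IntervalCalculus

/-! ### Integrals over compact manifolds with parameters -/

section Integrals

variable {F : Type*} [NormedAddCommGroup F] [NormedSpace ℝ F]

/-- The fundamental theorem of calculus on `[0,1]`. -/
theorem integral_vel {f : unitInterval → ℝ} (hf : ContMDiff (𝓡∂ 1) 𝓘(ℝ, ℝ) ∞ f) :
    ∫ t, vel 𝓘(ℝ, ℝ) f t = f 1 - f 0 := by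
  have hc : ContDiffOn ℝ 1 (f ∘ projIcc (0 : ℝ) 1 zero_le_one) (Icc 0 1) := by
    rw [← contMDiffOn_iff_contDiffOn]
    exact (contMDiffOn_comp_projIcc_iff.2 hf).of_le (by exact_mod_cast le_top)
  have h := intervalIntegral.integral_derivWithin_Icc_of_contDiffOn_Icc hc zero_le_one
  rw [intervalIntegral.integral_of_le zero_le_one, ← integral_Icc_eq_integral_Ioc] at h
  have h2 : ∫ t : unitInterval, vel 𝓘(ℝ, ℝ) f t = ∫ t : unitInterval,
      derivWithin (f ∘ projIcc (0 : ℝ) 1 zero_le_one) (Icc 0 1) (t : ℝ) := by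
    simp only [vel_eq_derivWithin]
  rw [h2, integral_subtype measurableSet_Icc
    (fun t => derivWithin (f ∘ projIcc (0 : ℝ) 1 zero_le_one) (Icc 0 1) t), h]
  simp

variable {K EK HK : Type*} [NormedAddCommGroup EK] [NormedSpace ℝ EK] [TopologicalSpace HK]
  {J : ModelWithCorners ℝ EK HK} [TopologicalSpace K] [ChartedSpace HK K]

/-- The partial derivative of a jointly smooth map exists. -/
theorem hasDerivAt_of_contMDiff {Φ : ℝ → K → F}
    (hΦ : ContMDiff (𝓘(ℝ, ℝ).prod J) 𝓘(ℝ, F) ∞ (Function.uncurry Φ)) (ε : ℝ) (x : K) :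
    HasDerivAt (fun ε => Φ ε x) (deriv (fun ε => Φ ε x) ε) ε := by
  have h : ContMDiff 𝓘(ℝ, ℝ) 𝓘(ℝ, F) ∞ (fun ε => Φ ε x) :=
    hΦ.comp (contMDiff_id.prodMk contMDiff_const)
  exact (h.contDiff.differentiable (by simp) ε).hasDerivAt

variable [IsManifold J 1 K]

theorem contMDiff_deriv_uncurry {Φ : ℝ → K → F}
    (hΦ : ContMDiff (𝓘(ℝ, ℝ).prod J) 𝓘(ℝ, F) ∞ (Function.uncurry Φ)) :
    ContMDiff (𝓘(ℝ, ℝ).prod J) 𝓘(ℝ, F) ∞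
      (Function.uncurry fun ε x => deriv (fun ε => Φ ε x) ε) := by
  have h := contMDiff_deriv (J := 𝓘(ℝ, ℝ).prod J) (N := ℝ × K) (Ψ := fun n ε => Φ ε n.2)
    (τ := fun n => n.1) ?_ contMDiff_fst
  · exact h
  · exact hΦ.comp (contMDiff_snd.prodMk (contMDiff_snd.comp contMDiff_fst))

variable [CompactSpace K] [MeasurableSpace K] [BorelSpace K] {μ : Measure K} [IsFiniteMeasure μ]

theorem integrable_of_continuous {K : Type*} [TopologicalSpace K] [CompactSpace K]
    [MeasurableSpace K] [BorelSpace K] {μ : Measure K} [IsFiniteMeasure μ] {f : K → ℝ}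
    (hf : Continuous f) : Integrable f μ :=
  hf.integrable_of_hasCompactSupport (HasCompactSupport.of_compactSpace _)

/-- Differentiation under the integral sign over a compact manifold. -/
theorem hasDerivAt_integral {Φ : ℝ → K → ℝ}
    (hΦ : ContMDiff (𝓘(ℝ, ℝ).prod J) 𝓘(ℝ, ℝ) ∞ (Function.uncurry Φ)) (ε₀ : ℝ) :
    HasDerivAt (fun ε => ∫ x, Φ ε x ∂μ) (∫ x, deriv (fun ε => Φ ε x) ε₀ ∂μ) ε₀ := by
  have hD := contMDiff_deriv_uncurry hΦ
  have hslice : ∀ ε, Continuous (Φ ε) := fun ε =>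
    hΦ.continuous.comp (f := fun x : K => (ε, x)) (by fun_prop)
  obtain ⟨C, hC⟩ := (((isCompact_Icc (a := ε₀ - 1) (b := ε₀ + 1)).prod
    (isCompact_univ (X := K))).image hD.continuous.norm).bddAbove
  refine (hasDerivAt_integral_of_dominated_loc_of_deriv_le (bound := fun _ => C)
    (F' := fun ε x => deriv (fun ε => Φ ε x) ε)
    (Icc_mem_nhds (sub_one_lt ε₀) (lt_add_one ε₀)) ?_ ?_ ?_ ?_ ?_ ?_).2
  · exact Eventually.of_forall fun ε => (integrable_of_continuous (hslice ε)).1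
  · exact integrable_of_continuous (hslice ε₀)
  · exact (integrable_of_continuous (K := K)
      (f := fun x => deriv (fun ε => Φ ε x) ε₀)
      (hD.continuous.comp (f := fun x : K => (ε₀, x)) (by fun_prop))).1
  · exact Eventually.of_forall fun x ε hε => hC ⟨(ε, x), ⟨hε, mem_univ _⟩, rfl⟩
  · exact integrable_const _
  · exact Eventually.of_forall fun x ε _ => hasDerivAt_of_contMDiff hΦ ε x

theorem contDiff_integral {Φ : ℝ → K → ℝ}
    (hΦ : ContMDiff (𝓘(ℝ, ℝ).prod J) 𝓘(ℝ, ℝ) ∞ (Function.uncurry Φ)) :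
    ContDiff ℝ ∞ (fun ε => ∫ x, Φ ε x ∂μ) := by
  rw [contDiff_infty]
  intro n
  induction n generalizing Φ with
  | zero =>
    exact contDiff_zero.2
      (continuous_iff_continuousAt.2 fun ε => (hasDerivAt_integral hΦ ε).continuousAt)
  | succ n ih =>
    have h : deriv (fun ε => ∫ x, Φ ε x ∂μ) = fun ε => ∫ x, deriv (fun ε => Φ ε x) ε ∂μ :=
      funext fun ε => (hasDerivAt_integral hΦ ε).deriv
    push_cast
    rw [contDiff_succ_iff_deriv]
    refine ⟨fun ε => (hasDerivAt_integral hΦ ε).differentiableAt, by simp, ?_⟩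
    rw [h]
    exact ih (contMDiff_deriv_uncurry hΦ)

end Integrals

/-! ### Difference quotients converge in the smooth topology -/

section SmoothConvergence

variable {E : Type*} [NormedAddCommGroup E] [NormedSpace ℝ E]

theorem vel_iterate_smul (c : ℝ) {f : unitInterval → E} (hf : ContMDiff (𝓡∂ 1) 𝓘(ℝ, E) ∞ f)
    (k : ℕ) : (vel 𝓘(ℝ, E))^[k] (c • f) = c • (vel 𝓘(ℝ, E))^[k] f := by
  induction k generalizing f with
  | zero => rfl
  | succ k ih =>
    have h1 : vel 𝓘(ℝ, E) (c • f) = c • vel 𝓘(ℝ, E) f := by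
      ext t
      exact ((hasVelAt_of_contMDiff hf t).clm (c • ContinuousLinearMap.id ℝ E)).vel_eq
    have h2 : ContMDiff (𝓡∂ 1) 𝓘(ℝ, E) ∞ (vel 𝓘(ℝ, E) f) :=
      contMDiff_vel (N := unitInterval) (Ψ := fun _ => f) (hf.comp contMDiff_snd) contMDiff_id
    rw [Function.iterate_succ_apply, Function.iterate_succ_apply, h1, ih h2]

/-- Difference quotients of a smooth curve in `C^∞([0,1], E)` converge, together with all their
derivatives, to the velocity of the curve. -/
theorem smoothTendsto_slope {Ψ : ℝ → unitInterval → E}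
    (hΨ : ContMDiff (𝓘(ℝ, ℝ).prod (𝓡∂ 1)) 𝓘(ℝ, E) ∞ (Function.uncurry Ψ)) (h0 : ∀ r, Ψ 0 r = 0)
    {γ : unitInterval → E} (hγ : ∀ r, HasDerivAt (fun ε => Ψ ε r) (γ r) 0) :
    SmoothTendsto (𝓝[≠] (0 : ℝ)) (fun ε => ε⁻¹ • Ψ ε) γ := by
  intro k
  have hsm : ∀ ε, ContMDiff (𝓡∂ 1) 𝓘(ℝ, E) ∞ (Ψ ε) := fun ε =>
    hΨ.comp (contMDiff_const.prodMk contMDiff_id)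
  simp only [vel_iterate_smul _ (hsm _)]
  clear hsm
  induction k generalizing Ψ γ with
  | zero =>
    simp only [Function.iterate_zero, id_eq]
    have hD := contMDiff_deriv_uncurry hΨ
    obtain rfl : (fun r => deriv (fun ε => Ψ ε r) 0) = γ := funext fun r => (hγ r).deriv
    rw [Metric.tendstoUniformly_iff]
    intro δ hδ
    -- the `ε`-derivative is uniformly close to its value at `0`, by compactness of `[0,1]`
    have hu : ∀ᶠ ε in 𝓝 (0 : ℝ), ∀ r : unitInterval,
        dist (deriv (fun ε => Ψ ε r) 0) (deriv (fun ε => Ψ ε r) ε) < δ / 2 := by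
      have := (ContinuousMap.curry ⟨_, hD.continuous⟩ :
        C(ℝ, C(unitInterval, E))).continuous.tendsto 0
      rw [ContinuousMap.tendsto_iff_tendstoUniformly, Metric.tendstoUniformly_iff] at this
      exact this (δ / 2) (half_pos hδ)
    obtain ⟨ρ, hρ, hball⟩ := Metric.eventually_nhds_iff_ball.1 hu
    have hb : ∀ᶠ ε in 𝓝[≠] (0 : ℝ), ε ∈ Metric.ball (0 : ℝ) ρ :=
      nhdsWithin_le_nhds (Metric.ball_mem_nhds _ hρ)
    filter_upwards [hb, self_mem_nhdsWithin] with ε hε hne r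
    have hmv := (convex_ball (0 : ℝ) ρ).norm_image_sub_le_of_norm_hasDerivWithin_le
      (f := fun ε => Ψ ε r - ε • deriv (fun ε => Ψ ε r) 0)
      (f' := fun ε => deriv (fun ε => Ψ ε r) ε - deriv (fun ε => Ψ ε r) 0) (C := δ / 2)
      (fun x _ => by
        have h1 := (hasDerivAt_of_contMDiff hΨ x r).sub
          ((hasDerivAt_id x).smul_const (deriv (fun ε => Ψ ε r) 0))
        rw [one_smul] at h1
        exact h1.hasDerivWithinAt)
      (fun x hx => by
        rw [← dist_eq_norm, dist_comm]; exact (hball x hx r).le)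
      (Metric.mem_ball_self hρ) hε
    simp only [h0, zero_smul, sub_zero] at hmv
    have hne' : (ε : ℝ) ≠ 0 := hne
    have : deriv (fun ε => Ψ ε r) 0 - (ε⁻¹ • Ψ ε) r =
        -(ε⁻¹ • (Ψ ε r - ε • deriv (fun ε => Ψ ε r) 0)) := by
      rw [smul_sub, smul_smul, inv_mul_cancel₀ hne', one_smul, Pi.smul_apply, neg_sub]
    rw [dist_eq_norm, this, norm_neg, norm_smul, norm_inv]
    calc ‖ε‖⁻¹ * ‖Ψ ε r - ε • deriv (fun ε => Ψ ε r) 0‖ ≤ ‖ε‖⁻¹ * (δ / 2 * ‖ε‖) := by gcongr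
      _ = δ / 2 := by field_simp
      _ < δ := half_lt_self hδ
  | succ k ih =>
    simp only [Function.iterate_succ_apply]
    have hv : ContMDiff (𝓘(ℝ, ℝ).prod (𝓡∂ 1)) 𝓘(ℝ, E) ∞
        (Function.uncurry fun ε => vel 𝓘(ℝ, E) (Ψ ε)) :=
      contMDiff_vel (N := ℝ × unitInterval) (Ψ := fun n => Ψ n.1)
        (hΨ.comp ((contMDiff_fst.comp contMDiff_fst).prodMk contMDiff_snd)) contMDiff_snd
    refine ih hv (fun r => ?_) (fun r => ?_)
    · have : Ψ 0 = fun _ => 0 := funext h0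
      rw [this]
      exact (hasVelAt_const _ _).vel_eq
    · obtain rfl : (fun r => deriv (fun ε => Ψ ε r) 0) = γ := funext fun r => (hγ r).deriv
      rw [← deriv_vel_comm hΨ.contMDiffAt]
      exact hasDerivAt_of_contMDiff hv 0 r

end SmoothConvergence

/-! ### Logarithmic derivatives of maps into a Lie group -/

section LieGroupCalculus

variable {E : Type*} [NormedAddCommGroup E] [NormedSpace ℝ E]
  {H : Type*} [TopologicalSpace H] {I : ModelWithCorners ℝ E H}
  {G : Type*} [TopologicalSpace G] [ChartedSpace H G]

theorem velZero_const (g : G) : velZero I (fun _ : ℝ => g) = 0 := by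
  simp only [velZero, mfderiv_const]
  rfl

theorem contMDiff_slice_fst {f : unitInterval → unitInterval → G}
    (hf : ContMDiff ((𝓡∂ 1).prod (𝓡∂ 1)) I ∞ (Function.uncurry f)) (b : unitInterval) :
    ContMDiff (𝓡∂ 1) I ∞ (fun s => f s b) :=
  hf.comp (contMDiff_id.prodMk contMDiff_const)

theorem contMDiff_slice_snd {f : unitInterval → unitInterval → G}
    (hf : ContMDiff ((𝓡∂ 1).prod (𝓡∂ 1)) I ∞ (Function.uncurry f)) (a : unitInterval) :
    ContMDiff (𝓡∂ 1) I ∞ (fun r => f a r) :=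
  hf.comp (contMDiff_const.prodMk contMDiff_id)

variable [Group G]

theorem Ad_one (X : E) : Ad I (1 : G) X = X := by
  have h : (fun x : G => 1 * x * 1⁻¹) = id := by ext; simp
  rw [Ad, h, mfderiv_id]
  rfl

variable [LieGroup I ∞ G]

theorem isManifold_one : IsManifold I 1 G :=
  IsManifold.of_le (n := ∞) (by exact_mod_cast le_top)

theorem contMDiff_mul_mul_inv (g : G) : ContMDiff I I ∞ (fun x : G => g * x * g⁻¹) :=
  (contMDiff_const.mul contMDiff_id).mul contMDiff_const

/-- Near a point where a path passes through `1`, its velocity can be computed in the preferred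
chart at `1`. -/
theorem vel_eq_vel_extChartAt {p : unitInterval → G} {t : unitInterval}
    (hp : MDifferentiableAt (𝓡∂ 1) I p t) (h1 : p t = 1) :
    vel I p t = vel 𝓘(ℝ, E) (fun t' => extChartAt I (1 : G) (p t')) t := by
  have : IsManifold I 1 G := isManifold_one
  have hφ : MDifferentiableAt I 𝓘(ℝ, E) (extChartAt I (1 : G)) (p t) :=
    mdifferentiableAt_extChartAt (by rw [h1]; exact mem_chart_source H 1)
  have h : mfderiv (𝓡∂ 1) 𝓘(ℝ, E) (fun t' => extChartAt I (1 : G) (p t')) t = _ :=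
    mfderiv_comp t hφ hp
  refine Eq.symm ((DFunLike.congr_fun h 1).trans ?_)
  have h2 : mfderiv I 𝓘(ℝ, E) (extChartAt I (1 : G)) (p t) = ContinuousLinearMap.id ℝ E := by
    rw [h1]; exact mfderiv_extChartAt_self
  exact DFunLike.congr_fun h2 _

/-- The analogue of `vel_eq_vel_extChartAt` for curves parametrised by `ℝ`. -/
theorem velZero_eq_deriv_extChartAt {p : ℝ → G}
    (hp : MDifferentiableAt 𝓘(ℝ, ℝ) I p 0) (h1 : p 0 = 1) :
    velZero I p = deriv (fun t' => extChartAt I (1 : G) (p t')) 0 := by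
  have : IsManifold I 1 G := isManifold_one
  have hφ : MDifferentiableAt I 𝓘(ℝ, E) (extChartAt I (1 : G)) (p 0) :=
    mdifferentiableAt_extChartAt (by rw [h1]; exact mem_chart_source H 1)
  have h : mfderiv 𝓘(ℝ, ℝ) 𝓘(ℝ, E) (fun t' => extChartAt I (1 : G) (p t')) 0 = _ :=
    mfderiv_comp 0 hφ hp
  rw [← fderiv_apply_one_eq_deriv, ← mfderiv_eq_fderiv]
  refine Eq.symm ((DFunLike.congr_fun h 1).trans ?_)
  have h2 : mfderiv I 𝓘(ℝ, E) (extChartAt I (1 : G)) (p 0) = ContinuousLinearMap.id ℝ E := by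
    rw [h1]; exact mfderiv_extChartAt_self
  exact DFunLike.congr_fun h2 _

theorem velZero_mul_of_eq_one {a b : ℝ → G}
    (ha : MDifferentiableAt 𝓘(ℝ, ℝ) I a 0) (hb : MDifferentiableAt 𝓘(ℝ, ℝ) I b 0)
    (ha1 : a 0 = 1) (hb1 : b 0 = 1) :
    velZero I (fun t' => a t' * b t') = velZero I a + velZero I b := by
  have hm : MDifferentiableAt (I.prod I) I (fun p : G × G => p.1 * p.2) (a 0, b 0) :=
    (contMDiff_mul I ∞).mdifferentiableAt (by simp)
  have h : mfderiv 𝓘(ℝ, ℝ) I (fun t' => a t' * b t') 0 = _ :=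
    mfderiv_comp 0 hm (ha.prodMk hb)
  rw [velZero, h, mfderiv_prodMk ha hb]
  refine (mfderiv_prod_eq_add_apply hm).trans ?_
  refine congrArg₂ (fun x y : E => x + y) ?_ ?_
  · have : (fun z : G => z * (a 0, b 0).2) = id := by ext z; simp [hb1]
    rw [this, mfderiv_id]
    rfl
  · have : (fun z : G => (a 0, b 0).1 * z) = id := by ext z; simp [ha1]
    rw [this, mfderiv_id]
    rfl

theorem velZero_conj_of_eq_one {a : ℝ → G} (g : G)
    (ha : MDifferentiableAt 𝓘(ℝ, ℝ) I a 0) (ha1 : a 0 = 1) :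
    velZero I (fun t' => g * a t' * g⁻¹) = Ad I g (velZero I a) := by
  have hm : MDifferentiableAt I I (fun x : G => g * x * g⁻¹) (a 0) :=
    (contMDiff_mul_mul_inv g).mdifferentiableAt (by simp)
  have h : mfderiv 𝓘(ℝ, ℝ) I (fun t' => g * a t' * g⁻¹) 0 = _ := mfderiv_comp 0 hm ha
  rw [velZero, h, ha1]
  rfl

theorem velZero_inv_of_eq_one {a : ℝ → G} (ha : ContMDiff 𝓘(ℝ, ℝ) I ∞ a) (ha1 : a 0 = 1) :
    velZero I (fun t' => (a t')⁻¹) = -velZero I a := by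
  have h := velZero_mul_of_eq_one (ha.mdifferentiableAt (by simp))
    (ha.inv.mdifferentiableAt (by simp)) ha1 (by simp [ha1])
  simp only [mul_inv_cancel, velZero_const] at h
  exact eq_neg_of_add_eq_zero_right h.symm

theorem vel_inv_of_eq_one {a : unitInterval → G} (ha : ContMDiff (𝓡∂ 1) I ∞ a)
    {t : unitInterval} (ha1 : a t = 1) :
    vel I (fun t' => (a t')⁻¹) t = -vel I a t := by
  have h := vel_mul_of_eq_one (ha.mdifferentiableAt (by simp))
    (ha.inv.mdifferentiableAt (by simp)) ha1 (by simp [ha1])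
  have hc : vel I (fun _ : unitInterval => (1 : G)) t = 0 := by
    simp only [vel, mfderiv_const]
    rfl
  simp only [mul_inv_cancel, hc] at h
  exact eq_neg_of_add_eq_zero_right h.symm

theorem Ad_mul (g h : G) (X : E) : Ad I (g * h) X = Ad I g (Ad I h X) := by
  have e : mfderiv I I ((fun x : G => g * x * g⁻¹) ∘ fun x : G => h * x * h⁻¹) 1 = _ :=
    mfderiv_comp 1 ((contMDiff_mul_mul_inv g).mdifferentiableAt (by simp))
      ((contMDiff_mul_mul_inv h).mdifferentiableAt (by simp))
  have hid : (fun x : G => g * x * g⁻¹) ∘ (fun x : G => h * x * h⁻¹) =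
      fun x => g * h * x * (g * h)⁻¹ := by
    ext x
    simp [mul_assoc]
  rw [hid, show h * (1 : G) * h⁻¹ = 1 by simp] at e
  exact DFunLike.congr_fun e X

theorem Ad_inv_cancel_left (g : G) (X : E) : Ad I g⁻¹ (Ad I g X) = X := by
  rw [← Ad_mul, inv_mul_cancel, Ad_one]

theorem rightLog_eq_Ad_leftLog {p : unitInterval → G} (hp : ContMDiff (𝓡∂ 1) I ∞ p)
    (t : unitInterval) : rightLog I p t = Ad I (p t) (leftLog I p t) := by
  have hc : ContMDiff (𝓡∂ 1) I ∞ (fun t' => (p t)⁻¹ * p t') := contMDiff_const.mul hp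
  rw [leftLog, ← vel_conj_of_eq_one _ (hc.mdifferentiableAt (by simp)) (by simp), rightLog]
  simp

theorem leftLog_inv {p : unitInterval → G} (hp : ContMDiff (𝓡∂ 1) I ∞ p) (t : unitInterval) :
    leftLog I (fun t => (p t)⁻¹) t = -rightLog I p t := by
  have hc : ContMDiff (𝓡∂ 1) I ∞ (fun t' => p t' * (p t)⁻¹) := hp.mul contMDiff_const
  rw [rightLog, ← vel_inv_of_eq_one hc (by simp), leftLog]
  simp

theorem rightLog_inv {p : unitInterval → G} (hp : ContMDiff (𝓡∂ 1) I ∞ p) (t : unitInterval) :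
    rightLog I (fun t => (p t)⁻¹) t = -leftLog I p t := by
  have hc : ContMDiff (𝓡∂ 1) I ∞ (fun t' => (p t)⁻¹ * p t') := contMDiff_const.mul hp
  rw [leftLog, ← vel_inv_of_eq_one hc (by simp), rightLog]
  simp

/-- The mixed second derivative at the crossing point of a map which is `1` on two crossing lines
is symmetric. -/
theorem vel_comm_of_eq_one {D : unitInterval → unitInterval → G} {a b : unitInterval}
    (hD : ContMDiff ((𝓡∂ 1).prod (𝓡∂ 1)) I ∞ (Function.uncurry D)) (ha : ∀ y, D a y = 1)
    (hb : ∀ x, D x b = 1) :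
    vel 𝓘(ℝ, E) (fun x => vel I (fun y => D x y) b) a =
      vel 𝓘(ℝ, E) (fun y => vel I (fun x => D x y) a) b := by
  have hx : ∀ y, ContMDiff (𝓡∂ 1) I ∞ (fun x => D x y) := fun y =>
    hD.comp (contMDiff_id.prodMk contMDiff_const)
  have hy : ∀ x, ContMDiff (𝓡∂ 1) I ∞ (fun y => D x y) := fun x =>
    hD.comp (contMDiff_const.prodMk contMDiff_id)
  have e1 : ∀ x, vel I (fun y => D x y) b = _ := fun x =>
    vel_eq_vel_extChartAt ((hy x).mdifferentiableAt (by simp)) (hb x)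
  have e2 : ∀ y, vel I (fun x => D x y) a = _ := fun y =>
    vel_eq_vel_extChartAt ((hx y).mdifferentiableAt (by simp)) (ha y)
  simp only [e1, e2]
  refine vel_comm (f := fun x y => extChartAt I (1 : G) (D x y)) ?_
  exact ContMDiffAt.comp (a, b) (contMDiffAt_extChartAt' (by simp [ha]))
    hD.contMDiffAt

/-- The analogue of `vel_comm_of_eq_one` with one real parameter. -/
theorem deriv_vel_comm_of_eq_one {D : ℝ → unitInterval → G} {b : unitInterval}
    (hD : ContMDiff (𝓘(ℝ, ℝ).prod (𝓡∂ 1)) I ∞ (Function.uncurry D)) (ha : ∀ y, D 0 y = 1)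
    (hb : ∀ x, D x b = 1) :
    deriv (fun x => vel I (fun y => D x y) b) 0 =
      vel 𝓘(ℝ, E) (fun y => velZero I (fun x => D x y)) b := by
  have hx : ∀ y, ContMDiff 𝓘(ℝ, ℝ) I ∞ (fun x => D x y) := fun y =>
    hD.comp (contMDiff_id.prodMk contMDiff_const)
  have hy : ∀ x, ContMDiff (𝓡∂ 1) I ∞ (fun y => D x y) := fun x =>
    hD.comp (contMDiff_const.prodMk contMDiff_id)
  have e1 : ∀ x, vel I (fun y => D x y) b = _ := fun x =>
    vel_eq_vel_extChartAt ((hy x).mdifferentiableAt (by simp)) (hb x)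
  have e2 : ∀ y, velZero I (fun x => D x y) = _ := fun y =>
    velZero_eq_deriv_extChartAt ((hx y).mdifferentiableAt (by simp)) (ha y)
  simp only [e1, e2]
  refine deriv_vel_comm (f := fun x y => extChartAt I (1 : G) (D x y)) ?_
  exact ContMDiffAt.comp (0, b) (contMDiffAt_extChartAt' (by simp [ha]))
    hD.contMDiffAt

theorem contMDiff_leftLog_fst {f : unitInterval → unitInterval → G}
    (hf : ContMDiff ((𝓡∂ 1).prod (𝓡∂ 1)) I ∞ (Function.uncurry f)) (a : unitInterval) :
    ContMDiff (𝓡∂ 1) 𝓘(ℝ, E) ∞ (fun r => leftLog I (fun s => f s r) a) :=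
  contMDiff_leftLog (Φ := fun r s => f s r) (τ := fun _ => a)
    (hf.comp (contMDiff_snd.prodMk contMDiff_fst)) contMDiff_const

theorem contMDiff_rightLog_snd {f : unitInterval → unitInterval → G}
    (hf : ContMDiff ((𝓡∂ 1).prod (𝓡∂ 1)) I ∞ (Function.uncurry f)) (b : unitInterval) :
    ContMDiff (𝓡∂ 1) 𝓘(ℝ, E) ∞ (fun s => rightLog I (fun r => f s r) b) :=
  contMDiff_rightLog (Φ := f) (τ := fun _ => b) hf contMDiff_const

/-- `∂ᵣ(f⁻¹ ∂ₛf) = f⁻¹ ∂ₛ((∂ᵣf) f⁻¹) f`. Both sides are the mixed second derivative of the map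
`f(a, r)⁻¹ f(s, r) f(s, b)⁻¹ f(a, b)`, which is `1` if `s = a` or `r = b`. -/
theorem vel_leftLog_eq_Ad_vel_rightLog {f : unitInterval → unitInterval → G}
    (hf : ContMDiff ((𝓡∂ 1).prod (𝓡∂ 1)) I ∞ (Function.uncurry f)) (a b : unitInterval) :
    vel 𝓘(ℝ, E) (fun r => leftLog I (fun s => f s r) a) b =
      Ad I (f a b)⁻¹ (vel 𝓘(ℝ, E) (fun s => rightLog I (fun r => f s r) b) a) := by
  have sS := contMDiff_slice_fst hf
  have sR := contMDiff_slice_snd hf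
  have hD : ContMDiff ((𝓡∂ 1).prod (𝓡∂ 1)) I ∞ (Function.uncurry fun s r =>
      (f a r)⁻¹ * f s r * (f s b)⁻¹ * f a b) :=
    ((((sR a).inv.comp contMDiff_snd).mul hf).mul ((sS b).inv.comp contMDiff_fst)).mul
      contMDiff_const
  have key := vel_comm_of_eq_one (a := a) (b := b) hD (by simp) (by simp)
  have e1 : ∀ r, vel I (fun s => (f a r)⁻¹ * f s r * (f s b)⁻¹ * f a b) a =
      leftLog I (fun s => f s r) a + -leftLog I (fun s => f s b) a := by
    intro r
    have h1 : ContMDiff (𝓡∂ 1) I ∞ (fun s => (f a r)⁻¹ * f s r) := contMDiff_const.mul (sS r)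
    have h2 : ContMDiff (𝓡∂ 1) I ∞ (fun s => (f a b)⁻¹ * f s b) := contMDiff_const.mul (sS b)
    have h3 := vel_mul_of_eq_one (t := a) (h1.mdifferentiableAt (by simp))
      (h2.inv.mdifferentiableAt (by simp)) (by simp) (by simp)
    rw [vel_inv_of_eq_one h2 (by simp)] at h3
    refine Eq.trans ?_ h3
    simp [mul_assoc]
  have e2 : ∀ s, vel I (fun r => (f a r)⁻¹ * f s r * (f s b)⁻¹ * f a b) b =
      Ad I (f a b)⁻¹ (-rightLog I (fun r => f a r) b + rightLog I (fun r => f s r) b) := by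
    intro s
    have h1 : ContMDiff (𝓡∂ 1) I ∞ (fun r => f s r * (f s b)⁻¹) := (sR s).mul contMDiff_const
    have h2 : ContMDiff (𝓡∂ 1) I ∞ (fun r => f a r * (f a b)⁻¹) := (sR a).mul contMDiff_const
    have h3 := vel_mul_of_eq_one (t := b) (h2.inv.mdifferentiableAt (by simp))
      (h1.mdifferentiableAt (by simp)) (by simp) (by simp)
    rw [vel_inv_of_eq_one h2 (by simp)] at h3
    have h5 : ContMDiff (𝓡∂ 1) I ∞ (fun r => (f a r * (f a b)⁻¹)⁻¹ * (f s r * (f s b)⁻¹)) :=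
      h2.inv.mul h1
    have h4 := vel_conj_of_eq_one (t := b) (f a b)⁻¹
      (h5.mdifferentiableAt (by simp)) (by simp)
    rw [h3] at h4
    refine Eq.trans ?_ h4
    simp [mul_assoc]
  simp only [e1, e2] at key
  have k1 := (((hasVelAt_const (-rightLog I (fun r => f a r) b) a).add (hasVelAt_of_contMDiff
    (contMDiff_rightLog_snd hf b) a)).clm (Ad I (f a b)⁻¹)).vel_eq
  have k2 := ((hasVelAt_of_contMDiff (contMDiff_leftLog_fst hf a) b).add
    (hasVelAt_const (-leftLog I (fun s => f s b) a) b)).vel_eq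
  rw [k1, k2, zero_add, add_zero] at key
  exact key.symm

/-- The logarithmic derivatives of a curve of paths through the constant path `1` have the same
derivative, namely the derivative of the velocity of the curve. -/
theorem deriv_leftLog_of_eq_one {f : ℝ → unitInterval → G}
    (hf : ContMDiff (𝓘(ℝ, ℝ).prod (𝓡∂ 1)) I ∞ (Function.uncurry f)) (h1 : ∀ r, f 0 r = 1)
    {V : unitInterval → E} (hV : ContMDiff (𝓡∂ 1) 𝓘(ℝ, E) ∞ V)
    (hfV : ∀ r, V r = velZero I (fun ε => f ε r)) (b : unitInterval) :
    deriv (fun ε => leftLog I (f ε) b) 0 = vel 𝓘(ℝ, E) V b := by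
  have sS : ∀ r, ContMDiff 𝓘(ℝ, ℝ) I ∞ (fun ε => f ε r) := fun r =>
    hf.comp (contMDiff_id.prodMk contMDiff_const)
  have hD : ContMDiff (𝓘(ℝ, ℝ).prod (𝓡∂ 1)) I ∞ (Function.uncurry fun s r =>
      (f s b)⁻¹ * f s r) := ((sS b).inv.comp contMDiff_fst).mul hf
  have key := deriv_vel_comm_of_eq_one (b := b) hD (by simp [h1]) (by simp)
  have e1 : ∀ r, velZero I (fun ε => (f ε b)⁻¹ * f ε r) = -V b + V r := by
    intro r
    rw [velZero_mul_of_eq_one ((sS b).inv.mdifferentiableAt (by simp))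
      ((sS r).mdifferentiableAt (by simp)) (by simp [h1]) (h1 r),
      velZero_inv_of_eq_one (sS b) (h1 b), hfV, hfV]
  simp only [e1] at key
  rw [((hasVelAt_const (-V b) b).add (hasVelAt_of_contMDiff hV b)).vel_eq, zero_add] at key
  exact key

/-- The statement for right logarithmic derivatives follows from that for left ones by inversion. -/
theorem deriv_rightLog_of_eq_one {f : ℝ → unitInterval → G}
    (hf : ContMDiff (𝓘(ℝ, ℝ).prod (𝓡∂ 1)) I ∞ (Function.uncurry f)) (h1 : ∀ r, f 0 r = 1)
    {V : unitInterval → E} (hV : ContMDiff (𝓡∂ 1) 𝓘(ℝ, E) ∞ V)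
    (hfV : ∀ r, V r = velZero I (fun ε => f ε r)) (b : unitInterval) :
    deriv (fun ε => rightLog I (f ε) b) 0 = vel 𝓘(ℝ, E) V b := by
  have sS : ∀ r, ContMDiff 𝓘(ℝ, ℝ) I ∞ (fun ε => f ε r) := fun r =>
    hf.comp (contMDiff_id.prodMk contMDiff_const)
  have sR : ∀ ε, ContMDiff (𝓡∂ 1) I ∞ (f ε) := fun ε =>
    hf.comp (contMDiff_const.prodMk contMDiff_id)
  have h := deriv_leftLog_of_eq_one (f := fun ε r => (f ε r)⁻¹) hf.inv (by simp [h1])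
    (V := fun r => -V r) hV.neg
    (fun r => by rw [velZero_inv_of_eq_one (sS r) (h1 r), hfV]) b
  simp only [leftLog_inv (sR _), deriv.fun_neg] at h
  rw [(hasVelAt_of_contMDiff hV b).neg.vel_eq] at h
  exact neg_injective h

end LieGroupCalculus

/-! ### The derivative of the adjoint representation -/

section AdDerivative

variable {E : Type*} [NormedAddCommGroup E] [NormedSpace ℝ E]
  {H : Type*} [TopologicalSpace H] {I : ModelWithCorners ℝ E H}
  {G : Type*} [TopologicalSpace G] [ChartedSpace H G]

theorem contMDiff_Ad [Group G] [LieGroup I ∞ G] (X : E) :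
    ContMDiff I 𝓘(ℝ, E) ∞ (fun g : G => Ad I g X) := by
  have : IsManifold I 1 G := isManifold_one
  exact contMDiff_Ad_apply contMDiff_id contMDiff_const

variable [I.Boundaryless]

theorem mfderiv_eq_fderiv_extChartAt {f : G → E} {x : G}
    (hf : MDifferentiableAt I 𝓘(ℝ, E) f x) (X : E) :
    mfderiv I 𝓘(ℝ, E) f x X =
      fderiv ℝ (fun y => f ((extChartAt I x).symm y)) (extChartAt I x x) X := by
  have h : mfderiv I 𝓘(ℝ, E) f x = fderivWithin ℝ (writtenInExtChartAt I 𝓘(ℝ, E) x f) (range I)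
    (extChartAt I x x) := hf.mfderiv
  rw [I.range_eq_univ, fderivWithin_univ] at h
  exact DFunLike.congr_fun h X

variable [Group G]

variable (I G) in
/-- The product of `G` in the preferred chart at `1`. -/
noncomputable def chartMul (p : E × E) : E :=
  extChartAt I (1 : G) ((extChartAt I (1 : G)).symm p.1 * (extChartAt I (1 : G)).symm p.2)

variable [LieGroup I ∞ G]

theorem contMDiffAt_extChartAt_symm_one {a : E} (ha : a ∈ (extChartAt I (1 : G)).target) :
    ContMDiffAt 𝓘(ℝ, E) I ∞ (extChartAt I (1 : G)).symm a :=
  (contMDiffOn_extChartAt_symm (1 : G)).contMDiffAt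
    ((isOpen_extChartAt_target (1 : G)).mem_nhds ha)

theorem contDiffAt_chartMul :
    ContDiffAt ℝ ∞ (chartMul I G) (extChartAt I (1 : G) 1, extChartAt I (1 : G) 1) := by
  rw [← contMDiffAt_iff_contDiffAt]
  have h := contMDiffAt_extChartAt_symm_one (I := I) (mem_extChartAt_target (I := I) (1 : G))
  have h1 : ContMDiffAt 𝓘(ℝ, E × E) I ∞ (fun p : E × E => (extChartAt I (1 : G)).symm p.1)
      (extChartAt I (1 : G) 1, extChartAt I (1 : G) 1) :=
    ContMDiffAt.comp (f := Prod.fst) _ h contDiffAt_fst.contMDiffAt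
  have h2 : ContMDiffAt 𝓘(ℝ, E × E) I ∞ (fun p : E × E => (extChartAt I (1 : G)).symm p.2)
      (extChartAt I (1 : G) 1, extChartAt I (1 : G) 1) :=
    ContMDiffAt.comp (f := Prod.snd) _ h contDiffAt_snd.contMDiffAt
  refine ContMDiffAt.comp (g := extChartAt I (1 : G)) _ (contMDiffAt_extChartAt' ?_) (h1.mul h2)
  simp

/-- The left invariant vector field of `X` in the preferred chart at `1`. -/
theorem mpullbackWithin_mulInvariantVectorField (X : E) {a : E}
    (ha : a ∈ (extChartAt I (1 : G)).target) :
    VectorField.mpullbackWithin 𝓘(ℝ, E) I (extChartAt I (1 : G)).symm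
      (mulInvariantVectorField (I := I) (G := G) X) (range I) a =
      fderiv ℝ (fun y => chartMul I G (a, y)) (extChartAt I (1 : G) 1) X := by
  have : IsManifold I 1 G := isManifold_one
  set g := (extChartAt I (1 : G)).symm a with hg
  have hgs : g ∈ (chartAt H (1 : G)).source := by
    rw [← extChartAt_source I]; exact (extChartAt I (1 : G)).map_target ha
  have hφ : MDifferentiableAt I 𝓘(ℝ, E) (extChartAt I (1 : G)) (g * 1) := by
    rw [mul_one]; exact mdifferentiableAt_extChartAt hgs
  have hm : MDifferentiableAt I I (fun x : G => g * x) 1 :=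
    (contMDiff_mul_left (n := ∞)).mdifferentiableAt (by simp)
  have hc : mfderiv I 𝓘(ℝ, E) (extChartAt I (1 : G) ∘ fun x : G => g * x) 1 = _ :=
    mfderiv_comp (1 : G) hφ hm
  have h1 := mfderiv_eq_fderiv_extChartAt (hφ.comp (1 : G) hm) X
  refine Eq.trans ?_ h1
  rw [hc]
  have hinv : (mfderiv[range I] (extChartAt I (1 : G)).symm a).inverse =
      mfderiv I 𝓘(ℝ, E) (extChartAt I (1 : G)) g :=
    ContinuousLinearMap.inverse_eq
      (mfderivWithin_extChartAt_symm_comp_mfderiv_extChartAt ha)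
      (mfderiv_extChartAt_comp_mfderivWithin_extChartAt_symm ha)
  rw [VectorField.mpullbackWithin_apply, hinv]
  have e : ∀ g' : G, g' = g → ∀ v : E, (mfderiv I 𝓘(ℝ, E) (extChartAt I (1 : G)) g : E →L[ℝ] E) v =
      (mfderiv I 𝓘(ℝ, E) (extChartAt I (1 : G)) g' : E →L[ℝ] E) v := by
    rintro _ rfl v; rfl
  exact e _ (mul_one g) _

/-- As `g y = (g y g⁻¹) g`, the left invariant vector field of `X` at `g` is the right invariant
vector field of `Ad g X` at `g`. -/
theorem fderiv_chartMul_eq (X : E) {a : E} (ha : a ∈ (extChartAt I (1 : G)).target) :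
    fderiv ℝ (fun y => chartMul I G (a, y)) (extChartAt I (1 : G) 1) X =
      fderiv ℝ (fun y => chartMul I G (y, a)) (extChartAt I (1 : G) 1)
        (Ad I ((extChartAt I (1 : G)).symm a) X) := by
  have : IsManifold I 1 G := isManifold_one
  set g := (extChartAt I (1 : G)).symm a with hg
  have hgs : g ∈ (chartAt H (1 : G)).source := by
    rw [← extChartAt_source I]; exact (extChartAt I (1 : G)).map_target ha
  have hφ : ∀ x, x = g → MDifferentiableAt I 𝓘(ℝ, E) (extChartAt I (1 : G)) x := by
    rintro _ rfl; exact mdifferentiableAt_extChartAt hgs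
  have hm : MDifferentiableAt I I (fun x : G => g * x) 1 :=
    (contMDiff_mul_left (n := ∞)).mdifferentiableAt (by simp)
  have hm' : MDifferentiableAt I I (fun x : G => x * g) 1 :=
    (contMDiff_mul_right (n := ∞)).mdifferentiableAt (by simp)
  have d1 : MDifferentiableAt I 𝓘(ℝ, E) (extChartAt I (1 : G) ∘ fun x : G => g * x) 1 :=
    (hφ _ (mul_one g)).comp (1 : G) hm
  have d2 : MDifferentiableAt I 𝓘(ℝ, E) (extChartAt I (1 : G) ∘ fun x : G => x * g) 1 :=
    (hφ _ (one_mul g)).comp (1 : G) hm'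
  have d2' : MDifferentiableAt I 𝓘(ℝ, E) (extChartAt I (1 : G) ∘ fun x : G => x * g)
      (g * 1 * g⁻¹) := by
    rw [mul_one, mul_inv_cancel]; exact d2
  have hcomp : (extChartAt I (1 : G) ∘ fun x : G => g * x) =
      (extChartAt I (1 : G) ∘ fun x : G => x * g) ∘ fun x => g * x * g⁻¹ := by
    ext x; simp
  have hc : mfderiv I 𝓘(ℝ, E) ((extChartAt I (1 : G) ∘ fun x : G => x * g) ∘
      fun x => g * x * g⁻¹) 1 = _ :=
    mfderiv_comp (1 : G) d2' ((contMDiff_mul_mul_inv g).mdifferentiableAt (by simp))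
  have h1 := mfderiv_eq_fderiv_extChartAt d1 X
  have h2 := mfderiv_eq_fderiv_extChartAt d2 (Ad I g X)
  refine h1.symm.trans (Eq.trans ?_ h2)
  rw [hcomp, hc]
  have e : ∀ g' : G, g' = 1 → ∀ v : E,
      (mfderiv I 𝓘(ℝ, E) (extChartAt I (1 : G) ∘ fun x : G => x * g) g' : E →L[ℝ] E) v =
      (mfderiv I 𝓘(ℝ, E) (extChartAt I (1 : G) ∘ fun x : G => x * g) 1 : E →L[ℝ] E) v := by
    rintro _ rfl v; rfl
  exact e _ (by simp) _

/-- The bracket of the Lie algebra in terms of the second derivative of the product. -/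
theorem bracket_eq_fderiv_fderiv (X Y : E) :
    bracket I G X Y =
      fderiv ℝ (fun a => fderiv ℝ (fun y => chartMul I G (a, y)) (extChartAt I (1 : G) 1) Y)
        (extChartAt I (1 : G) 1) X -
      fderiv ℝ (fun a => fderiv ℝ (fun y => chartMul I G (a, y)) (extChartAt I (1 : G) 1) X)
        (extChartAt I (1 : G) 1) Y := by
  have : IsManifold I 1 G := isManifold_one
  have hev : ∀ Z : E, VectorField.mpullbackWithin 𝓘(ℝ, E) I (extChartAt I (1 : G)).symm
      (mulInvariantVectorField (I := I) (G := G) Z) (range I) =ᶠ[𝓝 (extChartAt I (1 : G) 1)]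
      fun a => fderiv ℝ (fun y => chartMul I G (a, y)) (extChartAt I (1 : G) 1) Z := fun Z => by
    filter_upwards [(isOpen_extChartAt_target (I := I) (1 : G)).mem_nhds
      (mem_extChartAt_target (1 : G))] with a ha
    exact mpullbackWithin_mulInvariantVectorField Z ha
  have h0 : ∀ Z : E, fderiv ℝ (fun y => chartMul I G (extChartAt I (1 : G) 1, y))
      (extChartAt I (1 : G) 1) Z = Z := fun Z => by
    have e : (fun y => chartMul I G (extChartAt I (1 : G) 1, y)) =ᶠ[𝓝 (extChartAt I (1 : G) 1)]
        id := by
      filter_upwards [(isOpen_extChartAt_target (I := I) (1 : G)).mem_nhds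
        (mem_extChartAt_target (1 : G))] with a ha
      simp only [chartMul, extChartAt_to_inv, one_mul, id_eq]
      exact (extChartAt I (1 : G)).right_inv ha
    rw [e.fderiv_eq, fderiv_id]
    rfl
  have hb : bracket I G X Y = VectorField.mlieBracketWithin I
      (mulInvariantVectorField (I := I) (G := G) X) (mulInvariantVectorField (I := I) (G := G) Y)
      univ (1 : G) := by
    rw [VectorField.mlieBracketWithin_univ]; rfl
  have hinv : (mfderiv I 𝓘(ℝ, E) (extChartAt I (1 : G)) 1).inverse =
      ContinuousLinearMap.id ℝ (TangentSpace I (1 : G)) := by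
    rw [mfderiv_extChartAt_self]; exact ContinuousLinearMap.inverse_id
  have hset : (extChartAt I (1 : G)).symm ⁻¹' univ ∩ range I = univ := by
    rw [I.range_eq_univ]; simp
  have key : ∀ s : Set E, s = univ → ∀ V W V' W' : E → E, V =ᶠ[𝓝 (extChartAt I (1 : G) 1)] V' →
      W =ᶠ[𝓝 (extChartAt I (1 : G) 1)] W' →
      VectorField.lieBracketWithin ℝ V W s (extChartAt I (1 : G) 1) =
        VectorField.lieBracket ℝ V' W' (extChartAt I (1 : G) 1) := by
    rintro _ rfl V W V' W' hV hW
    rw [VectorField.lieBracketWithin_univ]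
    exact hV.lieBracket_vectorField_eq hW
  rw [hb, VectorField.mlieBracketWithin_apply]
  refine (DFunLike.congr_fun hinv _).trans ?_
  refine (key _ hset _ _ _ _ (hev X) (hev Y)).trans ?_
  rw [VectorField.lieBracket, h0, h0]

/-- The derivative of the adjoint action at `1` is the Lie bracket. -/
theorem mfderiv_Ad_apply (X Y : E) :
    mfderiv I 𝓘(ℝ, E) (fun g : G => Ad I g X) 1 Y = bracket I G Y X := by
  set φ := extChartAt I (1 : G) with hφ
  set a₀ := φ 1 with ha₀
  have htarget : φ.target ∈ 𝓝 a₀ :=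
    (isOpen_extChartAt_target (I := I) (1 : G)).mem_nhds (mem_extChartAt_target (1 : G))
  have hm : ContDiffAt ℝ ∞ (chartMul I G) (a₀, a₀) := contDiffAt_chartMul
  have hev : ∀ᶠ p in 𝓝 (a₀, a₀), DifferentiableAt ℝ (chartMul I G) p := by
    have h1 : ContDiffAt ℝ 1 (chartMul I G) (a₀, a₀) := hm.of_le (by exact_mod_cast le_top)
    exact (h1.eventually (by decide)).mono fun p hp => hp.differentiableAt (by simp)
  set D := fderiv ℝ (chartMul I G) with hD
  have hDd : DifferentiableAt ℝ D (a₀, a₀) :=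
    (hm.fderiv_right (m := ∞) (by simp)).differentiableAt (by simp)
  have hsym : IsSymmSndFDerivAt ℝ (chartMul I G) (a₀, a₀) := by
    refine hm.isSymmSndFDerivAt ?_
    rw [minSmoothness_of_isRCLikeNormedField]; exact ENat.LEInfty.out
  have cl : HasFDerivAt (fun a : E => ((a, a₀) : E × E)) (ContinuousLinearMap.inl ℝ E E) a₀ :=
    hasFDerivAt_prodMk_left _ _
  have cr : HasFDerivAt (fun a : E => ((a₀, a) : E × E)) (ContinuousLinearMap.inr ℝ E E) a₀ :=
    hasFDerivAt_prodMk_right _ _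
  have hL : ∀ Z : E, (fun a => fderiv ℝ (fun y => chartMul I G (a, y)) a₀ Z) =ᶠ[𝓝 a₀]
      fun a => D (a, a₀) (0, Z) := fun Z => by
    filter_upwards [cl.continuousAt.eventually hev] with a ha
    have := (ha.hasFDerivAt.comp a₀ (hasFDerivAt_prodMk_right a a₀)).fderiv
    simp only [Function.comp_def] at this
    rw [this]
    simp [hD]
  have hR : ∀ᶠ a in 𝓝 a₀, ∀ Z : E, fderiv ℝ (fun y => chartMul I G (y, a)) a₀ Z =
      D (a₀, a) (Z, 0) := by
    filter_upwards [cr.continuousAt.eventually hev] with a ha Z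
    have := (HasFDerivAt.comp (f := fun y => (y, a)) a₀ ha.hasFDerivAt
      (hasFDerivAt_prodMk_left a₀ a)).fderiv
    simp only [Function.comp_def] at this
    rw [this]
    simp [hD]
  have dL : ∀ Z : E, HasFDerivAt (fun a => D (a, a₀) (0, Z))
      (((ContinuousLinearMap.apply ℝ E ((0, Z) : E × E)).comp (fderiv ℝ D (a₀, a₀))).comp
        (ContinuousLinearMap.inl ℝ E E)) a₀ := fun Z => by
    have h : HasFDerivAt (fun p => D p (0, Z)) _ (a₀, a₀) :=
      (ContinuousLinearMap.apply ℝ E ((0, Z) : E × E)).hasFDerivAt.comp (a₀, a₀) hDd.hasFDerivAt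
    exact HasFDerivAt.comp (f := fun a => (a, a₀)) a₀ h cl
  have eL : ∀ Z W : E, fderiv ℝ (fun a => fderiv ℝ (fun y => chartMul I G (a, y)) a₀ Z) a₀ W =
      fderiv ℝ D (a₀, a₀) (W, 0) (0, Z) := fun Z W => by
    rw [(hL Z).fderiv_eq, (dL Z).fderiv]
    simp
  -- the adjoint action in the chart
  have hA : DifferentiableAt ℝ (fun a => Ad I (φ.symm a) X) a₀ := by
    have h := ((contMDiff_Ad (I := I) (G := G) X).contMDiffAt (x := φ.symm a₀)).comp a₀
      (contMDiffAt_extChartAt_symm_one (I := I) (mem_extChartAt_target (1 : G)))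
    exact (contMDiffAt_iff_contDiffAt.1 h).differentiableAt (by simp)
  have hA0 : Ad I (φ.symm a₀) X = X := by
    rw [ha₀, hφ, extChartAt_to_inv, Ad_one]
  have hD0 : ∀ Z, D (a₀, a₀) (Z, 0) = Z := fun Z => by
    have e : (fun y => chartMul I G (y, a₀)) =ᶠ[𝓝 a₀] id := by
      filter_upwards [htarget] with a ha
      simp only [chartMul, ha₀, hφ, extChartAt_to_inv, mul_one, id_eq]
      exact φ.right_inv ha
    rw [← hR.self_of_nhds, e.fderiv_eq, fderiv_id]
    rfl
  -- `g X = (Ad g X) g` in the chart; differentiating it at `g = 1` gives the claim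
  have hLR : (fun a => D (a, a₀) (0, X)) =ᶠ[𝓝 a₀]
      fun a => D (a₀, a) (Ad I (φ.symm a) X, 0) := by
    filter_upwards [hL X, hR, htarget] with a h1 h2 h3
    rw [← h1, ← h2]
    exact fderiv_chartMul_eq X h3
  have dR : HasFDerivAt (fun a => D (a₀, a) (Ad I (φ.symm a) X, 0)) _ a₀ :=
    (hDd.hasFDerivAt.comp a₀ cr).clm_apply
      (hA.hasFDerivAt.prodMk (hasFDerivAt_const (0 : E) a₀))
  have h1 := hLR.fderiv_eq (𝕜 := ℝ)
  rw [(dL X).fderiv, dR.fderiv] at h1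
  have h2 := DFunLike.congr_fun h1 Y
  simp only [ContinuousLinearMap.comp_apply, ContinuousLinearMap.inl_apply,
    ContinuousLinearMap.inr_apply, ContinuousLinearMap.apply_apply, add_apply,
    ContinuousLinearMap.flip_apply, hA0, ContinuousLinearMap.prod_apply, Function.comp_apply,
    zero_apply, hD0] at h2
  rw [bracket_eq_fderiv_fderiv, eL, eL,
    mfderiv_eq_fderiv_extChartAt ((contMDiff_Ad X).mdifferentiableAt (by simp)), h2,
    hsym (X, 0) (0, Y)]
  abel

end AdDerivative

/-! ### Infinitesimal invariance and the Maurer-Cartan equation -/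

section Bracket

variable {E : Type*} [NormedAddCommGroup E] [NormedSpace ℝ E]
  {H : Type*} [TopologicalSpace H] {I : ModelWithCorners ℝ E H}
  {G : Type*} [TopologicalSpace G] [ChartedSpace H G] [Group G] [LieGroup I ∞ G]

theorem lieGroup_minSmoothness : LieGroup I (minSmoothness ℝ 3) G :=
  LieGroup.of_le (n := ∞) (by
    rw [minSmoothness_of_isRCLikeNormedField]; exact ENat.LEInfty.out)

variable [I.Boundaryless]

/-- The differential of `(g, X) ↦ Ad g X` at `(1, X)`. -/
theorem mfderiv_uncurry_Ad_apply (X Y Z : E) :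
    mfderiv (I.prod 𝓘(ℝ, E)) 𝓘(ℝ, E) (fun p : G × E => Ad I p.1 p.2) (1, X) (Y, Z) =
      bracket I G Y X + Z := by
  have : IsManifold I 1 G := isManifold_one
  have hm : MDifferentiableAt (I.prod 𝓘(ℝ, E)) 𝓘(ℝ, E) (fun p : G × E => Ad I p.1 p.2) (1, X) :=
    (contMDiff_Ad_apply contMDiff_fst contMDiff_snd).mdifferentiableAt (by simp)
  refine (mfderiv_prod_eq_add_apply hm).trans ?_
  refine congrArg₂ (fun x y : E => x + y) (mfderiv_Ad_apply X Y) ?_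
  have : (fun z : E => Ad I (1 : G) z) = id := by ext z; simp [Ad_one]
  change mfderiv 𝓘(ℝ, E) 𝓘(ℝ, E) (fun z : E => Ad I (1 : G) z) X Z = Z
  rw [this, mfderiv_id]
  rfl

theorem deriv_Ad_apply_of_eq_one {c : ℝ → G} {X : ℝ → E} (hc : ContMDiff 𝓘(ℝ, ℝ) I ∞ c)
    (hX : ContDiff ℝ ∞ X) (h1 : c 0 = 1) :
    HasDerivAt (fun ε => Ad I (c ε) (X ε)) (bracket I G (velZero I c) (X 0) + deriv X 0) 0 := by
  have : IsManifold I 1 G := isManifold_one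
  have hs : ContMDiff 𝓘(ℝ, ℝ) 𝓘(ℝ, E) ∞ (fun ε => Ad I (c ε) (X ε)) :=
    contMDiff_Ad_apply hc hX.contMDiff
  have hm : MDifferentiableAt (I.prod 𝓘(ℝ, E)) 𝓘(ℝ, E) (fun p : G × E => Ad I p.1 p.2)
      (c 0, X 0) :=
    (contMDiff_Ad_apply contMDiff_fst contMDiff_snd).mdifferentiableAt (by simp)
  have hc' : MDifferentiableAt 𝓘(ℝ, ℝ) I c 0 := hc.mdifferentiableAt (by simp)
  have hX' : MDifferentiableAt 𝓘(ℝ, ℝ) 𝓘(ℝ, E) X 0 := hX.contMDiff.mdifferentiableAt (by simp)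
  have h : mfderiv 𝓘(ℝ, ℝ) 𝓘(ℝ, E) (fun ε => Ad I (c ε) (X ε)) 0 = _ :=
    mfderiv_comp 0 hm (hc'.prodMk hX')
  have hd := (hs.contDiff.differentiable (by simp) 0).hasDerivAt
  refine hd.congr_deriv ?_
  rw [← fderiv_apply_one_eq_deriv, ← mfderiv_eq_fderiv, h, mfderiv_prodMk hc' hX', h1,
    ← fderiv_apply_one_eq_deriv, ← mfderiv_eq_fderiv]
  exact mfderiv_uncurry_Ad_apply _ _ _

theorem vel_Ad_apply_of_eq_one {p : unitInterval → G} {X : unitInterval → E} {t : unitInterval}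
    (hp : ContMDiff (𝓡∂ 1) I ∞ p) (hX : ContMDiff (𝓡∂ 1) 𝓘(ℝ, E) ∞ X) (h1 : p t = 1) :
    vel 𝓘(ℝ, E) (fun t => Ad I (p t) (X t)) t =
      bracket I G (vel I p t) (X t) + vel 𝓘(ℝ, E) X t := by
  have : IsManifold I 1 G := isManifold_one
  have hm : MDifferentiableAt (I.prod 𝓘(ℝ, E)) 𝓘(ℝ, E) (fun p : G × E => Ad I p.1 p.2)
      (p t, X t) :=
    (contMDiff_Ad_apply contMDiff_fst contMDiff_snd).mdifferentiableAt (by simp)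
  have hp' : MDifferentiableAt (𝓡∂ 1) I p t := hp.mdifferentiableAt (by simp)
  have hX' : MDifferentiableAt (𝓡∂ 1) 𝓘(ℝ, E) X t := hX.mdifferentiableAt (by simp)
  have h : mfderiv (𝓡∂ 1) 𝓘(ℝ, E) (fun t => Ad I (p t) (X t)) t = _ :=
    mfderiv_comp t hm (hp'.prodMk hX')
  rw [vel, h, mfderiv_prodMk hp' hX', h1]
  exact mfderiv_uncurry_Ad_apply _ _ _

theorem hasVelAt_Ad_apply {p : unitInterval → G} {X : unitInterval → E}
    (hp : ContMDiff (𝓡∂ 1) I ∞ p) (hX : ContMDiff (𝓡∂ 1) 𝓘(ℝ, E) ∞ X) (t : unitInterval) :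
    HasVelAt (fun t => Ad I (p t) (X t))
      (Ad I (p t) (vel 𝓘(ℝ, E) X t + bracket I G (leftLog I p t) (X t))) t := by
  have hq : ContMDiff (𝓡∂ 1) I ∞ (fun t' => (p t)⁻¹ * p t') := contMDiff_const.mul hp
  have h2 := hasVelAt_of_contMDiff (contMDiff_Ad_apply hq hX) t
  rw [vel_Ad_apply_of_eq_one hq hX (by simp)] at h2
  have h3 := h2.clm (Ad I (p t))
  simp only [← Ad_mul, mul_inv_cancel_left] at h3
  rw [add_comm] at h3
  exact h3

/-- The adjoint action is by automorphisms of the Lie algebra. -/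
theorem Ad_bracket (g : G) (X Y : E) :
    Ad I g (bracket I G X Y) = bracket I G (Ad I g X) (Ad I g Y) := by
  have hφ := contMDiff_mul_mul_inv (I := I) g
  have e : (fun x : G => Ad I x (Ad I g Y)) ∘ (fun x => g * x * g⁻¹) =
      fun x => Ad I g (Ad I x Y) := by
    ext x
    simp only [Function.comp_apply, ← Ad_mul]
    simp
  have hm : MDifferentiableAt I 𝓘(ℝ, E) (fun x : G => Ad I x (Ad I g Y)) (g * 1 * g⁻¹) :=
    (contMDiff_Ad _).mdifferentiableAt (by simp)
  have h1 : mfderiv I 𝓘(ℝ, E) ((fun x : G => Ad I x (Ad I g Y)) ∘ (fun x => g * x * g⁻¹)) 1 = _ :=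
    mfderiv_comp 1 hm (hφ.mdifferentiableAt (by simp))
  have h2 : mfderiv I 𝓘(ℝ, E) (Ad I g ∘ fun x : G => Ad I x Y) 1 = _ :=
    mfderiv_comp 1 (((Ad I g).contMDiff (n := ∞)).mdifferentiableAt (by simp))
      ((contMDiff_Ad Y).mdifferentiableAt (by simp))
  rw [e, show g * (1 : G) * g⁻¹ = 1 by simp] at h1
  have h3 := (DFunLike.congr_fun h1 X).symm.trans (DFunLike.congr_fun h2 X)
  rw [mfderiv_eq_fderiv, ContinuousLinearMap.fderiv] at h3
  refine Eq.trans ?_ (h3.symm.trans ?_)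
  · exact congrArg (Ad I g) (mfderiv_Ad_apply Y X).symm
  · exact mfderiv_Ad_apply (Ad I g Y) (Ad I g X)

/-- Invariance of the form under the adjoint action of the Lie algebra. -/
theorem InvariantForm.form_bracket (B : InvariantForm I G) (X Y Z : E) :
    B.form (bracket I G X Y) Z = -B.form Y (bracket I G X Z) := by
  have hd : ∀ W : E, DifferentiableAt ℝ
      (fun a => Ad I ((extChartAt I (1 : G)).symm a) W) (extChartAt I (1 : G) 1) := fun W => by
    have h := ((contMDiff_Ad (I := I) (G := G) W).contMDiffAt
      (x := (extChartAt I (1 : G)).symm (extChartAt I (1 : G) 1))).comp (extChartAt I (1 : G) 1)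
      (contMDiffAt_extChartAt_symm_one (I := I) (mem_extChartAt_target (1 : G)))
    exact (contMDiffAt_iff_contDiffAt.1 h).differentiableAt (by simp)
  have hA : ∀ W : E, fderiv ℝ (fun a => Ad I ((extChartAt I (1 : G)).symm a) W)
      (extChartAt I (1 : G) 1) X = bracket I G X W := fun W =>
    (mfderiv_eq_fderiv_extChartAt ((contMDiff_Ad W).mdifferentiableAt (by simp)) X).symm.trans
      (mfderiv_Ad_apply W X)
  have h1 := ((B.form.hasFDerivAt.comp (extChartAt I (1 : G) 1) (hd Y).hasFDerivAt).clm_apply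
    (hd Z).hasFDerivAt)
  have e : (fun a => (B.form ∘ fun a => Ad I ((extChartAt I (1 : G)).symm a) Y) a
      (Ad I ((extChartAt I (1 : G)).symm a) Z)) = fun _ => B.form Y Z := by
    ext a
    exact B.ad_invariant _ _ _
  rw [e] at h1
  have h2 := DFunLike.congr_fun (h1.unique (hasFDerivAt_const _ _)) X
  simp only [add_apply, ContinuousLinearMap.comp_apply, ContinuousLinearMap.flip_apply, hA,
    Function.comp_apply, extChartAt_to_inv, Ad_one, zero_apply] at h2
  linarith

/-- The Maurer-Cartan equation. -/
theorem vel_leftLog_eq_vel_leftLog_add {f : unitInterval → unitInterval → G}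
    (hf : ContMDiff ((𝓡∂ 1).prod (𝓡∂ 1)) I ∞ (Function.uncurry f)) (a b : unitInterval) :
    vel 𝓘(ℝ, E) (fun r => leftLog I (fun s => f s r) a) b =
      vel 𝓘(ℝ, E) (fun s => leftLog I (fun r => f s r) b) a +
        bracket I G (leftLog I (fun s => f s b) a) (leftLog I (fun r => f a r) b) := by
  rw [vel_leftLog_eq_Ad_vel_rightLog hf]
  simp only [rightLog_eq_Ad_leftLog (contMDiff_slice_snd hf _)]
  rw [(hasVelAt_Ad_apply (contMDiff_slice_fst hf b)
    (contMDiff_leftLog (Φ := f) (τ := fun _ => b) hf contMDiff_const) a).vel_eq,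
    Ad_inv_cancel_left]

end Bracket

/-! ### The Lie bracket as a continuous bilinear map -/

section BracketBilinear

variable {E : Type*} [NormedAddCommGroup E] [NormedSpace ℝ E] [FiniteDimensional ℝ E]
  {H : Type*} [TopologicalSpace H] {I : ModelWithCorners ℝ E H}
  {G : Type*} [TopologicalSpace G] [ChartedSpace H G] [Group G] [LieGroup I ∞ G]

variable (I G) in
/-- The Lie bracket as a continuous bilinear map. -/
noncomputable def bracketL : E →L[ℝ] E →L[ℝ] E :=
  have : LieGroup I (minSmoothness ℝ 3) G := lieGroup_minSmoothness
  have : CompleteSpace E := FiniteDimensional.complete ℝ E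
  (LinearMap.mk₂ ℝ (bracket I G)
    (fun x y z => add_lie (L := GroupLieAlgebra I G) (M := GroupLieAlgebra I G) x y z)
    (fun c x y => smul_lie (R := ℝ) (L := GroupLieAlgebra I G) (M := GroupLieAlgebra I G) c x y)
    (fun x y z => lie_add (L := GroupLieAlgebra I G) (M := GroupLieAlgebra I G) x y z)
    (fun c x y => lie_smul (R := ℝ) (L := GroupLieAlgebra I G)
      (M := GroupLieAlgebra I G) c x y)).toContinuousBilinearMap

theorem bracketL_apply (X Y : E) : bracketL I G X Y = bracket I G X Y := rfl

theorem bracket_add_left (X Y Z : E) :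
    bracket I G (X + Y) Z = bracket I G X Z + bracket I G Y Z := by
  simp only [← bracketL_apply, map_add, add_apply]

theorem bracket_add_right (X Y Z : E) :
    bracket I G X (Y + Z) = bracket I G X Y + bracket I G X Z := by
  simp only [← bracketL_apply, map_add]

theorem bracket_smul_left (c : ℝ) (X Y : E) : bracket I G (c • X) Y = c • bracket I G X Y := by
  simp only [← bracketL_apply, map_smul, smul_apply]

theorem bracket_smul_right (c : ℝ) (X Y : E) : bracket I G X (c • Y) = c • bracket I G X Y := by
  simp only [← bracketL_apply, map_smul]

theorem bracket_neg_left (X Y : E) : bracket I G (-X) Y = -bracket I G X Y := by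
  simp only [← bracketL_apply, map_neg, neg_apply]

theorem bracket_self (X : E) : bracket I G X X = 0 := by
  have : LieGroup I (minSmoothness ℝ 3) G := lieGroup_minSmoothness
  have : CompleteSpace E := FiniteDimensional.complete ℝ E
  exact lie_self (L := GroupLieAlgebra I G) X

theorem bracket_skew (X Y : E) : -bracket I G Y X = bracket I G X Y := by
  have : LieGroup I (minSmoothness ℝ 3) G := lieGroup_minSmoothness
  have : CompleteSpace E := FiniteDimensional.complete ℝ E
  exact lie_skew (L := GroupLieAlgebra I G) X Y

theorem bracket_jacobi (X Y Z : E) : bracket I G X (bracket I G Y Z) =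
    bracket I G (bracket I G X Y) Z + bracket I G Y (bracket I G X Z) := by
  have : LieGroup I (minSmoothness ℝ 3) G := lieGroup_minSmoothness
  have : CompleteSpace E := FiniteDimensional.complete ℝ E
  exact LieRingModule.leibniz_lie (L := GroupLieAlgebra I G) (M := GroupLieAlgebra I G) X Y Z

theorem HasVelAt.bracket {X Y : unitInterval → E} {X' Y' : E} {t : unitInterval}
    (hX : HasVelAt X X' t) (hY : HasVelAt Y Y' t) :
    HasVelAt (fun t => bracket I G (X t) (Y t)) (bracket I G X' (Y t) + bracket I G (X t) Y') t :=
  HasVelAt.bilin (bracketL I G) hX hY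

end BracketBilinear

/-! ### Stokes' theorem on the square and the cube -/

section CubeIntegrals

theorem contMDiff_vel_square_fst {g : unitInterval × unitInterval → ℝ}
    (hg : ContMDiff ((𝓡∂ 1).prod (𝓡∂ 1)) 𝓘(ℝ, ℝ) ∞ g) :
    ContMDiff ((𝓡∂ 1).prod (𝓡∂ 1)) 𝓘(ℝ, ℝ) ∞
      (fun x : unitInterval × unitInterval => vel 𝓘(ℝ, ℝ) (fun s => g (s, x.2)) x.1) :=
    contMDiff_vel (Ψ := fun (x : unitInterval × unitInterval) s => g (s, x.2))
      (hg.comp (contMDiff_snd.prodMk (contMDiff_snd.comp contMDiff_fst))) contMDiff_fst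

theorem contMDiff_vel_square_snd {g : unitInterval × unitInterval → ℝ}
    (hg : ContMDiff ((𝓡∂ 1).prod (𝓡∂ 1)) 𝓘(ℝ, ℝ) ∞ g) :
    ContMDiff ((𝓡∂ 1).prod (𝓡∂ 1)) 𝓘(ℝ, ℝ) ∞
      (fun x : unitInterval × unitInterval => vel 𝓘(ℝ, ℝ) (fun r => g (x.1, r)) x.2) :=
    contMDiff_vel (Ψ := fun (x : unitInterval × unitInterval) r => g (x.1, r))
      (hg.comp ((contMDiff_fst.comp contMDiff_fst).prodMk contMDiff_snd)) contMDiff_snd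

theorem integral_vel_fst {g : unitInterval × unitInterval → ℝ}
    (hg : ContMDiff ((𝓡∂ 1).prod (𝓡∂ 1)) 𝓘(ℝ, ℝ) ∞ g) :
    ∫ x : unitInterval × unitInterval, vel 𝓘(ℝ, ℝ) (fun s => g (s, x.2)) x.1 =
      ∫ r, g (1, r) - g (0, r) := by
  rw [Measure.volume_eq_prod,
    integral_prod_symm _ (integrable_of_continuous (contMDiff_vel_square_fst hg).continuous)]
  refine integral_congr_ae (Eventually.of_forall fun r => ?_)
  exact integral_vel (f := fun s => g (s, r)) (hg.comp (contMDiff_id.prodMk contMDiff_const))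

theorem integral_vel_snd {g : unitInterval × unitInterval → ℝ}
    (hg : ContMDiff ((𝓡∂ 1).prod (𝓡∂ 1)) 𝓘(ℝ, ℝ) ∞ g) :
    ∫ x : unitInterval × unitInterval, vel 𝓘(ℝ, ℝ) (fun r => g (x.1, r)) x.2 =
      ∫ s, g (s, 1) - g (s, 0) := by
  rw [Measure.volume_eq_prod,
    integral_prod _ (integrable_of_continuous (contMDiff_vel_square_snd hg).continuous)]
  refine integral_congr_ae (Eventually.of_forall fun s => ?_)
  exact integral_vel (f := fun r => g (s, r)) (hg.comp (contMDiff_const.prodMk contMDiff_id))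

variable {g : unitInterval × unitInterval × unitInterval → ℝ}
  (hg : ContMDiff ((𝓡∂ 1).prod ((𝓡∂ 1).prod (𝓡∂ 1))) 𝓘(ℝ, ℝ) ∞ g)

include hg

theorem contMDiff_vel_cube_fst : ContMDiff ((𝓡∂ 1).prod ((𝓡∂ 1).prod (𝓡∂ 1))) 𝓘(ℝ, ℝ) ∞
    (fun x : unitInterval × unitInterval × unitInterval =>
      vel 𝓘(ℝ, ℝ) (fun u => g (u, x.2.1, x.2.2)) x.1) :=
  contMDiff_vel (Ψ := fun (x : unitInterval × unitInterval × unitInterval) u =>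
    g (u, x.2.1, x.2.2))
    (hg.comp (contMDiff_snd.prodMk (contMDiff_snd.comp contMDiff_fst))) contMDiff_fst

theorem contMDiff_vel_cube_snd : ContMDiff ((𝓡∂ 1).prod ((𝓡∂ 1).prod (𝓡∂ 1))) 𝓘(ℝ, ℝ) ∞
    (fun x : unitInterval × unitInterval × unitInterval =>
      vel 𝓘(ℝ, ℝ) (fun s => g (x.1, s, x.2.2)) x.2.1) :=
  contMDiff_vel (Ψ := fun (x : unitInterval × unitInterval × unitInterval) s =>
    g (x.1, s, x.2.2)) (hg.comp ((contMDiff_fst.comp contMDiff_fst).prodMk (contMDiff_snd.prodMk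
      (contMDiff_snd.comp (contMDiff_snd.comp contMDiff_fst)))))
    (contMDiff_fst.comp contMDiff_snd)

theorem contMDiff_vel_cube_trd : ContMDiff ((𝓡∂ 1).prod ((𝓡∂ 1).prod (𝓡∂ 1))) 𝓘(ℝ, ℝ) ∞
    (fun x : unitInterval × unitInterval × unitInterval =>
      vel 𝓘(ℝ, ℝ) (fun r => g (x.1, x.2.1, r)) x.2.2) :=
  contMDiff_vel (Ψ := fun (x : unitInterval × unitInterval × unitInterval) r =>
    g (x.1, x.2.1, r)) (hg.comp ((contMDiff_fst.comp contMDiff_fst).prodMk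
      ((contMDiff_fst.comp (contMDiff_snd.comp contMDiff_fst)).prodMk contMDiff_snd)))
    (contMDiff_snd.comp contMDiff_snd)

theorem integral_vel_cube_fst :
    ∫ x : unitInterval × unitInterval × unitInterval,
      vel 𝓘(ℝ, ℝ) (fun u => g (u, x.2.1, x.2.2)) x.1 =
      (∫ y : unitInterval × unitInterval, g (1, y)) -
        ∫ y : unitInterval × unitInterval, g (0, y) := by
  have hc : ∀ u, Continuous fun y : unitInterval × unitInterval => g (u, y) := fun u =>
    hg.continuous.comp (by fun_prop)
  rw [Measure.volume_eq_prod,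
    integral_prod_symm _ (integrable_of_continuous (contMDiff_vel_cube_fst hg).continuous),
    ← integral_sub (integrable_of_continuous (hc 1)) (integrable_of_continuous (hc 0))]
  refine integral_congr_ae (Eventually.of_forall fun y => ?_)
  exact integral_vel (f := fun u => g (u, y)) (hg.comp (contMDiff_id.prodMk contMDiff_const))

theorem integral_vel_cube_snd :
    ∫ x : unitInterval × unitInterval × unitInterval,
      vel 𝓘(ℝ, ℝ) (fun s => g (x.1, s, x.2.2)) x.2.1 =
      (∫ y : unitInterval × unitInterval, g (y.1, 1, y.2)) -
        ∫ y : unitInterval × unitInterval, g (y.1, 0, y.2) := by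
  have hc : ∀ s, Continuous fun y : unitInterval × unitInterval => g (y.1, s, y.2) := fun s =>
    hg.continuous.comp (by fun_prop)
  rw [← integral_sub (integrable_of_continuous (hc 1)) (integrable_of_continuous (hc 0)),
    Measure.volume_eq_prod,
    integral_prod _ (integrable_of_continuous (contMDiff_vel_cube_snd hg).continuous),
    Measure.volume_eq_prod,
    integral_prod (fun y : unitInterval × unitInterval => g (y.1, 1, y.2) - g (y.1, 0, y.2))
      (integrable_of_continuous ((hc 1).sub (hc 0)))]
  refine integral_congr_ae (Eventually.of_forall fun u => ?_)
  exact integral_vel_fst (g := fun y => g (u, y)) (hg.comp (contMDiff_const.prodMk contMDiff_id))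

theorem integral_vel_cube_trd :
    ∫ x : unitInterval × unitInterval × unitInterval,
      vel 𝓘(ℝ, ℝ) (fun r => g (x.1, x.2.1, r)) x.2.2 =
      ∫ y : unitInterval × unitInterval, g (y.1, y.2, 1) - g (y.1, y.2, 0) := by
  have hc : Continuous fun y : unitInterval × unitInterval => g (y.1, y.2, 1) - g (y.1, y.2, 0) :=
    (hg.continuous.comp (by fun_prop)).sub (hg.continuous.comp (by fun_prop))
  rw [Measure.volume_eq_prod,
    integral_prod _ (integrable_of_continuous (contMDiff_vel_cube_trd hg).continuous),
    Measure.volume_eq_prod, integral_prod _ (integrable_of_continuous hc)]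
  refine integral_congr_ae (Eventually.of_forall fun u => ?_)
  exact integral_vel_snd (g := fun y => g (u, y)) (hg.comp (contMDiff_const.prodMk contMDiff_id))

end CubeIntegrals

/-! ### Smoothness of logarithmic derivatives on the cube -/

section LogDerivatives

variable {E : Type*} [NormedAddCommGroup E] [NormedSpace ℝ E]
  {H : Type*} [TopologicalSpace H] {I : ModelWithCorners ℝ E H}
  {G : Type*} [TopologicalSpace G] [ChartedSpace H G] [Group G] [LieGroup I ∞ G]
  {F : unitInterval × unitInterval × unitInterval → G}
  (hF : ContMDiff ((𝓡∂ 1).prod ((𝓡∂ 1).prod (𝓡∂ 1))) I ∞ F)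

include hF

theorem contMDiff_leftLog_cube_fst : ContMDiff ((𝓡∂ 1).prod ((𝓡∂ 1).prod (𝓡∂ 1))) 𝓘(ℝ, E) ∞
    (fun x : unitInterval × unitInterval × unitInterval =>
      leftLog I (fun u => F (u, x.2.1, x.2.2)) x.1) :=
  contMDiff_leftLog (Φ := fun (x : unitInterval × unitInterval × unitInterval) u =>
    F (u, x.2.1, x.2.2))
    (hF.comp (contMDiff_snd.prodMk (contMDiff_snd.comp contMDiff_fst))) contMDiff_fst

theorem contMDiff_leftLog_cube_snd : ContMDiff ((𝓡∂ 1).prod ((𝓡∂ 1).prod (𝓡∂ 1))) 𝓘(ℝ, E) ∞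
    (fun x : unitInterval × unitInterval × unitInterval =>
      leftLog I (fun s => F (x.1, s, x.2.2)) x.2.1) :=
  contMDiff_leftLog (Φ := fun (x : unitInterval × unitInterval × unitInterval) s =>
    F (x.1, s, x.2.2)) (hF.comp ((contMDiff_fst.comp contMDiff_fst).prodMk (contMDiff_snd.prodMk
      (contMDiff_snd.comp (contMDiff_snd.comp contMDiff_fst)))))
    (contMDiff_fst.comp contMDiff_snd)

theorem contMDiff_rightLog_cube_fst : ContMDiff ((𝓡∂ 1).prod ((𝓡∂ 1).prod (𝓡∂ 1))) 𝓘(ℝ, E) ∞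
    (fun x : unitInterval × unitInterval × unitInterval =>
      rightLog I (fun u => F (u, x.2.1, x.2.2)) x.1) :=
  contMDiff_rightLog (Φ := fun (x : unitInterval × unitInterval × unitInterval) u =>
    F (u, x.2.1, x.2.2))
    (hF.comp (contMDiff_snd.prodMk (contMDiff_snd.comp contMDiff_fst))) contMDiff_fst

theorem contMDiff_rightLog_cube_trd : ContMDiff ((𝓡∂ 1).prod ((𝓡∂ 1).prod (𝓡∂ 1))) 𝓘(ℝ, E) ∞
    (fun x : unitInterval × unitInterval × unitInterval =>
      rightLog I (fun r => F (x.1, x.2.1, r)) x.2.2) :=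
  contMDiff_rightLog (Φ := fun (x : unitInterval × unitInterval × unitInterval) r =>
    F (x.1, x.2.1, r)) (hF.comp ((contMDiff_fst.comp contMDiff_fst).prodMk
      ((contMDiff_fst.comp (contMDiff_snd.comp contMDiff_fst)).prodMk contMDiff_snd)))
    (contMDiff_snd.comp contMDiff_snd)

end LogDerivatives

/-! ### The Polyakov-Wiegmann formula -/

section PolyakovWiegmann

variable {E : Type*} [NormedAddCommGroup E] [NormedSpace ℝ E]
  {H : Type*} [TopologicalSpace H] {I : ModelWithCorners ℝ E H}
  {G : Type*} [TopologicalSpace G] [ChartedSpace H G] [Group G]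

/-- The integrand of `∫_F ω`, up to the factor `i/2π`. -/
noncomputable def discDensity (B : InvariantForm I G)
    (F : unitInterval × unitInterval × unitInterval → G)
    (x : unitInterval × unitInterval × unitInterval) : ℝ :=
  B.form (leftLog I (fun u => F (u, x.2.1, x.2.2)) x.1)
    (vel 𝓘(ℝ, E) (fun r => leftLog I (fun s => F (x.1, s, r)) x.2.1) x.2.2)

/-- The integral defining the group cocycle, for arbitrary maps `f₁, f₂ : [0,1]² → G`. -/
noncomputable def squareCocycle (B : InvariantForm I G)
    (f₁ f₂ : unitInterval × unitInterval → G) : ℝ :=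
  -(1 / (2 * Real.pi)) * ∫ x : unitInterval × unitInterval,
    B.form (leftLog I (fun s => f₁ (s, x.2)) x.1) (rightLog I (fun r => f₂ (x.1, r)) x.2)

variable [LieGroup I ∞ G]

theorem continuous_discDensity (B : InvariantForm I G)
    {F : unitInterval × unitInterval × unitInterval → G}
    (hF : ContMDiff ((𝓡∂ 1).prod ((𝓡∂ 1).prod (𝓡∂ 1))) I ∞ F) :
    Continuous (discDensity B F) := by
  have h := contMDiff_vel (Ψ := fun (x : unitInterval × unitInterval × unitInterval) r =>
    leftLog I (fun s => F (x.1, s, r)) x.2.1) (τ := fun x => x.2.2)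
    ((contMDiff_leftLog_cube_snd hF).comp ((contMDiff_fst.comp contMDiff_fst).prodMk
      ((contMDiff_fst.comp (contMDiff_snd.comp contMDiff_fst)).prodMk contMDiff_snd)))
    (contMDiff_snd.comp contMDiff_snd)
  exact (B.form.continuous.comp (contMDiff_leftLog_cube_fst hF).continuous).clm_apply h.continuous

variable [FiniteDimensional ℝ E] [I.Boundaryless]
  {F₁ F₂ : unitInterval × unitInterval × unitInterval → G}

/-- The Polyakov-Wiegmann formula: the integrand of `∫_F ω` is multiplicative up to total
derivatives. -/
theorem discDensity_mul (B : InvariantForm I G)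
    (hF₁ : ContMDiff ((𝓡∂ 1).prod ((𝓡∂ 1).prod (𝓡∂ 1))) I ∞ F₁)
    (hF₂ : ContMDiff ((𝓡∂ 1).prod ((𝓡∂ 1).prod (𝓡∂ 1))) I ∞ F₂) (u s r : unitInterval) :
    discDensity B (fun x => F₁ x * F₂ x) (u, s, r) =
      discDensity B F₁ (u, s, r) + discDensity B F₂ (u, s, r) -
      vel 𝓘(ℝ, ℝ) (fun u => B.form (leftLog I (fun s => F₁ (u, s, r)) s)
        (rightLog I (fun r => F₂ (u, s, r)) r)) u +
      vel 𝓘(ℝ, ℝ) (fun s => B.form (leftLog I (fun u => F₁ (u, s, r)) u)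
        (rightLog I (fun r => F₂ (u, s, r)) r)) s +
      vel 𝓘(ℝ, ℝ) (fun r => B.form (rightLog I (fun u => F₂ (u, s, r)) u)
        (leftLog I (fun s => F₁ (u, s, r)) s)) r := by
  have sU : ∀ {F : unitInterval × unitInterval × unitInterval → G} (_ : ContMDiff ((𝓡∂ 1).prod
      ((𝓡∂ 1).prod (𝓡∂ 1))) I ∞ F) (s r : unitInterval),
      ContMDiff (𝓡∂ 1) I ∞ (fun u => F (u, s, r)) := fun hF s r =>
    hF.comp (contMDiff_id.prodMk contMDiff_const)
  have sS : ∀ {F : unitInterval × unitInterval × unitInterval → G} (_ : ContMDiff ((𝓡∂ 1).prod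
      ((𝓡∂ 1).prod (𝓡∂ 1))) I ∞ F) (u r : unitInterval),
      ContMDiff (𝓡∂ 1) I ∞ (fun s => F (u, s, r)) := fun hF u r =>
    hF.comp (contMDiff_const.prodMk (contMDiff_id.prodMk contMDiff_const))
  have sR : ∀ {F : unitInterval × unitInterval × unitInterval → G} (_ : ContMDiff ((𝓡∂ 1).prod
      ((𝓡∂ 1).prod (𝓡∂ 1))) I ∞ F) (u s : unitInterval),
      ContMDiff (𝓡∂ 1) I ∞ (fun r => F (u, s, r)) := fun hF u s =>
    hF.comp (contMDiff_const.prodMk (contMDiff_const.prodMk contMDiff_id))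
  have sUS : ∀ {F : unitInterval × unitInterval × unitInterval → G} (_ : ContMDiff ((𝓡∂ 1).prod
      ((𝓡∂ 1).prod (𝓡∂ 1))) I ∞ F) (r : unitInterval), ContMDiff ((𝓡∂ 1).prod (𝓡∂ 1)) I ∞
      (Function.uncurry fun u s => F (u, s, r)) := fun hF r =>
    hF.comp (contMDiff_fst.prodMk (contMDiff_snd.prodMk contMDiff_const))
  have sUR : ∀ {F : unitInterval × unitInterval × unitInterval → G} (_ : ContMDiff ((𝓡∂ 1).prod
      ((𝓡∂ 1).prod (𝓡∂ 1))) I ∞ F) (s : unitInterval), ContMDiff ((𝓡∂ 1).prod (𝓡∂ 1)) I ∞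
      (Function.uncurry fun u r => F (u, s, r)) := fun hF s =>
    hF.comp (contMDiff_fst.prodMk (contMDiff_const.prodMk contMDiff_snd))
  have sSR : ∀ {F : unitInterval × unitInterval × unitInterval → G} (_ : ContMDiff ((𝓡∂ 1).prod
      ((𝓡∂ 1).prod (𝓡∂ 1))) I ∞ F) (u : unitInterval), ContMDiff ((𝓡∂ 1).prod (𝓡∂ 1)) I ∞
      (Function.uncurry fun s r => F (u, s, r)) := fun hF u =>
    hF.comp (contMDiff_const.prodMk (contMDiff_fst.prodMk contMDiff_snd))
  -- smoothness of the logarithmic derivatives in each variable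
  have α₁S := contMDiff_leftLog (Φ := fun s u => F₁ (u, s, r)) (τ := fun _ => u)
    ((sUS hF₁ r).comp (contMDiff_snd.prodMk contMDiff_fst)) contMDiff_const
  have β₁U := contMDiff_leftLog (Φ := fun u s => F₁ (u, s, r)) (τ := fun _ => s) (sUS hF₁ r)
    contMDiff_const
  have β₁R := contMDiff_leftLog_fst (sSR hF₁ u) s
  have β₂R := contMDiff_leftLog_fst (sSR hF₂ u) s
  have α₂R := contMDiff_leftLog_fst (sUR hF₂ s) u
  have ρ₂U := contMDiff_rightLog_snd (sUR hF₂ s) r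
  have ρ₂S := contMDiff_rightLog_snd (sSR hF₂ u) r
  -- the mixed second derivatives, and the `r`-derivative of `(∂ᵤF₂) F₂⁻¹ = Ad F₂ (F₂⁻¹ ∂ᵤF₂)`
  have hMC := vel_leftLog_eq_vel_leftLog_add
    (f := fun s u => F₁ (u, s, r)) ((sUS hF₁ r).comp (contMDiff_snd.prodMk contMDiff_fst)) s u
  have hT := congrArg (Ad I (F₂ (u, s, r))) (vel_leftLog_eq_Ad_vel_rightLog (sSR hF₂ u) s r)
  have hU := congrArg (Ad I (F₂ (u, s, r))) (vel_leftLog_eq_Ad_vel_rightLog (sUR hF₂ s) u r)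
  rw [Ad_inv_cancel] at hT hU
  have dσ := hasVelAt_Ad_apply (sR hF₂ u s) α₂R r
  simp only [← rightLog_eq_Ad_leftLog (sU hF₂ _ _)] at dσ
  rw [map_add, Ad_bracket, ← rightLog_eq_Ad_leftLog (sR hF₂ u s),
    ← rightLog_eq_Ad_leftLog (sU hF₂ s r), hU] at dσ
  have eu := (HasVelAt.bilin B.form (hasVelAt_of_contMDiff β₁U u)
    (hasVelAt_of_contMDiff ρ₂U u)).vel_eq
  have es := (HasVelAt.bilin B.form (hasVelAt_of_contMDiff α₁S s)
    (hasVelAt_of_contMDiff ρ₂S s)).vel_eq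
  have er := (HasVelAt.bilin B.form dσ (hasVelAt_of_contMDiff β₁R r)).vel_eq
  rw [eu, es, er]
  -- the logarithmic derivatives of the product; `Ad F₂` is then applied to both entries of the form
  have hα := leftLog_mul (sU hF₁ s r) (sU hF₂ s r) u
  have dβ := ((hasVelAt_Ad_apply (sR hF₂ u s).inv β₁R r).add (hasVelAt_of_contMDiff β₂R r)).vel_eq
  simp only [← leftLog_mul (sS hF₁ _ _) (sS hF₂ _ _), leftLog_inv (sR hF₂ u s)] at dβ
  have e1 : ∀ X Y : E, Ad I (F₂ (u, s, r)) (Ad I (F₂ (u, s, r))⁻¹ X + Y) =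
      X + Ad I (F₂ (u, s, r)) Y := fun X Y => by rw [map_add, Ad_inv_cancel]
  have e2 : discDensity B F₂ (u, s, r) = B.form (rightLog I (fun u => F₂ (u, s, r)) u)
      (vel 𝓘(ℝ, E) (fun s => rightLog I (fun r => F₂ (u, s, r)) r) s) := by
    rw [← hT, rightLog_eq_Ad_leftLog (sU hF₂ s r), B.ad_invariant, discDensity]
  rw [e2]
  simp only [discDensity]
  rw [hα, dβ, ← B.ad_invariant (F₂ (u, s, r)), e1, e1, hT,
    ← rightLog_eq_Ad_leftLog (sU hF₂ s r), hMC]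
  simp only [map_add, add_apply, bracket_neg_left, map_neg, B.form_bracket]
  rw [B.symm (leftLog I (fun s => F₁ (u, s, r)) s), ← bracket_skew
    (rightLog I (fun r => F₂ (u, s, r)) r) (leftLog I (fun s => F₁ (u, s, r)) s), map_neg, map_neg]
  ring

/-- The integral of the Polyakov-Wiegmann formula over the cube. The total `u`- and `s`-derivatives
integrate to values of the cocycle on opposite faces; the total `r`-derivative does not contribute,
since `F₂` is independent of `u` on the faces `r = 0` and `r = 1`. -/
theorem integral_discDensity_mul (B : InvariantForm I G)
    (hF₁ : ContMDiff ((𝓡∂ 1).prod ((𝓡∂ 1).prod (𝓡∂ 1))) I ∞ F₁)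
    (hF₂ : ContMDiff ((𝓡∂ 1).prod ((𝓡∂ 1).prod (𝓡∂ 1))) I ∞ F₂)
    (h0 : ∀ u s, F₂ (u, s, 0) = F₂ (0, s, 0)) (h1 : ∀ u s, F₂ (u, s, 1) = F₂ (0, s, 1)) :
    1 / (2 * Real.pi) * ∫ x, discDensity B (fun x => F₁ x * F₂ x) x =
      1 / (2 * Real.pi) * (∫ x, discDensity B F₁ x) +
      1 / (2 * Real.pi) * (∫ x, discDensity B F₂ x) +
      (squareCocycle B (fun y => F₁ (1, y)) (fun y => F₂ (1, y)) -
        squareCocycle B (fun y => F₁ (0, y)) (fun y => F₂ (0, y))) -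
      (squareCocycle B (fun y => F₁ (y.1, 1, y.2)) (fun y => F₂ (y.1, 1, y.2)) -
        squareCocycle B (fun y => F₁ (y.1, 0, y.2)) (fun y => F₂ (y.1, 0, y.2))) := by
  have sU : ContMDiff ((𝓡∂ 1).prod ((𝓡∂ 1).prod (𝓡∂ 1))) 𝓘(ℝ, ℝ) ∞
      (fun x : unitInterval × unitInterval × unitInterval =>
        B.form (leftLog I (fun s => F₁ (x.1, s, x.2.2)) x.2.1)
          (rightLog I (fun r => F₂ (x.1, x.2.1, r)) x.2.2)) :=
    (B.form.contMDiff.comp (contMDiff_leftLog_cube_snd hF₁)).clm_apply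
      (contMDiff_rightLog_cube_trd hF₂)
  have sS : ContMDiff ((𝓡∂ 1).prod ((𝓡∂ 1).prod (𝓡∂ 1))) 𝓘(ℝ, ℝ) ∞
      (fun x : unitInterval × unitInterval × unitInterval =>
        B.form (leftLog I (fun u => F₁ (u, x.2.1, x.2.2)) x.1)
          (rightLog I (fun r => F₂ (x.1, x.2.1, r)) x.2.2)) :=
    (B.form.contMDiff.comp (contMDiff_leftLog_cube_fst hF₁)).clm_apply
      (contMDiff_rightLog_cube_trd hF₂)
  have sR : ContMDiff ((𝓡∂ 1).prod ((𝓡∂ 1).prod (𝓡∂ 1))) 𝓘(ℝ, ℝ) ∞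
      (fun x : unitInterval × unitInterval × unitInterval =>
        B.form (rightLog I (fun u => F₂ (u, x.2.1, x.2.2)) x.1)
          (leftLog I (fun s => F₁ (x.1, s, x.2.2)) x.2.1)) :=
    (B.form.contMDiff.comp (contMDiff_rightLog_cube_fst hF₂)).clm_apply
      (contMDiff_leftLog_cube_snd hF₁)
  have iU := integrable_of_continuous (μ := volume) (contMDiff_vel_cube_fst sU).continuous
  have iS := integrable_of_continuous (μ := volume) (contMDiff_vel_cube_snd sS).continuous
  have iR := integrable_of_continuous (μ := volume) (contMDiff_vel_cube_trd sR).continuous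
  have i1 := integrable_of_continuous (μ := volume) (continuous_discDensity B hF₁)
  have i2 := integrable_of_continuous (μ := volume) (continuous_discDensity B hF₂)
  have hd : ∀ x, discDensity B (fun x => F₁ x * F₂ x) x = _ := fun x =>
    discDensity_mul B hF₁ hF₂ x.1 x.2.1 x.2.2
  have key := (integral_congr_ae (μ := volume) (Eventually.of_forall hd)).trans
    ((integral_add (((i1.add i2).sub iU).add iS) iR).trans (congrArg₂ (· + ·)
      ((integral_add ((i1.add i2).sub iU) iS).trans (congrArg₂ (· + ·)
        ((integral_sub (i1.add i2) iU).trans (congrArg₂ (· - ·) (integral_add i1 i2) rfl))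
          rfl)) rfl))
  have eU := integral_vel_cube_fst sU
  have eS := integral_vel_cube_snd sS
  have eR := integral_vel_cube_trd sR
  simp only [h0, h1, rightLog_const, map_zero, zero_apply, sub_self, integral_zero] at eR
  simp only at key eU eS
  rw [key, eU, eS, eR]
  simp only [squareCocycle]
  ring

end PolyakovWiegmann

/-! ### The group cocycle -/

section SquareCocycle

variable {E : Type*} [NormedAddCommGroup E] [NormedSpace ℝ E]
  {H : Type*} [TopologicalSpace H] {I : ModelWithCorners ℝ E H}
  {G : Type*} [TopologicalSpace G] [ChartedSpace H G] [Group G]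

theorem leftLog_const_mul (g : G) (p : unitInterval → G) (t : unitInterval) :
    leftLog I (fun t => g * p t) t = leftLog I p t := by
  simp only [leftLog, mul_inv_rev, mul_assoc, inv_mul_cancel_left]

/-- The cocycle only depends on `f₁` through `f₁⁻¹ ∂ₛf₁`, so a left factor independent of `s` drops
out. -/
theorem squareCocycle_const_mul (B : InvariantForm I G) (g : unitInterval → G)
    (f₁ f₂ : unitInterval × unitInterval → G) :
    squareCocycle B (fun y => g y.2 * f₁ y) f₂ = squareCocycle B f₁ f₂ := by
  have h : ∀ x : unitInterval × unitInterval, leftLog I (fun s => g x.2 * f₁ (s, x.2)) x.1 =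
      leftLog I (fun s => f₁ (s, x.2)) x.1 := fun x =>
    leftLog_const_mul (g x.2) (fun s => f₁ (s, x.2)) x.1
  simp only [squareCocycle, h]

theorem integrable_form_apply (B : InvariantForm I G) {V W : unitInterval × unitInterval → E}
    (hV : ContMDiff ((𝓡∂ 1).prod (𝓡∂ 1)) 𝓘(ℝ, E) ∞ V)
    (hW : ContMDiff ((𝓡∂ 1).prod (𝓡∂ 1)) 𝓘(ℝ, E) ∞ W) :
    Integrable fun x => B.form (V x) (W x) :=
  integrable_of_continuous ((B.form.continuous.comp hV.continuous).clm_apply hW.continuous)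

variable [LieGroup I ∞ G]

theorem squareCocycle_eq_zero_of_left (B : InvariantForm I G)
    {f₁ f₂ : unitInterval × unitInterval → G} (h : ∀ s r, f₁ (s, r) = f₁ (0, r)) :
    squareCocycle B f₁ f₂ = 0 := by
  have h' : ∀ x : unitInterval × unitInterval, leftLog I (fun s => f₁ (s, x.2)) x.1 = 0 := by
    intro x
    simp only [fun s => h s x.2, leftLog_const]
  simp only [squareCocycle, h', map_zero, zero_apply, integral_zero, mul_zero]

theorem squareCocycle_eq_zero_of_right (B : InvariantForm I G)
    {f₁ f₂ : unitInterval × unitInterval → G} (h : ∀ s r, f₂ (s, r) = f₂ (s, 0)) :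
    squareCocycle B f₁ f₂ = 0 := by
  have h' : ∀ x : unitInterval × unitInterval, rightLog I (fun r => f₂ (x.1, r)) x.2 = 0 := by
    intro x
    simp only [fun r => h x.1 r, rightLog_const]
  simp only [squareCocycle, h', map_zero, integral_zero, mul_zero]

/-- The phase of the action of `g ∈ P₀G` is a value of the cocycle. -/
theorem squareCocycle_inv (B : InvariantForm I G) {g : unitInterval → G}
    (hg : ContMDiff (𝓡∂ 1) I ∞ g) (f : unitInterval × unitInterval → G) :
    squareCocycle B f (fun y => (g y.2)⁻¹) = 1 / (2 * Real.pi) * ∫ y : unitInterval × unitInterval,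
      B.form (leftLog I (fun s => f (s, y.2)) y.1) (leftLog I g y.2) := by
  simp only [squareCocycle, rightLog_inv hg, map_neg, integral_neg]
  ring

variable {f₁ f₂ f₃ : unitInterval × unitInterval → G}

theorem contMDiff_leftLog_square (hf : ContMDiff ((𝓡∂ 1).prod (𝓡∂ 1)) I ∞ f₁) :
    ContMDiff ((𝓡∂ 1).prod (𝓡∂ 1)) 𝓘(ℝ, E) ∞
      (fun x : unitInterval × unitInterval => leftLog I (fun s => f₁ (s, x.2)) x.1) :=
  contMDiff_leftLog (Φ := fun (x : unitInterval × unitInterval) s => f₁ (s, x.2))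
    (hf.comp (contMDiff_snd.prodMk (contMDiff_snd.comp contMDiff_fst))) contMDiff_fst

theorem contMDiff_rightLog_square (hf : ContMDiff ((𝓡∂ 1).prod (𝓡∂ 1)) I ∞ f₁) :
    ContMDiff ((𝓡∂ 1).prod (𝓡∂ 1)) 𝓘(ℝ, E) ∞
      (fun x : unitInterval × unitInterval => rightLog I (fun r => f₁ (x.1, r)) x.2) :=
  contMDiff_rightLog (Φ := fun (x : unitInterval × unitInterval) r => f₁ (x.1, r))
    (hf.comp ((contMDiff_fst.comp contMDiff_fst).prodMk contMDiff_snd)) contMDiff_snd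

/-- The cocycle identity for arbitrary maps `[0,1]² → G`. -/
theorem squareCocycle_cocycle (B : InvariantForm I G)
    (h₁ : ContMDiff ((𝓡∂ 1).prod (𝓡∂ 1)) I ∞ f₁) (h₂ : ContMDiff ((𝓡∂ 1).prod (𝓡∂ 1)) I ∞ f₂)
    (h₃ : ContMDiff ((𝓡∂ 1).prod (𝓡∂ 1)) I ∞ f₃) :
    squareCocycle B f₁ f₂ + squareCocycle B (fun y => f₁ y * f₂ y) f₃ =
      squareCocycle B f₁ (fun y => f₂ y * f₃ y) + squareCocycle B f₂ f₃ := by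
  have smS {f : unitInterval × unitInterval → G} (hf : ContMDiff ((𝓡∂ 1).prod (𝓡∂ 1)) I ∞ f)
      (r : unitInterval) : ContMDiff (𝓡∂ 1) I ∞ (fun s => f (s, r)) :=
    hf.comp (contMDiff_id.prodMk contMDiff_const)
  have smR {f : unitInterval × unitInterval → G} (hf : ContMDiff ((𝓡∂ 1).prod (𝓡∂ 1)) I ∞ f)
      (s : unitInterval) : ContMDiff (𝓡∂ 1) I ∞ (fun r => f (s, r)) :=
    hf.comp (contMDiff_const.prodMk contMDiff_id)
  have : IsManifold I 1 G := isManifold_one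
  have i12 := integrable_form_apply B (contMDiff_leftLog_square h₁) (contMDiff_rightLog_square h₂)
  have i23 := integrable_form_apply B (contMDiff_leftLog_square h₂) (contMDiff_rightLog_square h₃)
  have i13 := integrable_form_apply B (contMDiff_leftLog_square h₁)
    (contMDiff_Ad_apply h₂ (contMDiff_rightLog_square h₃))
  have e1 : ∀ x : unitInterval × unitInterval,
      B.form (leftLog I (fun s => f₁ (s, x.2) * f₂ (s, x.2)) x.1)
        (rightLog I (fun r => f₃ (x.1, r)) x.2) =
      B.form (leftLog I (fun s => f₁ (s, x.2)) x.1)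
        (Ad I (f₂ x) (rightLog I (fun r => f₃ (x.1, r)) x.2)) +
      B.form (leftLog I (fun s => f₂ (s, x.2)) x.1) (rightLog I (fun r => f₃ (x.1, r)) x.2) := by
    intro x
    rw [leftLog_mul (smS h₁ x.2) (smS h₂ x.2), map_add, add_apply, ← B.ad_invariant (f₂ x),
      Ad_inv_cancel]
  have e2 : ∀ x : unitInterval × unitInterval,
      B.form (leftLog I (fun s => f₁ (s, x.2)) x.1)
        (rightLog I (fun r => f₂ (x.1, r) * f₃ (x.1, r)) x.2) =
      B.form (leftLog I (fun s => f₁ (s, x.2)) x.1) (rightLog I (fun r => f₂ (x.1, r)) x.2) +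
      B.form (leftLog I (fun s => f₁ (s, x.2)) x.1)
        (Ad I (f₂ x) (rightLog I (fun r => f₃ (x.1, r)) x.2)) := by
    intro x
    rw [rightLog_mul (smR h₂ x.1) (smR h₃ x.1), map_add]
  simp only [squareCocycle, e1, e2]
  rw [integral_add i13 i23, integral_add i12 i13]
  ring

end SquareCocycle

/-! ### Integrals of the three-form over homotopies -/

section DiscIntegrals

variable {E : Type*} [NormedAddCommGroup E] [NormedSpace ℝ E]
  {H : Type*} [TopologicalSpace H] {I : ModelWithCorners ℝ E H}
  {G : Type*} [TopologicalSpace G] [ChartedSpace H G] [Group G]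

/-- `(1/i) ∫_F ω` for an arbitrary map `F : [0,1]³ → G`. -/
noncomputable def cubeIntegral (B : InvariantForm I G)
    (F : unitInterval × unitInterval × unitInterval → G) : ℝ :=
  1 / (2 * Real.pi) * ∫ x, discDensity B F x

variable [LieGroup I ∞ G]

/-- The three-form pulls back to zero along a map which does not depend on `u`. -/
theorem cubeIntegral_eq_zero (B : InvariantForm I G)
    {F : unitInterval × unitInterval × unitInterval → G} (h : ∀ u y, F (u, y) = F (0, y)) :
    cubeIntegral B F = 0 := by
  have h' : ∀ x, discDensity B F x = 0 := by
    intro x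
    simp only [discDensity, fun u => h u (x.2.1, x.2.2), leftLog_const, map_zero, zero_apply]
  simp only [cubeIntegral, h', integral_zero, mul_zero]

variable [FiniteDimensional ℝ E] [I.Boundaryless]
  {F₁ F₂ : unitInterval × unitInterval × unitInterval → G}

/-- `∫_F ω` is multiplicative up to the values of the cocycle on the faces `u = 0, 1` and
`s = 0, 1`. -/
theorem cubeIntegral_mul (B : InvariantForm I G)
    (hF₁ : ContMDiff ((𝓡∂ 1).prod ((𝓡∂ 1).prod (𝓡∂ 1))) I ∞ F₁)
    (hF₂ : ContMDiff ((𝓡∂ 1).prod ((𝓡∂ 1).prod (𝓡∂ 1))) I ∞ F₂)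
    (h0 : ∀ u s, F₂ (u, s, 0) = F₂ (0, s, 0)) (h1 : ∀ u s, F₂ (u, s, 1) = F₂ (0, s, 1)) :
    cubeIntegral B (fun x => F₁ x * F₂ x) = cubeIntegral B F₁ + cubeIntegral B F₂ +
      (squareCocycle B (fun y => F₁ (1, y)) (fun y => F₂ (1, y)) -
        squareCocycle B (fun y => F₁ (0, y)) (fun y => F₂ (0, y))) -
      (squareCocycle B (fun y => F₁ (y.1, 1, y.2)) (fun y => F₂ (y.1, 1, y.2)) -
        squareCocycle B (fun y => F₁ (y.1, 0, y.2)) (fun y => F₂ (y.1, 0, y.2))) :=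
  integral_discDensity_mul B hF₁ hF₂ h0 h1

/-- `∫_F ω` is multiplicative up to the cocycle for homotopies of paths in the loop group. -/
theorem cubeIntegral_mul_of_fixed (B : InvariantForm I G)
    (hF₁ : ContMDiff ((𝓡∂ 1).prod ((𝓡∂ 1).prod (𝓡∂ 1))) I ∞ F₁)
    (hF₂ : ContMDiff ((𝓡∂ 1).prod ((𝓡∂ 1).prod (𝓡∂ 1))) I ∞ F₂)
    (h0 : ∀ u s, F₂ (u, s, 0) = F₂ (0, s, 0)) (h1 : ∀ u s, F₂ (u, s, 1) = F₂ (0, s, 1))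
    (k0 : ∀ u r, F₁ (u, 0, r) = F₁ (0, 0, r)) (k1 : ∀ u r, F₁ (u, 1, r) = F₁ (0, 1, r)) :
    cubeIntegral B (fun x => F₁ x * F₂ x) = cubeIntegral B F₁ + cubeIntegral B F₂ +
      squareCocycle B (fun y => F₁ (1, y)) (fun y => F₂ (1, y)) -
        squareCocycle B (fun y => F₁ (0, y)) (fun y => F₂ (0, y)) := by
  rw [cubeIntegral_mul B hF₁ hF₂ h0 h1,
    squareCocycle_eq_zero_of_left B (f₁ := fun y => F₁ (y.1, 1, y.2)) (fun s r => k1 s r),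
    squareCocycle_eq_zero_of_left B (f₁ := fun y => F₁ (y.1, 0, y.2)) (fun s r => k0 s r)]
  ring

end DiscIntegrals

/-! ### The normal subgroup of disc holonomies -/

section Holonomy

variable {E : Type*} [NormedAddCommGroup E] [NormedSpace ℝ E]
  {H : Type*} [TopologicalSpace H] {I : ModelWithCorners ℝ E H}
  {G : Type*} [TopologicalSpace G] [ChartedSpace H G] [Group G] [LieGroup I ∞ G]

theorem ExtPath.mul_path {B : InvariantForm I G} (x y : ExtPath B) :
    (x * y).path = x.path * y.path := rfl

theorem ExtPath.mul_phase {B : InvariantForm I G} (x y : ExtPath B) :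
    (x * y).phase = x.phase * y.phase * Circle.exp (squareCocycle B x.path.1 y.path.1) := rfl

theorem ExtPath.inv_phase {B : InvariantForm I G} (x : ExtPath B) :
    x⁻¹.phase = (x.phase *
      Circle.exp (squareCocycle B x.path.1 (fun y => (x.path.1 y)⁻¹)))⁻¹ := rfl

/-- A map `F : [0,1]³ → G` is a disc in the loop group: a smooth homotopy `u ↦ F(u, ·, ·)`, starting
at the constant path, of paths in the loop group with both end points at `1`. Unlike `IsDisc` this
is a property of plain functions, which can be multiplied and composed without bundling. -/
structure IsDiscMap (I : ModelWithCorners ℝ E H)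
    (F : unitInterval × unitInterval × unitInterval → G) : Prop where
  smooth : ContMDiff ((𝓡∂ 1).prod ((𝓡∂ 1).prod (𝓡∂ 1))) I ∞ F
  bot : ∀ y, F (0, y) = 1
  side_zero : ∀ u r, F (u, 0, r) = 1
  side_one : ∀ u r, F (u, 1, r) = 1
  loop_zero : ∀ u s, F (u, s, 0) = 1
  loop_one : ∀ u s, F (u, s, 1) = 1

/-- Membership in `N` in terms of unbundled discs and the real-valued integral. -/
theorem mem_holonomySet_iff {B : InvariantForm I G} {x : ExtPath B} :
    x ∈ holonomySet B ↔ ∃ F, IsDiscMap I F ∧ (fun y => F (1, y)) = x.path.1 ∧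
      x.phase = Circle.exp (cubeIntegral B F) := by
  constructor
  · rintro ⟨F, ⟨hu, hs, hr⟩, hx, hp⟩
    exact ⟨F, ⟨F.contMDiff, fun y => hu y.1 y.2, fun u r => (hs u r).1, fun u r => (hs u r).2,
      fun u s => (hr u s).1, fun u s => (hr u s).2⟩, funext fun y => hx y.1 y.2, hp⟩
  · rintro ⟨F, h, hx, hp⟩
    exact ⟨⟨F, h.smooth⟩, ⟨fun s r => h.bot (s, r), fun u r => ⟨h.side_zero u r, h.side_one u r⟩,
      fun u s => ⟨h.loop_zero u s, h.loop_one u s⟩⟩, fun s r => congrFun hx (s, r), hp⟩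

theorem IsDiscMap.mul {F₁ F₂ : unitInterval × unitInterval × unitInterval → G}
    (h₁ : IsDiscMap I F₁) (h₂ : IsDiscMap I F₂) : IsDiscMap I (fun x => F₁ x * F₂ x) where
  smooth := h₁.smooth.mul h₂.smooth
  bot := by simp [h₁.bot, h₂.bot]
  side_zero := by simp [h₁.side_zero, h₂.side_zero]
  side_one := by simp [h₁.side_one, h₂.side_one]
  loop_zero := by simp [h₁.loop_zero, h₂.loop_zero]
  loop_one := by simp [h₁.loop_one, h₂.loop_one]

theorem IsDiscMap.inv {F : unitInterval × unitInterval × unitInterval → G}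
    (h : IsDiscMap I F) : IsDiscMap I (fun x => (F x)⁻¹) where
  smooth := h.smooth.inv
  bot := by simp [h.bot]
  side_zero := by simp [h.side_zero]
  side_one := by simp [h.side_one]
  loop_zero := by simp [h.loop_zero]
  loop_one := by simp [h.loop_one]

variable [FiniteDimensional ℝ E] [I.Boundaryless]

theorem IsDiscMap.cubeIntegral_mul {B : InvariantForm I G}
    {F₁ F₂ : unitInterval × unitInterval × unitInterval → G} (h₁ : IsDiscMap I F₁)
    (h₂ : IsDiscMap I F₂) :
    cubeIntegral B (fun x => F₁ x * F₂ x) = cubeIntegral B F₁ + cubeIntegral B F₂ +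
      squareCocycle B (fun y => F₁ (1, y)) (fun y => F₂ (1, y)) := by
  rw [cubeIntegral_mul_of_fixed B h₁.smooth h₂.smooth (by simp [h₂.loop_zero])
    (by simp [h₂.loop_one]) (by simp [h₁.side_zero]) (by simp [h₁.side_one]),
    squareCocycle_eq_zero_of_left B (f₁ := fun y => F₁ (0, y)) (by simp [h₁.bot]), sub_zero]

/-- Apply multiplicativity to `F F⁻¹ = 1`. -/
theorem IsDiscMap.cubeIntegral_inv {B : InvariantForm I G}
    {F : unitInterval × unitInterval × unitInterval → G} (h : IsDiscMap I F) :
    cubeIntegral B (fun x => (F x)⁻¹) = -(cubeIntegral B F +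
      squareCocycle B (fun y => F (1, y)) (fun y => (F (1, y))⁻¹)) := by
  have h1 := h.cubeIntegral_mul (B := B) h.inv
  rw [cubeIntegral_eq_zero B (F := fun x => F x * (F x)⁻¹) (by simp)] at h1
  linarith

/-- A homotopy `F` relative to the end points between two paths in the loop group identifies
`(F(0), z)` with `(F(1), z exp ∫_F ω)`. -/
theorem div_mem_holonomySet {B : InvariantForm I G} {x y : ExtPath B}
    {F : unitInterval × unitInterval × unitInterval → G}
    (hF : ContMDiff ((𝓡∂ 1).prod ((𝓡∂ 1).prod (𝓡∂ 1))) I ∞ F)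
    (h0 : (fun y => F (0, y)) = x.path.1) (h1 : (fun z => F (1, z)) = y.path.1)
    (k0 : ∀ u r, F (u, 0, r) = 1) (k1 : ∀ u r, F (u, 1, r) = F (0, 1, r))
    (l0 : ∀ u s, F (u, s, 0) = 1) (l1 : ∀ u s, F (u, s, 1) = 1)
    (hp : y.phase = x.phase * Circle.exp (cubeIntegral B F)) :
    y / x ∈ holonomySet B := by
  have e0 : ∀ z, F (0, z) = x.path.1 z := congrFun h0
  have hx : ContMDiff ((𝓡∂ 1).prod ((𝓡∂ 1).prod (𝓡∂ 1))) I ∞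
      (fun z : unitInterval × unitInterval × unitInterval => (x.path.1 z.2)⁻¹) :=
    (x.path.1.contMDiff.comp contMDiff_snd).inv
  have hx0 : ∀ s, x.path.1 (s, 0) = 1 := fun s => (x.path.2.2 s).1
  have hx1 : ∀ s, x.path.1 (s, 1) = 1 := fun s => (x.path.2.2 s).2
  refine mem_holonomySet_iff.2 ⟨fun z => F z * (x.path.1 z.2)⁻¹, ⟨hF.mul hx, ?_, ?_, ?_, ?_, ?_⟩,
    ?_, ?_⟩
  · simp [e0]
  · intro u r; simp only [k0, ← e0, inv_one, mul_one]
  · intro u r; simp only [k1, ← e0, mul_inv_cancel]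
  · simp [l0, hx0]
  · simp [l1, hx1]
  · ext z
    rw [div_eq_mul_inv]
    change _ = y.path.1 z * (x.path.1 z)⁻¹
    rw [← congrFun h1 z]
  · rw [cubeIntegral_mul_of_fixed B hF hx (fun _ _ => rfl) (fun _ _ => rfl) (by simp [k0]) k1,
      cubeIntegral_eq_zero B (F := fun z => (x.path.1 z.2)⁻¹) (fun _ _ => rfl), div_eq_mul_inv,
      ExtPath.mul_phase, ExtPath.inv_phase, hp, h0, h1]
    change _ * Circle.exp (squareCocycle B y.path.1 fun z => (x.path.1 z)⁻¹) = _
    simp only [Circle.exp_add, Circle.exp_sub, Circle.exp_zero, mul_one]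
    refine Circle.ext ?_
    simp only [Circle.coe_mul, Circle.coe_inv, Circle.coe_div]
    field_simp

variable (B : InvariantForm I G)

/-- The set `N` is a subgroup: multiplicativity of `∫_F ω` up to the cocycle is the multiplication
of phases in `P₀L₀G × U(1)`. -/
noncomputable def holonomySubgroup : Subgroup (ExtPath B) where
  carrier := holonomySet B
  one_mem' := by
    refine mem_holonomySet_iff.2 ⟨fun _ => 1, ⟨contMDiff_const, ?_, ?_, ?_, ?_, ?_⟩, rfl, ?_⟩ <;>
      try exact fun _ _ => rfl
    · exact fun _ => rfl
    · rw [cubeIntegral_eq_zero B fun _ _ => rfl, Circle.exp_zero]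
      rfl
  mul_mem' {x y} hx hy := by
    obtain ⟨F₁, h₁, e₁, p₁⟩ := mem_holonomySet_iff.1 hx
    obtain ⟨F₂, h₂, e₂, p₂⟩ := mem_holonomySet_iff.1 hy
    refine mem_holonomySet_iff.2 ⟨_, h₁.mul h₂, ?_, ?_⟩
    · ext z
      change F₁ (1, z) * F₂ (1, z) = x.path.1 z * y.path.1 z
      rw [← congrFun e₁ z, ← congrFun e₂ z]
    · rw [h₁.cubeIntegral_mul h₂, ExtPath.mul_phase, p₁, p₂, e₁, e₂, Circle.exp_add,
        Circle.exp_add]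
  inv_mem' {x} hx := by
    obtain ⟨F, h, e, p⟩ := mem_holonomySet_iff.1 hx
    refine mem_holonomySet_iff.2 ⟨_, h.inv, ?_, ?_⟩
    · ext z
      change (F (1, z))⁻¹ = (x.path.1 z)⁻¹
      rw [← congrFun e z]
    · have e' : (fun y => (F (1, y))⁻¹) = fun y => (x.path.1 y)⁻¹ :=
        funext fun y => by rw [← congrFun e y]
      rw [h.cubeIntegral_inv, ExtPath.inv_phase, p, e, e', Circle.exp_neg, Circle.exp_add]

/-- If `F` is a disc with boundary `n`, then `x F x⁻¹`, with `x` independent of `u`, is a disc with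
boundary `x n x⁻¹`. -/
theorem holonomySubgroup_normal : (holonomySubgroup B).Normal := by
  refine ⟨fun n hn x => ?_⟩
  obtain ⟨F, h, e, p⟩ := mem_holonomySet_iff.1 hn
  have hx : ContMDiff ((𝓡∂ 1).prod ((𝓡∂ 1).prod (𝓡∂ 1))) I ∞
      (fun z : unitInterval × unitInterval × unitInterval => x.path.1 z.2) :=
    x.path.1.contMDiff.comp contMDiff_snd
  have hx0 : ∀ s, x.path.1 (s, 0) = 1 := fun s => (x.path.2.2 s).1
  have hx1 : ∀ s, x.path.1 (s, 1) = 1 := fun s => (x.path.2.2 s).2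
  have c1 := cubeIntegral_mul_of_fixed B hx h.smooth (by simp [h.loop_zero]) (by simp [h.loop_one])
    (fun _ _ => rfl) (fun _ _ => rfl)
  have c2 := cubeIntegral_mul_of_fixed B (F₁ := fun z => x.path.1 z.2 * F z)
    (F₂ := fun z => (x.path.1 z.2)⁻¹) (hx.mul h.smooth) hx.inv (fun _ _ => rfl) (fun _ _ => rfl)
    (by simp [h.side_zero]) (by simp [h.side_one])
  rw [cubeIntegral_eq_zero B (F := fun z => x.path.1 z.2) (fun _ _ => rfl),
    squareCocycle_eq_zero_of_right B (f₂ := fun y => F (0, y)) (by simp [h.bot])] at c1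
  rw [cubeIntegral_eq_zero B (F := fun z => (x.path.1 z.2)⁻¹) (fun _ _ => rfl)] at c2
  refine mem_holonomySet_iff.2 ⟨fun z => x.path.1 z.2 * F z * (x.path.1 z.2)⁻¹,
    ⟨(hx.mul h.smooth).mul hx.inv, ?_, ?_, ?_, ?_, ?_⟩, ?_, ?_⟩
  · simp [h.bot]
  · simp [h.side_zero]
  · simp [h.side_one]
  · simp [h.loop_zero]
  · simp [h.loop_one]
  · ext z
    change x.path.1 z * F (1, z) * (x.path.1 z)⁻¹ = x.path.1 z * n.path.1 z * (x.path.1 z)⁻¹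
    rw [← congrFun e z]
  · have e' : (fun y => x.path.1 y * F (1, y)) = (x * n).path.1 :=
      funext fun y => by rw [congrFun e y]; rfl
    have e0 : (fun y => x.path.1 y * F (0, y)) = x.path.1 :=
      funext fun y => by rw [h.bot, mul_one]
    rw [e] at c1
    rw [e', e0] at c2
    rw [c2, c1, ExtPath.mul_phase, ExtPath.mul_phase, ExtPath.inv_phase, p]
    change _ * Circle.exp (squareCocycle B (x * n).path.1 fun z => (x.path.1 z)⁻¹) = _
    simp only [Circle.exp_add, Circle.exp_sub, Circle.exp_zero, one_mul, mul_one]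
    refine Circle.ext ?_
    simp only [Circle.coe_mul, Circle.coe_inv, Circle.coe_div]
    field_simp
    exact Circle.coe_one

theorem normalClosure_holonomySet :
    Subgroup.normalClosure (holonomySet B) = holonomySubgroup B := by
  have := holonomySubgroup_normal B
  exact Subgroup.normalClosure_eq_self (holonomySubgroup B)

end Holonomy

/-! ### The action of the path group and the crossed module -/

section Action

variable {E : Type*} [NormedAddCommGroup E] [NormedSpace ℝ E]
  {H : Type*} [TopologicalSpace H] {I : ModelWithCorners ℝ E H}
  {G : Type*} [TopologicalSpace G] [ChartedSpace H G] [Group G] [LieGroup I ∞ G]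

theorem actExt_path {B : InvariantForm I G} (g : PathGroup I G) (x : ExtPath B) :
    (actExt B g x).path = conj g x.path := rfl

theorem actExt_phase {B : InvariantForm I G} (g : PathGroup I G) (x : ExtPath B) :
    (actExt B g x).phase =
      x.phase * Circle.exp (squareCocycle B x.path.1 (fun y => (g.1 y.2)⁻¹)) := by
  rw [squareCocycle_inv B g.1.contMDiff]
  rfl

theorem conj_coe (g : PathGroup I G) (f : PathLoopGroup I G) :
    ⇑(conj g f).1 = fun y => g.1 y.2 * f.1 y * (g.1 y.2)⁻¹ := rfl

theorem contMDiff_comp_snd (g : PathGroup I G) :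
    ContMDiff ((𝓡∂ 1).prod (𝓡∂ 1)) I ∞ (fun y : unitInterval × unitInterval => g.1 y.2) :=
  g.1.contMDiff.comp contMDiff_snd

/-- `g ∈ P₀G` acts on `P₀L₀G × U(1)` by endomorphisms. -/
theorem actExt_mul {B : InvariantForm I G} (g : PathGroup I G) (x y : ExtPath B) :
    actExt B g (x * y) = actExt B g x * actExt B g y := by
  refine ExtPath.ext (Subtype.ext (DFunLike.ext _ _ fun z => ?_)) ?_
  · change g.1 z.2 * (x.path.1 z * y.path.1 z) * (g.1 z.2)⁻¹ =
      g.1 z.2 * x.path.1 z * (g.1 z.2)⁻¹ * (g.1 z.2 * y.path.1 z * (g.1 z.2)⁻¹)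
    group
  · have hg := contMDiff_comp_snd g
    have hx := x.path.1.contMDiff
    have hy := y.path.1.contMDiff
    have e1 := squareCocycle_cocycle B hx hg.inv (f₃ := fun z => g.1 z.2 * y.path.1 z * (g.1 z.2)⁻¹)
      ((hg.mul hy).mul hg.inv)
    have e2 := squareCocycle_cocycle B hx hy hg.inv
    have e3 : (fun z => (g.1 z.2)⁻¹ * (g.1 z.2 * y.path.1 z * (g.1 z.2)⁻¹)) =
        fun z => y.path.1 z * (g.1 z.2)⁻¹ := by
      ext z
      group
    have e4 : squareCocycle B (fun y => (g.1 y.2)⁻¹)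
        (fun z => g.1 z.2 * y.path.1 z * (g.1 z.2)⁻¹) = 0 :=
      squareCocycle_eq_zero_of_left B fun _ _ => rfl
    have e5 : squareCocycle B (conj g x.path).1 (conj g y.path).1 =
        squareCocycle B (fun z => x.path.1 z * (g.1 z.2)⁻¹)
          (fun z => g.1 z.2 * y.path.1 z * (g.1 z.2)⁻¹) := by
      rw [← squareCocycle_const_mul B g.1 (fun z => x.path.1 z * (g.1 z.2)⁻¹)]
      simp only [conj_coe, mul_assoc]
    have e6 : ⇑(x.path * y.path).1 = fun z => x.path.1 z * y.path.1 z := rfl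
    rw [e3, e4] at e1
    simp only [actExt_phase, actExt_path, ExtPath.mul_phase, ExtPath.mul_path, e5, e6]
    have e7 : squareCocycle B (fun z => x.path.1 z * y.path.1 z) (fun y => (g.1 y.2)⁻¹) =
        squareCocycle B x.path.1 (fun y => (g.1 y.2)⁻¹) +
        squareCocycle B (fun z => x.path.1 z * (g.1 z.2)⁻¹)
          (fun z => g.1 z.2 * y.path.1 z * (g.1 z.2)⁻¹) +
        squareCocycle B y.path.1 (fun y => (g.1 y.2)⁻¹) - squareCocycle B x.path.1 y.path.1 := by
      linarith
    rw [e7]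
    refine Circle.ext ?_
    simp only [Circle.exp_add, Circle.exp_sub, Circle.coe_mul, Circle.coe_div]
    field_simp

theorem actExt_one {B : InvariantForm I G} (x : ExtPath B) : actExt B 1 x = x := by
  refine ExtPath.ext (Subtype.ext (DFunLike.ext _ _ fun z => ?_)) ?_
  · change 1 * x.path.1 z * 1⁻¹ = _
    group
  · rw [actExt_phase, squareCocycle_eq_zero_of_right B (fun _ _ => rfl), Circle.exp_zero, mul_one]

theorem actExt_comp {B : InvariantForm I G} (g h : PathGroup I G) (x : ExtPath B) :
    actExt B (g * h) x = actExt B g (actExt B h x) := by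
  refine ExtPath.ext (Subtype.ext (DFunLike.ext _ _ fun z => ?_)) ?_
  · change g.1 z.2 * h.1 z.2 * x.path.1 z * (g.1 z.2 * h.1 z.2)⁻¹ =
      g.1 z.2 * (h.1 z.2 * x.path.1 z * (h.1 z.2)⁻¹) * (g.1 z.2)⁻¹
    group
  · have hg := contMDiff_comp_snd g
    have hh := contMDiff_comp_snd h
    have e1 := squareCocycle_cocycle B x.path.1.contMDiff hh.inv hg.inv
    have e2 : squareCocycle B (fun y => (h.1 y.2)⁻¹) (fun y => (g.1 y.2)⁻¹) = 0 :=
      squareCocycle_eq_zero_of_left B fun _ _ => rfl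
    have e3 : (fun y : unitInterval × unitInterval => ((g * h).1 y.2)⁻¹) =
        fun y => (h.1 y.2)⁻¹ * (g.1 y.2)⁻¹ := by
      ext y
      exact mul_inv_rev _ _
    have e4 : squareCocycle B (conj h x.path).1 (fun y => (g.1 y.2)⁻¹) =
        squareCocycle B (fun y => x.path.1 y * (h.1 y.2)⁻¹) (fun y => (g.1 y.2)⁻¹) := by
      rw [← squareCocycle_const_mul B h.1 (fun y => x.path.1 y * (h.1 y.2)⁻¹)]
      simp only [conj_coe, mul_assoc]
    rw [e2, add_zero, ← e3] at e1
    simp only [actExt_phase, actExt_path, e4, ← e1, Circle.exp_add, mul_assoc]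

/-- The endpoint evaluation as a homomorphism on `P₀L₀G × U(1)`. -/
noncomputable def endpointHom (B : InvariantForm I G) : ExtPath B →* PathGroup I G where
  toFun x := endpoint x.path
  map_one' := rfl
  map_mul' _ _ := rfl

theorem endpointHom_eq_one {B : InvariantForm I G} {x : ExtPath B} (hx : x ∈ holonomySet B) :
    endpointHom B x = 1 := by
  obtain ⟨F, h, e, -⟩ := mem_holonomySet_iff.1 hx
  refine Subtype.ext (DFunLike.ext _ _ fun r => ?_)
  change x.path.1 (1, r) = 1
  rw [← congrFun e]
  exact h.side_one _ _

/-- The action of `g ∈ P₀G` on `P₀L₀G × U(1)` as an endomorphism. -/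
noncomputable def actExtHom (B : InvariantForm I G) (g : PathGroup I G) :
    ExtPath B →* ExtPath B where
  toFun := actExt B g
  map_one' := by
    have h := actExt_mul g (1 : ExtPath B) 1
    rw [one_mul] at h
    exact (mul_eq_left.1 h.symm)
  map_mul' := actExt_mul g

/-- The parameter of a homotopy which contracts a path `f` to its end point: the path
`s ↦ f(1 - (1 - u)(1 - s))` is `f` for `u = 0` and constantly `f(1)` for `u = 1`. -/
noncomputable def tailParam (u s : unitInterval) : unitInterval :=
  unitInterval.symm (unitInterval.symm u * unitInterval.symm s)

theorem contMDiff_tailParam : ContMDiff ((𝓡∂ 1).prod (𝓡∂ 1)) (𝓡∂ 1) ∞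
    (fun x : unitInterval × unitInterval => tailParam x.1 x.2) := by
  have h : ContMDiff ((𝓡∂ 1).prod (𝓡∂ 1)) 𝓘(ℝ, ℝ) ∞
      (fun x : unitInterval × unitInterval => 1 - (1 - (x.1 : ℝ)) * (1 - (x.2 : ℝ))) :=
    contMDiff_const.sub ((contMDiff_const.sub (contMDiff_subtypeVal_Icc.comp contMDiff_fst)).mul
      (contMDiff_const.sub (contMDiff_subtypeVal_Icc.comp contMDiff_snd)))
  exact contMDiff_iff_comp_subtypeVal_Icc.2 ⟨by unfold tailParam; fun_prop, h⟩

theorem tailParam_zero_left (s : unitInterval) : tailParam 0 s = s := by simp [tailParam]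

theorem tailParam_one_left (s : unitInterval) : tailParam 1 s = 1 := by simp [tailParam]

theorem tailParam_zero_right (u : unitInterval) : tailParam u 0 = u := by simp [tailParam]

theorem tailParam_one_right (u : unitInterval) : tailParam u 1 = 1 := by simp [tailParam]


theorem normalClosure_holonomySet_le_ker (B : InvariantForm I G) :
    Subgroup.normalClosure (holonomySet B) ≤ (endpointHom B).ker :=
  Subgroup.normalClosure_le_normal fun _ hx => endpointHom_eq_one hx

theorem cls_surjective (B : InvariantForm I G) : Function.Surjective (cls B) :=
  QuotientGroup.mk_surjective

variable [FiniteDimensional ℝ E] [I.Boundaryless]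

/-- If `F` is a disc with boundary `f`, then `g F g⁻¹` is a disc with boundary `g f g⁻¹`, and the
integral of `ω` changes by the phase of the action. -/
theorem actExt_mem_holonomySet {B : InvariantForm I G} (g : PathGroup I G) {x : ExtPath B}
    (hx : x ∈ holonomySet B) : actExt B g x ∈ holonomySet B := by
  obtain ⟨F, h, e, p⟩ := mem_holonomySet_iff.1 hx
  have hg : ContMDiff ((𝓡∂ 1).prod ((𝓡∂ 1).prod (𝓡∂ 1))) I ∞
      (fun z : unitInterval × unitInterval × unitInterval => g.1 z.2.2) :=
    g.1.contMDiff.comp (contMDiff_snd.comp contMDiff_snd)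
  refine mem_holonomySet_iff.2 ⟨fun z => g.1 z.2.2 * F z * (g.1 z.2.2)⁻¹,
    ⟨(hg.mul h.smooth).mul hg.inv, ?_, ?_, ?_, ?_, ?_⟩, ?_, ?_⟩
  · simp [h.bot]
  · simp [h.side_zero]
  · simp [h.side_one]
  · simp [h.loop_zero]
  · simp [h.loop_one]
  · ext z
    change _ = g.1 z.2 * x.path.1 z * (g.1 z.2)⁻¹
    rw [← congrFun e z]
  · have c1 := cubeIntegral_mul_of_fixed B hg h.smooth (by simp [h.loop_zero])
      (by simp [h.loop_one]) (fun _ _ => rfl) (fun _ _ => rfl)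
    have c2 := cubeIntegral_mul_of_fixed B (F₁ := fun z => g.1 z.2.2 * F z)
      (F₂ := fun z => (g.1 z.2.2)⁻¹) (hg.mul h.smooth) hg.inv (fun _ _ => rfl) (fun _ _ => rfl)
      (by simp [h.side_zero]) (by simp [h.side_one])
    rw [cubeIntegral_eq_zero B (F := fun z => g.1 z.2.2) (fun _ _ => rfl),
      squareCocycle_eq_zero_of_left B (f₁ := fun y => g.1 (1, y).2.2) (fun _ _ => rfl),
      squareCocycle_eq_zero_of_left B (f₁ := fun y => g.1 (0, y).2.2) (fun _ _ => rfl)] at c1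
    rw [cubeIntegral_eq_zero B (F := fun z => (g.1 z.2.2)⁻¹) (fun _ _ => rfl), c1,
      squareCocycle_eq_zero_of_left B (f₁ := fun y => g.1 (0, y).2.2 * F (0, y))
        (fun s r => by simp only [h.bot])] at c2
    rw [c2, actExt_phase, p, ← Circle.exp_add, ← e,
      ← squareCocycle_const_mul B g.1 (fun y => F (1, y))]
    congr 1
    ring

/-- The two sides of the Peiffer identity, `f₁ f₂ f₁⁻¹` and `(♭f₁) f₂ (♭f₁)⁻¹`, are joined by the
homotopy `h f₂ h⁻¹`, where `h` contracts `f₁` to its end point; their phases differ by the integral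
of `ω` over it. -/
theorem actExt_endpoint_div_mem_holonomySet {B : InvariantForm I G} (x y : ExtPath B) :
    actExt B (endpoint x.path) y / (x * y * x⁻¹) ∈ holonomySet B := by
  have hh : ContMDiff ((𝓡∂ 1).prod ((𝓡∂ 1).prod (𝓡∂ 1))) I ∞
      (fun z : unitInterval × unitInterval × unitInterval =>
        x.path.1 (tailParam z.1 z.2.1, z.2.2)) :=
    x.path.1.contMDiff.comp ((contMDiff_tailParam.comp (contMDiff_fst.prodMk
      (contMDiff_fst.comp contMDiff_snd))).prodMk (contMDiff_snd.comp contMDiff_snd))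
  have hy : ContMDiff ((𝓡∂ 1).prod ((𝓡∂ 1).prod (𝓡∂ 1))) I ∞
      (fun z : unitInterval × unitInterval × unitInterval => y.path.1 z.2) :=
    y.path.1.contMDiff.comp contMDiff_snd
  have x0 : ∀ s, x.path.1 (s, 0) = 1 := fun s => (x.path.2.2 s).1
  have x1 : ∀ s, x.path.1 (s, 1) = 1 := fun s => (x.path.2.2 s).2
  have y0 : ∀ s, y.path.1 (s, 0) = 1 := fun s => (y.path.2.2 s).1
  have y1 : ∀ s, y.path.1 (s, 1) = 1 := fun s => (y.path.2.2 s).2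
  have yb : ∀ r, y.path.1 (0, r) = 1 := y.path.2.1
  have c1 := cubeIntegral_mul B hh hy (fun _ _ => rfl) (fun _ _ => rfl)
  have c2 := cubeIntegral_mul B
    (F₁ := fun z => x.path.1 (tailParam z.1 z.2.1, z.2.2) * y.path.1 z.2)
    (F₂ := fun z => (x.path.1 (tailParam z.1 z.2.1, z.2.2))⁻¹) (hh.mul hy) hh.inv
    (by simp [x0]) (by simp [x1])
  have c3 := cubeIntegral_mul B hh
    (F₂ := fun z => (x.path.1 (tailParam z.1 z.2.1, z.2.2))⁻¹) hh.inv (by simp [x0]) (by simp [x1])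
  have v1 : cubeIntegral B (fun z => y.path.1 z.2) = 0 := cubeIntegral_eq_zero B fun _ _ => rfl
  have v2 : cubeIntegral B (fun _ => (1 : G)) = 0 := cubeIntegral_eq_zero B fun _ _ => rfl
  simp only [tailParam_zero_left, tailParam_one_left, tailParam_zero_right, tailParam_one_right,
    mul_inv_cancel, yb, v1, v2, mul_one] at c1 c2 c3
  have w1 : squareCocycle B (fun z => x.path.1 (1, z.2)) (fun z => y.path.1 z) = 0 :=
    squareCocycle_eq_zero_of_left B fun _ _ => rfl
  have w2 : squareCocycle B (fun z => x.path.1 (1, z.2)) (fun z => y.path.1 (1, z.2)) = 0 :=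
    squareCocycle_eq_zero_of_left B fun _ _ => rfl
  have w3 : squareCocycle B (fun z => x.path.1 (z.1, z.2)) (fun _ => 1) = 0 :=
    squareCocycle_eq_zero_of_right B fun _ _ => rfl
  have w4 : squareCocycle B (fun z => x.path.1 (1, z.2)) (fun z => (x.path.1 (1, z.2))⁻¹) = 0 :=
    squareCocycle_eq_zero_of_left B fun _ _ => rfl
  have w5 : squareCocycle B (fun z => x.path.1 (1, z.2) * y.path.1 (1, z.2))
      (fun z => (x.path.1 (1, z.2))⁻¹) = 0 :=
    squareCocycle_eq_zero_of_left B fun _ _ => rfl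
  have w6 : squareCocycle B (fun z => x.path.1 (1, z.2) * y.path.1 z)
      (fun z => (x.path.1 (1, z.2))⁻¹) =
      squareCocycle B y.path.1 (fun z => (x.path.1 (1, z.2))⁻¹) :=
    squareCocycle_const_mul B (fun r => x.path.1 (1, r)) _ _
  rw [w1, w2, w3] at c1
  rw [w5, w6] at c2
  rw [w4] at c3
  refine div_mem_holonomySet
    (F := fun z => x.path.1 (tailParam z.1 z.2.1, z.2.2) * y.path.1 z.2 *
      (x.path.1 (tailParam z.1 z.2.1, z.2.2))⁻¹) ((hh.mul hy).mul hh.inv) ?_ ?_ ?_ ?_ ?_ ?_ ?_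
  · ext z
    simp only [tailParam_zero_left]
    rfl
  · ext z
    simp only [tailParam_one_left]
    rfl
  · simp [yb]
  · simp [tailParam_one_right]
  · simp [y0]
  · simp [y1]
  · rw [actExt_phase, ExtPath.mul_phase, ExtPath.mul_phase, ExtPath.inv_phase]
    change _ * Circle.exp (squareCocycle B y.path.1 (fun z => (x.path.1 (1, z.2))⁻¹)) =
      _ * Circle.exp (squareCocycle B (fun z => x.path.1 z * y.path.1 z)
        (fun z => (x.path.1 z)⁻¹)) * _
    have e : squareCocycle B y.path.1 (fun z => (x.path.1 (1, z.2))⁻¹) =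
        cubeIntegral B (fun z => x.path.1 (tailParam z.1 z.2.1, z.2.2) * y.path.1 z.2 *
          (x.path.1 (tailParam z.1 z.2.1, z.2.2))⁻¹) + squareCocycle B x.path.1 y.path.1 +
        squareCocycle B (fun z => x.path.1 z * y.path.1 z) (fun z => (x.path.1 z)⁻¹) -
        squareCocycle B x.path.1 (fun z => (x.path.1 z)⁻¹) := by
      linarith
    rw [e]
    refine Circle.ext ?_
    simp only [Circle.exp_add, Circle.exp_sub, Circle.coe_mul, Circle.coe_div, Circle.coe_inv]
    field_simp

theorem mem_normalClosure_holonomySet {B : InvariantForm I G} {x : ExtPath B} :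
    x ∈ Subgroup.normalClosure (holonomySet B) ↔ x ∈ holonomySet B := by
  rw [normalClosure_holonomySet]
  rfl

/-- The action of `g ∈ P₀G` on the extension `(P₀L₀G × U(1)) / N`. -/
noncomputable def actLoopExt (B : InvariantForm I G) (g : PathGroup I G) :
    LoopExt B →* LoopExt B :=
  QuotientGroup.map _ _ (actExtHom B g) fun _ hx => mem_normalClosure_holonomySet.2
    (actExt_mem_holonomySet g (mem_normalClosure_holonomySet.1 hx))

theorem actLoopExt_one (B : InvariantForm I G) (h : LoopExt B) : actLoopExt B 1 h = h := by
  obtain ⟨x, rfl⟩ := cls_surjective B h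
  exact congrArg (cls B) (actExt_one x)

theorem actLoopExt_mul (B : InvariantForm I G) (g₁ g₂ : PathGroup I G) (h : LoopExt B) :
    actLoopExt B (g₁ * g₂) h = actLoopExt B g₁ (actLoopExt B g₂ h) := by
  obtain ⟨x, rfl⟩ := cls_surjective B h
  exact congrArg (cls B) (actExt_comp g₁ g₂ x)

theorem cls_eq_iff {B : InvariantForm I G} {x y : ExtPath B} :
    cls B x = cls B y ↔ x / y ∈ holonomySet B :=
  QuotientGroup.eq_iff_div_mem.trans mem_normalClosure_holonomySet

/-- The string 2-group as a crossed module. -/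
noncomputable def stringTwoGroup (B : InvariantForm I G) :
    CrossedModule (LoopExt B) (PathGroup I G) where
  t := QuotientGroup.lift _ (endpointHom B) (normalClosure_holonomySet_le_ker B)
  act :=
    { toFun := fun g => MonoidHom.toMulEquiv (actLoopExt B g) (actLoopExt B g⁻¹)
        (MonoidHom.ext fun h => by
          change actLoopExt B g⁻¹ (actLoopExt B g h) = h
          rw [← actLoopExt_mul, inv_mul_cancel, actLoopExt_one])
        (MonoidHom.ext fun h => by
          change actLoopExt B g (actLoopExt B g⁻¹ h) = h
          rw [← actLoopExt_mul, mul_inv_cancel, actLoopExt_one])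
      map_one' := MulEquiv.ext (actLoopExt_one B)
      map_mul' := fun g h => MulEquiv.ext (actLoopExt_mul B g h) }
  t_act g h := by
    obtain ⟨x, rfl⟩ := cls_surjective B h
    rfl
  peiffer h₁ h₂ := by
    obtain ⟨x, rfl⟩ := cls_surjective B h₁
    obtain ⟨y, rfl⟩ := cls_surjective B h₂
    exact cls_eq_iff.2 (actExt_endpoint_div_mem_holonomySet x y)

theorem isStringTwoGroup_stringTwoGroup (B : InvariantForm I G) :
    IsStringTwoGroup B (stringTwoGroup B) :=
  ⟨fun _ => rfl, fun _ _ => rfl⟩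

end Action

/-! ### Smooth curves with a given velocity -/

section Curves

variable {E : Type*} [NormedAddCommGroup E] [NormedSpace ℝ E]
  {H : Type*} [TopologicalSpace H] {I : ModelWithCorners ℝ E H}
  {G : Type*} [TopologicalSpace G] [ChartedSpace H G]
  {K E' H' : Type*} [NormedAddCommGroup E'] [NormedSpace ℝ E'] [TopologicalSpace H']
  {J : ModelWithCorners ℝ E' H'} [TopologicalSpace K] [ChartedSpace H' K]

theorem contMDiff_slice_curve {c : ℝ → K → G}
    (hc : ContMDiff (𝓘(ℝ, ℝ).prod J) I ∞ (fun y : ℝ × K => c y.1 y.2)) (x : K) :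
    ContMDiff 𝓘(ℝ, ℝ) I ∞ (fun ε => c ε x) :=
  hc.comp (contMDiff_id.prodMk contMDiff_const)

variable [Group G] [LieGroup I ∞ G]

/-- The velocity at `1` of a smooth family of curves through `1` is smooth, because the
trivialisation of the tangent bundle over the preferred chart at `1` is the identity over `1`. -/
theorem contMDiff_velZero [IsManifold J 1 K] {c : ℝ → K → G}
    (hc : ContMDiff (𝓘(ℝ, ℝ).prod J) I ∞ (fun y : ℝ × K => c y.1 y.2)) (h1 : ∀ x, c 0 x = 1) :
    ContMDiff J 𝓘(ℝ, E) ∞ (fun x => velZero I (fun ε => c ε x)) := by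
  intro x₀
  have := ContMDiffAt.mfderiv (m := ∞) (n := ∞) (I := 𝓘(ℝ, ℝ)) (I' := I) (J := J) (x₀ := x₀)
    (fun x ε => c ε x) (fun _ => 0)
    (hc.comp (contMDiff_snd.prodMk contMDiff_fst)).contMDiffAt contMDiffAt_const (by simp)
  have h2 := this.clm_apply (contMDiffAt_const (c := (1:ℝ)))
  refine h2.congr_of_eventuallyEq (Eventually.of_forall fun n => ?_)
  refine Eq.trans ?_ (DFunLike.congr_fun (inTC_one (J := 𝓘(ℝ, ℝ)) (I := I)
    (fun _ : K => (0 : ℝ)) (fun n => c 0 n) (fun n => mfderiv 𝓘(ℝ, ℝ) I (fun ε => c ε n) 0)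
    x₀ n (h1 _) (h1 _) (mem_univ _)) 1).symm
  refine congrArg (mfderiv 𝓘(ℝ, ℝ) I (fun ε => c ε n) 0) ?_
  exact ((tangentBundleCore 𝓘(ℝ, ℝ) ℝ).coordChange_self (achart ℝ (0 : ℝ)) _
    (mem_chart_source ℝ _) _).symm

/-- Every smooth family of elements of the Lie algebra, parametrised by a compact manifold, is the
velocity of a smooth curve of families of group elements. In the chart `φ` at `1` the curve is
`φ(1) + a sin(ε/a) X`, where `a` is so small that it never leaves the chart. -/
theorem exists_curve_velZero_eq [I.Boundaryless] [CompactSpace K] {X : K → E}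
    (hX : ContMDiff J 𝓘(ℝ, E) ∞ X) :
    ∃ c : ℝ → K → G, ContMDiff (𝓘(ℝ, ℝ).prod J) I ∞ (fun y : ℝ × K => c y.1 y.2) ∧
      (∀ x, c 0 x = 1) ∧ (∀ ε x, X x = 0 → c ε x = 1) ∧
      ∀ x, velZero I (fun ε => c ε x) = X x := by
  obtain ⟨C, hC⟩ := (isCompact_range hX.continuous.norm).bddAbove
  have hC' : ∀ x, ‖X x‖ ≤ |C| := fun x => (hC ⟨x, rfl⟩).trans (le_abs_self C)
  obtain ⟨δ, hδ, hball⟩ := Metric.isOpen_iff.1 (isOpen_extChartAt_target (I := I) (1 : G)) _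
    (mem_extChartAt_target (1 : G))
  set a : ℝ := δ / (|C| + 1) with ha
  have hC1 : 0 < |C| + 1 := by positivity
  have ha0 : 0 < a := div_pos hδ hC1
  have hmem : ∀ ε x, extChartAt I (1 : G) 1 + (a * Real.sin (ε / a)) • X x ∈
      (extChartAt I (1 : G)).target := by
    intro ε x
    refine hball ?_
    rw [Metric.mem_ball, dist_eq_norm, add_sub_cancel_left, norm_smul, Real.norm_eq_abs, abs_mul,
      abs_of_pos ha0]
    calc a * |Real.sin (ε / a)| * ‖X x‖ ≤ a * 1 * |C| := by
          gcongr
          · exact Real.abs_sin_le_one _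
          · exact hC' x
      _ < a * (|C| + 1) := by nlinarith
      _ = δ := by rw [ha]; field_simp
  have hsin : ContMDiff (𝓘(ℝ, ℝ).prod J) 𝓘(ℝ, ℝ) ∞ (fun y : ℝ × K => a * Real.sin (y.1 / a)) :=
    (contDiff_const.mul (Real.contDiff_sin.comp (contDiff_id.div_const a))).contMDiff.comp
      contMDiff_fst
  have hc : ContMDiff (𝓘(ℝ, ℝ).prod J) I ∞ (fun y : ℝ × K => (extChartAt I (1 : G)).symm
      (extChartAt I (1 : G) 1 + (a * Real.sin (y.1 / a)) • X y.2)) :=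
    (contMDiffOn_extChartAt_symm (n := ∞) (1 : G)).comp_contMDiff
      (contMDiff_const.add (hsin.smul (hX.comp contMDiff_snd))) fun y => hmem y.1 y.2
  have h0 : ∀ x, (extChartAt I (1 : G)).symm
      (extChartAt I (1 : G) 1 + (a * Real.sin (0 / a)) • X x) = 1 := by simp
  refine ⟨fun ε x => (extChartAt I (1 : G)).symm
    (extChartAt I (1 : G) 1 + (a * Real.sin (ε / a)) • X x), hc, h0, ?_, fun x => ?_⟩
  · intro ε x hx
    simp [hx]
  · have hs : ContMDiff 𝓘(ℝ, ℝ) I ∞ (fun ε => (extChartAt I (1 : G)).symm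
        (extChartAt I (1 : G) 1 + (a * Real.sin (ε / a)) • X x)) :=
      hc.comp (f := fun ε : ℝ => (ε, x)) (contMDiff_id.prodMk contMDiff_const)
    rw [velZero_eq_deriv_extChartAt (hs.mdifferentiableAt (by simp)) (h0 x)]
    simp only [fun ε => (extChartAt I (1 : G)).right_inv (hmem ε x)]
    have hd : HasDerivAt (fun ε => a * Real.sin (ε / a)) 1 0 := by
      have := ((hasDerivAt_id (0 : ℝ)).div_const a).sin.const_mul a
      simpa [ha0.ne'] using this
    simpa using ((hd.smul_const (X x)).const_add (extChartAt I (1 : G) 1)).deriv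

end Curves

/-! ### Curves in the path group and in the central extension -/

section Paths

variable {E : Type*} [NormedAddCommGroup E] [NormedSpace ℝ E]
  {H : Type*} [TopologicalSpace H] {I : ModelWithCorners ℝ E H}
  {G : Type*} [TopologicalSpace G] [ChartedSpace H G] [Group G]

theorem integrable_form_path (B : InvariantForm I G) {V W : unitInterval → E}
    (hV : ContMDiff (𝓡∂ 1) 𝓘(ℝ, E) ∞ V) (hW : ContMDiff (𝓡∂ 1) 𝓘(ℝ, E) ∞ W) :
    Integrable fun r => B.form (V r) (W r) :=
  integrable_of_continuous ((B.form.continuous.comp hV.continuous).clm_apply hW.continuous)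

variable [LieGroup I ∞ G]

theorem exists_hasVelPath [I.Boundaryless] (V : PathAlgebra E) :
    ∃ c : ℝ → PathGroup I G, HasVelPath c V := by
  obtain ⟨c, hc, h0, h1, hv⟩ := exists_curve_velZero_eq (I := I) (G := G) V.1.contMDiff
  refine ⟨fun ε => ⟨⟨c ε, hc.comp (contMDiff_const.prodMk contMDiff_id)⟩, h1 ε 0 V.2⟩, hc,
    Subtype.ext (DFunLike.ext _ _ h0), fun r => (hv r).symm⟩

theorem coe_eq_im_mul_I (q : skewAdjoint ℂ) : (q : ℂ) = (q : ℂ).im * Complex.I := by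
  have h : -(q : ℂ) = star (q : ℂ) := (skewAdjoint.mem_iff.1 q.2).symm
  apply Complex.ext
  · have h' : -(q : ℂ).re = (q : ℂ).re := congrArg Complex.re h
    simp only [Complex.mul_re, Complex.ofReal_re, Complex.I_re, Complex.ofReal_im, Complex.I_im]
    linarith
  · simp

theorem contDiff_circleExp {L : ℝ → ℝ} (hL : ContDiff ℝ ∞ L) :
    ContDiff ℝ ∞ (fun ε => (Circle.exp (L ε) : ℂ)) := by
  simp only [Circle.coe_exp]
  exact (((Complex.ofRealCLM.contDiff (n := ∞)).comp hL).mul contDiff_const).cexp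

theorem hasDerivAt_circleExp {L : ℝ → ℝ} {L' : ℝ} (hL : HasDerivAt L L' 0) (h0 : L 0 = 0) :
    HasDerivAt (fun ε => (Circle.exp (L ε) : ℂ)) (L' * Complex.I) 0 := by
  have h := (hL.ofReal_comp.mul_const Complex.I).cexp
  simp only [h0, Complex.ofReal_zero, zero_mul, Complex.exp_zero, one_mul] at h
  simpa only [Circle.coe_exp] using h

theorem exists_hasVelExt [I.Boundaryless] (B : InvariantForm I G) (W : LoopExtAlgebra E) :
    ∃ c, HasVelExt B c W := by
  have hX : ContMDiff ((𝓡∂ 1).prod (𝓡∂ 1)) 𝓘(ℝ, E) ∞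
      (fun y : unitInterval × unitInterval => (y.1 : ℝ) • W.1.1 y.2) :=
    (contMDiff_subtypeVal_Icc.comp contMDiff_fst).smul (W.1.1.contMDiff.comp contMDiff_snd)
  obtain ⟨c, hc, h0, h1, hv⟩ := exists_curve_velZero_eq (I := I) (G := G) hX
  let x : ℝ → ExtPath B := fun ε => ⟨⟨⟨c ε, hc.comp (contMDiff_const.prodMk contMDiff_id)⟩,
    fun r => h1 ε (0, r) (by simp), fun s => ⟨h1 ε (s, 0) (by simp [W.1.2.1]),
      h1 ε (s, 1) (by simp [W.1.2.2])⟩⟩, Circle.exp (ε * (W.2 : ℂ).im)⟩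
  have hd := hasDerivAt_circleExp ((hasDerivAt_id (0 : ℝ)).mul_const (W.2 : ℂ).im) (by simp)
  refine ⟨fun ε => cls B (x ε), x, hc, contDiff_circleExp (contDiff_id.mul contDiff_const),
    ExtPath.ext (Subtype.ext (DFunLike.ext _ _ h0)) ?_, fun _ => rfl, fun r => ?_, ?_⟩
  · change Circle.exp (0 * (W.2 : ℂ).im) = 1
    simp
  · refine Eq.trans ?_ (hv (1, r)).symm
    simp
  · refine Eq.trans (coe_eq_im_mul_I _) ?_
    refine Eq.trans ?_ hd.deriv.symm
    simp

theorem linear_adPath (g : PathGroup I G) : IsLinearMap ℝ (adPath (E := E) g) where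
  map_add V W := Subtype.ext (DFunLike.ext _ _ fun r => (Ad I (g.1 r)).map_add (V.1 r) (W.1 r))
  map_smul a V := Subtype.ext (DFunLike.ext _ _ fun r => (Ad I (g.1 r)).map_smul a (V.1 r))

theorem linear_tAlg : IsLinearMap ℝ (tAlg (E := E)) where
  map_add _ _ := rfl
  map_smul _ _ := rfl

theorem imag_add (x y : ℝ) : imag (x + y) = imag x + imag y :=
  Subtype.ext (by simp [imag, add_mul])

theorem imag_smul (a x : ℝ) : imag (a * x) = a • imag x :=
  Subtype.ext (by simp [imag, mul_assoc])

theorem imag_zero : imag 0 = 0 := Subtype.ext (by simp [imag])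

theorem contMDiff_leftLog_path {p : unitInterval → G} (hp : ContMDiff (𝓡∂ 1) I ∞ p) :
    ContMDiff (𝓡∂ 1) 𝓘(ℝ, E) ∞ (leftLog I p) :=
  contMDiff_leftLog (Φ := fun (_ : unitInterval) => p) (τ := id) (hp.comp contMDiff_snd)
    contMDiff_id

theorem linear_actGroupAlg (B : InvariantForm I G) (g : PathGroup I G) :
    IsLinearMap ℝ (actGroupAlg B g) where
  map_add V W := by
    refine Prod.ext (Subtype.ext (DFunLike.ext _ _ fun r =>
      (Ad I (g.1 r)).map_add (V.1.1 r) (W.1.1 r))) ?_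
    have hl := contMDiff_leftLog_path g.1.contMDiff
    have e : ∫ r, B.form ((V + W).1.1 r) (leftLog I g.1 r) =
        (∫ r, B.form (V.1.1 r) (leftLog I g.1 r)) + ∫ r, B.form (W.1.1 r) (leftLog I g.1 r) := by
      rw [← integral_add (integrable_form_path B V.1.1.contMDiff hl)
        (integrable_form_path B W.1.1.contMDiff hl)]
      refine integral_congr_ae (Eventually.of_forall fun r => ?_)
      change B.form (V.1.1 r + W.1.1 r) _ = _
      rw [map_add, add_apply]
    change V.2 + W.2 + imag _ = V.2 + imag _ + (W.2 + imag _)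
    rw [e, mul_add, imag_add, add_add_add_comm]
  map_smul a V := by
    refine Prod.ext (Subtype.ext (DFunLike.ext _ _ fun r =>
      (Ad I (g.1 r)).map_smul a (V.1.1 r))) ?_
    have e : ∫ r, B.form ((a • V).1.1 r) (leftLog I g.1 r) =
        a * ∫ r, B.form (V.1.1 r) (leftLog I g.1 r) := by
      rw [← integral_const_mul]
      refine integral_congr_ae (Eventually.of_forall fun r => ?_)
      change B.form (a • V.1.1 r) _ = _
      rw [map_smul, smul_apply, smul_eq_mul]
    change a • V.2 + imag _ = a • (V.2 + imag _)
    rw [e, mul_left_comm, imag_smul, smul_add]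

theorem HasVelPath.conj {c : ℝ → PathGroup I G} {V : PathAlgebra E} (h : HasVelPath c V)
    (g : PathGroup I G) : HasVelPath (fun ε => g * c ε * g⁻¹) (adPath g V) := by
  obtain ⟨hs, h0, hv⟩ := h
  have hg : ContMDiff (𝓘(ℝ, ℝ).prod (𝓡∂ 1)) I ∞ (fun x : ℝ × unitInterval => g.1 x.2) :=
    g.1.contMDiff.comp contMDiff_snd
  refine ⟨(hg.mul hs).mul hg.inv, by simp [h0], fun r => ?_⟩
  have h1 : (c 0).1 r = 1 := by rw [h0]; rfl
  have := velZero_conj_of_eq_one (g.1 r)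
    ((contMDiff_slice_curve (c := fun ε r => (c ε).1 r) hs r).mdifferentiableAt (by simp)) h1
  refine Eq.trans ?_ this.symm
  rw [← hv]
  rfl

theorem HasVelPath.leftLog_smooth {c : ℝ → PathGroup I G} {V : PathAlgebra E}
    (h : HasVelPath c V) : ContMDiff (𝓘(ℝ, ℝ).prod (𝓡∂ 1)) 𝓘(ℝ, E) ∞
      (fun x : ℝ × unitInterval => leftLog I (c x.1).1 x.2) :=
  have : IsManifold (𝓘(ℝ, ℝ).prod (𝓡∂ 1)) 1 (ℝ × unitInterval) := inferInstance
  contMDiff_leftLog (N := ℝ × unitInterval) (Φ := fun x r => (c x.1).1 r) (τ := fun x => x.2)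
    (h.1.comp ((contMDiff_fst.comp contMDiff_fst).prodMk contMDiff_snd)) contMDiff_snd

end Paths

/-! ### The derivative of the action -/

section ActionDerivative

variable {E : Type*} [NormedAddCommGroup E] [NormedSpace ℝ E]
  {H : Type*} [TopologicalSpace H] {I : ModelWithCorners ℝ E H}
  {G : Type*} [TopologicalSpace G] [ChartedSpace H G] [Group G]

theorem contMDiff_form_apply {N E' H' : Type*} [NormedAddCommGroup E'] [NormedSpace ℝ E']
    [TopologicalSpace H'] {J : ModelWithCorners ℝ E' H'} [TopologicalSpace N] [ChartedSpace H' N]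
    (B : InvariantForm I G) {V W : N → E} (hV : ContMDiff J 𝓘(ℝ, E) ∞ V)
    (hW : ContMDiff J 𝓘(ℝ, E) ∞ W) : ContMDiff J 𝓘(ℝ, ℝ) ∞ (fun x => B.form (V x) (W x)) :=
  ((B.form.contMDiff (n := ∞)).comp hV).clm_apply hW

variable [LieGroup I ∞ G]

theorem contMDiff_leftLog_family {f : ℝ → unitInterval × unitInterval → G}
    (hf : ContMDiff (𝓘(ℝ, ℝ).prod ((𝓡∂ 1).prod (𝓡∂ 1))) I ∞
      (fun y : ℝ × unitInterval × unitInterval => f y.1 y.2)) :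
    ContMDiff (𝓘(ℝ, ℝ).prod ((𝓡∂ 1).prod (𝓡∂ 1))) 𝓘(ℝ, E) ∞
      (fun y : ℝ × unitInterval × unitInterval =>
        leftLog I (fun s => f y.1 (s, y.2.2)) y.2.1) :=
  contMDiff_leftLog (Φ := fun (y : ℝ × unitInterval × unitInterval) s => f y.1 (s, y.2.2))
    (hf.comp ((contMDiff_fst.comp contMDiff_fst).prodMk
      (contMDiff_snd.prodMk (contMDiff_snd.comp (contMDiff_snd.comp contMDiff_fst)))))
    (contMDiff_fst.comp contMDiff_snd)

theorem contMDiff_rightLog_family {f : ℝ → unitInterval × unitInterval → G}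
    (hf : ContMDiff (𝓘(ℝ, ℝ).prod ((𝓡∂ 1).prod (𝓡∂ 1))) I ∞
      (fun y : ℝ × unitInterval × unitInterval => f y.1 y.2)) :
    ContMDiff (𝓘(ℝ, ℝ).prod ((𝓡∂ 1).prod (𝓡∂ 1))) 𝓘(ℝ, E) ∞
      (fun y : ℝ × unitInterval × unitInterval =>
        rightLog I (fun r => f y.1 (y.2.1, r)) y.2.2) :=
  contMDiff_rightLog (Φ := fun (y : ℝ × unitInterval × unitInterval) r => f y.1 (y.2.1, r))
    (hf.comp ((contMDiff_fst.comp contMDiff_fst).prodMk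
      ((contMDiff_fst.comp (contMDiff_snd.comp contMDiff_fst)).prodMk contMDiff_snd)))
    (contMDiff_snd.comp contMDiff_snd)

/-- The cocycle is smooth along smooth families of maps `[0,1]² → G`. -/
theorem contDiff_squareCocycle (B : InvariantForm I G) {f₁ f₂ : ℝ → unitInterval × unitInterval → G}
    (h₁ : ContMDiff (𝓘(ℝ, ℝ).prod ((𝓡∂ 1).prod (𝓡∂ 1))) I ∞
      (fun y : ℝ × unitInterval × unitInterval => f₁ y.1 y.2))
    (h₂ : ContMDiff (𝓘(ℝ, ℝ).prod ((𝓡∂ 1).prod (𝓡∂ 1))) I ∞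
      (fun y : ℝ × unitInterval × unitInterval => f₂ y.1 y.2)) :
    ContDiff ℝ ∞ (fun ε => squareCocycle B (f₁ ε) (f₂ ε)) :=
  contDiff_const.mul (contDiff_integral (J := (𝓡∂ 1).prod (𝓡∂ 1))
    (Φ := fun ε (y : unitInterval × unitInterval) =>
      B.form (leftLog I (fun s => f₁ ε (s, y.2)) y.1) (rightLog I (fun r => f₂ ε (y.1, r)) y.2))
    (contMDiff_form_apply B (contMDiff_leftLog_family h₁) (contMDiff_rightLog_family h₂)))

/-- The derivative of the phase of the action of `P₀G`, along a curve of paths in the loop group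
through the constant path `1`. -/
theorem hasDerivAt_integral_form_leftLog (B : InvariantForm I G)
    {f : ℝ → unitInterval × unitInterval → G}
    (hf : ContMDiff (𝓘(ℝ, ℝ).prod ((𝓡∂ 1).prod (𝓡∂ 1))) I ∞
      (fun y : ℝ × unitInterval × unitInterval => f y.1 y.2))
    (h0 : ∀ y, f 0 y = 1) (hs : ∀ ε r, f ε (0, r) = 1) {X : unitInterval → E}
    (hX : ContMDiff (𝓡∂ 1) 𝓘(ℝ, E) ∞ X) :
    HasDerivAt (fun ε => ∫ y : unitInterval × unitInterval,
        B.form (leftLog I (fun s => f ε (s, y.2)) y.1) (X y.2))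
      (∫ r, B.form (velZero I (fun ε => f ε (1, r))) (X r)) 0 := by
  have hV := contMDiff_velZero hf h0
  have hX2 : ContMDiff ((𝓡∂ 1).prod (𝓡∂ 1)) 𝓘(ℝ, E) ∞
      (fun y : unitInterval × unitInterval => X y.2) := hX.comp contMDiff_snd
  have hl := contMDiff_leftLog_family hf
  have hd := hasDerivAt_integral (J := (𝓡∂ 1).prod (𝓡∂ 1)) (μ := volume)
    (Φ := fun ε (y : unitInterval × unitInterval) =>
      B.form (leftLog I (fun s => f ε (s, y.2)) y.1) (X y.2))
    (contMDiff_form_apply B hl (hX2.comp contMDiff_snd)) 0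
  refine hd.congr_deriv ?_
  have e : ∀ y : unitInterval × unitInterval,
      deriv (fun ε => B.form (leftLog I (fun s => f ε (s, y.2)) y.1) (X y.2)) 0 =
      vel 𝓘(ℝ, ℝ) (fun s => B.form (velZero I (fun ε => f ε (s, y.2))) (X y.2)) y.1 := by
    intro y
    have hsl : ContMDiff (𝓘(ℝ, ℝ).prod (𝓡∂ 1)) I ∞
        (Function.uncurry fun ε s => f ε (s, y.2)) :=
      hf.comp (contMDiff_fst.prodMk (contMDiff_snd.prodMk contMDiff_const))
    have hVs : ContMDiff (𝓡∂ 1) 𝓘(ℝ, E) ∞ (fun s => velZero I (fun ε => f ε (s, y.2))) :=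
      hV.comp (contMDiff_id.prodMk contMDiff_const)
    have h1 := deriv_leftLog_of_eq_one hsl (fun s => h0 (s, y.2)) hVs (fun _ => rfl) y.1
    have h2 := ((B.form.flip (X y.2)).hasFDerivAt.comp_hasDerivAt 0
      (hasDerivAt_of_contMDiff (J := (𝓡∂ 1).prod (𝓡∂ 1))
        (Φ := fun ε y => leftLog I (fun s => f ε (s, y.2)) y.1) hl 0 y)).deriv
    have h3 := ((hasVelAt_of_contMDiff hVs y.1).clm (B.form.flip (X y.2))).vel_eq
    refine Eq.trans h2 (Eq.trans ?_ h3.symm)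
    exact congrArg (B.form.flip (X y.2)) h1
  simp only [e]
  rw [integral_vel_fst (contMDiff_form_apply B hV hX2)]
  simp only [hs, velZero_const, map_zero, zero_apply, sub_zero]

/-- Changing the phase of a curve in the extension by `exp(i L)` adds `i L'(0)` to its velocity. -/
theorem hasVelExt_of_lift {B : InvariantForm I G} {c : ℝ → LoopExt B} {x : ℝ → ExtPath B}
    (hs : ContMDiff (𝓘(ℝ, ℝ).prod ((𝓡∂ 1).prod (𝓡∂ 1))) I ∞
      (fun y : ℝ × unitInterval × unitInterval => (x y.1).path.1 y.2))
    (h0 : (x 0).path = 1) {z : ℝ → Circle} (hz : ContDiff ℝ ∞ (fun ε => (z ε : ℂ))) (hz0 : z 0 = 1)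
    {L : ℝ → ℝ} {L' : ℝ} (hL : ContDiff ℝ ∞ L) (hL0 : L 0 = 0) (hL' : HasDerivAt L L' 0)
    (hp : ∀ ε, (x ε).phase = z ε * Circle.exp (L ε)) (hc : ∀ ε, c ε = cls B (x ε))
    {W : LoopExtAlgebra E} (hW : ∀ r, W.1.1 r = velZero I (fun ε => (x ε).path.1 (1, r)))
    (hq : (W.2 : ℂ) = deriv (fun ε => (z ε : ℂ)) 0 + L' * Complex.I) : HasVelExt B c W := by
  have hp' : (fun ε => ((x ε).phase : ℂ)) = fun ε => (z ε : ℂ) * (Circle.exp (L ε) : ℂ) := by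
    ext ε
    rw [hp, Circle.coe_mul]
  refine ⟨x, hs, ?_, ExtPath.ext h0 ?_, hc, hW, ?_⟩
  · rw [hp']
    exact hz.mul (contDiff_circleExp hL)
  · rw [hp, hz0, hL0, Circle.exp_zero, mul_one]
    rfl
  · have hd := ((hz.differentiable (by simp) 0).hasDerivAt.mul
      (hasDerivAt_circleExp hL' hL0)).deriv
    rw [hp', hq]
    refine Eq.trans ?_ hd.symm
    simp [hz0, hL0]

theorem coe_imag (a : ℝ) : (imag a : ℂ) = a * Complex.I := rfl

theorem HasVelExt.map_t [FiniteDimensional ℝ E] [I.Boundaryless] {B : InvariantForm I G}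
    {c : ℝ → LoopExt B} {W : LoopExtAlgebra E} (h : HasVelExt B c W) :
    HasVelPath (fun ε => (stringTwoGroup B).t (c ε)) (tAlg W) := by
  obtain ⟨x, hs, -, h0, hc, hv, -⟩ := h
  refine ⟨?_, ?_, fun r => ?_⟩
  · simp only [hc, (isStringTwoGroup_stringTwoGroup B).1]
    exact hs.comp (contMDiff_fst.prodMk (contMDiff_const.prodMk contMDiff_snd))
  · simp only [hc, (isStringTwoGroup_stringTwoGroup B).1, h0]
    rfl
  · simp only [hc, (isStringTwoGroup_stringTwoGroup B).1]
    exact hv r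

theorem HasVelExt.map_act [FiniteDimensional ℝ E] [I.Boundaryless] {B : InvariantForm I G}
    {c : ℝ → LoopExt B} {W : LoopExtAlgebra E} (h : HasVelExt B c W) (g : PathGroup I G) :
    HasVelExt B (fun ε => (stringTwoGroup B).act g (c ε)) (actGroupAlg B g W) := by
  obtain ⟨x, hs, hz, h0, hc, hv, hq⟩ := h
  have hg : ContMDiff (𝓘(ℝ, ℝ).prod ((𝓡∂ 1).prod (𝓡∂ 1))) I ∞
      (fun y : ℝ × unitInterval × unitInterval => g.1 y.2.2) :=
    g.1.contMDiff.comp (contMDiff_snd.comp contMDiff_snd)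
  have h1 : ∀ y, (x 0).path.1 y = 1 := by
    intro y
    rw [h0]
    rfl
  have hL := contDiff_squareCocycle B (f₁ := fun ε => (x ε).path.1)
    (f₂ := fun _ y => (g.1 y.2)⁻¹) hs hg.inv
  have hL' := (hasDerivAt_integral_form_leftLog B (f := fun ε => (x ε).path.1) hs h1
    (fun ε r => (x ε).path.2.1 r) (contMDiff_leftLog_path g.1.contMDiff)).const_mul
      (1 / (2 * Real.pi))
  refine hasVelExt_of_lift (x := fun ε => actExt B g (x ε)) (z := fun ε => (x ε).phase)
    ((hg.mul hs).mul hg.inv) ?_ hz (by rw [h0]; rfl) hL ?_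
    (L' := 1 / (2 * Real.pi) * ∫ r, B.form (W.1.1 r) (leftLog I g.1 r)) ?_ ?_ ?_ ?_ ?_
  · rw [h0]
    refine Subtype.ext (DFunLike.ext _ _ fun y => ?_)
    change g.1 y.2 * 1 * (g.1 y.2)⁻¹ = 1
    group
  · exact squareCocycle_eq_zero_of_left B (fun s r => (h1 _).trans (h1 _).symm)
  · simp only [squareCocycle_inv B g.1.contMDiff, hv]
    exact hL'
  · exact fun ε => actExt_phase g (x ε)
  · intro ε
    rw [hc]
    exact (isStringTwoGroup_stringTwoGroup B).2 g (x ε)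
  · intro r
    have := velZero_conj_of_eq_one (g.1 r)
      ((contMDiff_slice_curve (c := fun ε y => (x ε).path.1 y) hs (1, r)).mdifferentiableAt
        (by simp)) (h1 (1, r))
    refine Eq.trans ?_ this.symm
    rw [← hv]
    rfl
  · rw [← hq, ← coe_imag]
    rfl

theorem isLinearisation_stringTwoGroup [FiniteDimensional ℝ E] [I.Boundaryless]
    (B : InvariantForm I G) :
    IsLinearisation (stringTwoGroup B) (HasVelExt B) HasVelPath adPath tAlg (actGroupAlg B) where
  exists_velH := exists_hasVelExt B
  exists_velG := exists_hasVelPath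
  linear_Ad := linear_adPath
  linear_t := linear_tAlg
  linear_act := linear_actGroupAlg B
  deriv_Ad g _ _ h := h.conj g
  deriv_t _ _ h := h.map_t
  deriv_act g _ _ h := h.map_act g

end ActionDerivative

/-! ### Uniqueness of tangent vectors for integral forms -/

section Uniqueness

variable {E : Type*} [NormedAddCommGroup E] [NormedSpace ℝ E]
  {H : Type*} [TopologicalSpace H] {I : ModelWithCorners ℝ E H}
  {G : Type*} [TopologicalSpace G] [ChartedSpace H G] [Group G]

theorem deriv_form_apply_eq_zero (B : InvariantForm I G) {V W : ℝ → E}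
    (hV : DifferentiableAt ℝ V 0) (hW : DifferentiableAt ℝ W 0) (hV0 : V 0 = 0) (hW0 : W 0 = 0) :
    deriv (fun ε => B.form (V ε) (W ε)) 0 = 0 := by
  have h := ((B.form.hasFDerivAt.comp_hasDerivAt 0 hV.hasDerivAt).clm_apply hW.hasDerivAt).deriv
  simpa [hV0, hW0] using h

variable [LieGroup I ∞ G]

/-- Along a pair of curves through the constant map `1`, both factors of the integrand vanish at
`ε = 0`, so the cocycle vanishes to second order. -/
theorem hasDerivAt_squareCocycle_zero (B : InvariantForm I G)
    {f₁ f₂ : ℝ → unitInterval × unitInterval → G}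
    (h₁ : ContMDiff (𝓘(ℝ, ℝ).prod ((𝓡∂ 1).prod (𝓡∂ 1))) I ∞
      (fun y : ℝ × unitInterval × unitInterval => f₁ y.1 y.2))
    (h₂ : ContMDiff (𝓘(ℝ, ℝ).prod ((𝓡∂ 1).prod (𝓡∂ 1))) I ∞
      (fun y : ℝ × unitInterval × unitInterval => f₂ y.1 y.2))
    (z₁ : ∀ y, f₁ 0 y = 1) (z₂ : ∀ y, f₂ 0 y = 1) :
    HasDerivAt (fun ε => squareCocycle B (f₁ ε) (f₂ ε)) 0 0 := by
  have hl := contMDiff_leftLog_family h₁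
  have hr := contMDiff_rightLog_family h₂
  have hd := hasDerivAt_integral (J := (𝓡∂ 1).prod (𝓡∂ 1)) (μ := volume)
    (Φ := fun ε (y : unitInterval × unitInterval) =>
      B.form (leftLog I (fun s => f₁ ε (s, y.2)) y.1) (rightLog I (fun r => f₂ ε (y.1, r)) y.2))
    (contMDiff_form_apply B hl hr) 0
  have e : ∀ y : unitInterval × unitInterval, deriv (fun ε =>
      B.form (leftLog I (fun s => f₁ ε (s, y.2)) y.1) (rightLog I (fun r => f₂ ε (y.1, r)) y.2)) 0 =
      0 := by
    intro y
    refine deriv_form_apply_eq_zero B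
      (hasDerivAt_of_contMDiff (J := (𝓡∂ 1).prod (𝓡∂ 1))
        (Φ := fun ε y => leftLog I (fun s => f₁ ε (s, y.2)) y.1) hl 0 y).differentiableAt
      (hasDerivAt_of_contMDiff (J := (𝓡∂ 1).prod (𝓡∂ 1))
        (Φ := fun ε y => rightLog I (fun r => f₂ ε (y.1, r)) y.2) hr 0 y).differentiableAt ?_ ?_
    · simp only [z₁, leftLog_const]
    · simp only [z₂, rightLog_const]
  simp only [e, integral_zero] at hd
  exact (hd.const_mul (-(1 / (2 * Real.pi)))).congr_deriv (mul_zero _)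

/-- Along a curve of maps through the constant map `1`, both factors of the integrand vanish at
`ε = 0`, so the integral of the three-form vanishes to second order. -/
theorem hasDerivAt_cubeIntegral_zero (B : InvariantForm I G)
    {F : ℝ → unitInterval × unitInterval × unitInterval → G}
    (hF : ContMDiff (𝓘(ℝ, ℝ).prod ((𝓡∂ 1).prod ((𝓡∂ 1).prod (𝓡∂ 1)))) I ∞
      (fun y : ℝ × unitInterval × unitInterval × unitInterval => F y.1 y.2))
    (z : ∀ y, F 0 y = 1) : HasDerivAt (fun ε => cubeIntegral B (F ε)) 0 0 := by
  have hu : ContMDiff (𝓘(ℝ, ℝ).prod ((𝓡∂ 1).prod ((𝓡∂ 1).prod (𝓡∂ 1)))) 𝓘(ℝ, E) ∞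
      (fun y : ℝ × unitInterval × unitInterval × unitInterval =>
        leftLog I (fun u => F y.1 (u, y.2.2.1, y.2.2.2)) y.2.1) :=
    contMDiff_leftLog (Φ := fun (y : ℝ × unitInterval × unitInterval × unitInterval) u =>
      F y.1 (u, y.2.2.1, y.2.2.2))
      (hF.comp ((contMDiff_fst.comp contMDiff_fst).prodMk (contMDiff_snd.prodMk
        (contMDiff_snd.comp (contMDiff_snd.comp contMDiff_fst)))))
      (contMDiff_fst.comp contMDiff_snd)
  have hs : ContMDiff ((𝓘(ℝ, ℝ).prod ((𝓡∂ 1).prod ((𝓡∂ 1).prod (𝓡∂ 1)))).prod (𝓡∂ 1))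
      𝓘(ℝ, E) ∞ (Function.uncurry
        fun (y : ℝ × unitInterval × unitInterval × unitInterval) r =>
          leftLog I (fun s => F y.1 (y.2.1, s, r)) y.2.2.1) :=
    contMDiff_leftLog
      (Φ := fun (x : (ℝ × unitInterval × unitInterval × unitInterval) × unitInterval) s =>
        F x.1.1 (x.1.2.1, s, x.2))
      (hF.comp (((contMDiff_fst.comp contMDiff_fst).comp contMDiff_fst).prodMk
        ((contMDiff_fst.comp ((contMDiff_snd.comp contMDiff_fst).comp contMDiff_fst)).prodMk
          (contMDiff_snd.prodMk (contMDiff_snd.comp contMDiff_fst)))))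
      (contMDiff_fst.comp (contMDiff_snd.comp (contMDiff_snd.comp contMDiff_fst)))
  have hr := contMDiff_vel hs (τ := fun y => y.2.2.2)
    (contMDiff_snd.comp (contMDiff_snd.comp contMDiff_snd))
  have hd := hasDerivAt_integral (J := (𝓡∂ 1).prod ((𝓡∂ 1).prod (𝓡∂ 1))) (μ := volume)
    (Φ := fun ε => discDensity B (F ε)) (contMDiff_form_apply B hu hr) 0
  have e : ∀ y, deriv (fun ε => discDensity B (F ε) y) 0 = 0 := by
    intro y
    refine deriv_form_apply_eq_zero B
      (hasDerivAt_of_contMDiff (J := (𝓡∂ 1).prod ((𝓡∂ 1).prod (𝓡∂ 1)))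
        (Φ := fun ε (y : unitInterval × unitInterval × unitInterval) =>
          leftLog I (fun u => F ε (u, y.2.1, y.2.2)) y.1) hu 0 y).differentiableAt
      (hasDerivAt_of_contMDiff (J := (𝓡∂ 1).prod ((𝓡∂ 1).prod (𝓡∂ 1)))
        (Φ := fun ε (y : unitInterval × unitInterval × unitInterval) =>
          vel 𝓘(ℝ, E) (fun r => leftLog I (fun s => F ε (y.1, s, r)) y.2.1) y.2.2)
        hr 0 y).differentiableAt ?_ ?_
    · simp only [z, leftLog_const]
    · simp only [z, leftLog_const]
      exact (hasVelAt_const 0 _).vel_eq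
  simp only [e, integral_zero] at hd
  exact (hd.const_mul (1 / (2 * Real.pi))).congr_deriv (mul_zero _)

variable [FiniteDimensional ℝ E] [I.Boundaryless]

/-- For an integral form the holonomy of a disc depends on its boundary only: `F₁ F₂⁻¹` is a disc
with constant boundary. -/
theorem InvariantForm.IsIntegral.exp_cubeIntegral_eq {B : InvariantForm I G} (hB : B.IsIntegral)
    {F₁ F₂ : unitInterval × unitInterval × unitInterval → G} (h₁ : IsDiscMap I F₁)
    (h₂ : IsDiscMap I F₂) (h : ∀ y, F₁ (1, y) = F₂ (1, y)) :
    Circle.exp (cubeIntegral B F₁) = Circle.exp (cubeIntegral B F₂) := by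
  have hd := h₁.mul h₂.inv
  have e : Circle.exp (cubeIntegral B fun x => F₁ x * (F₂ x)⁻¹) = 1 :=
    hB ⟨_, hd.smooth⟩ ⟨fun s r => hd.bot (s, r), fun u r => ⟨hd.side_zero u r, hd.side_one u r⟩,
      fun u s => ⟨hd.loop_zero u s, hd.loop_one u s⟩⟩ (fun s r => by
        change F₁ (1, s, r) * (F₂ (1, s, r))⁻¹ = 1
        rw [h, mul_inv_cancel])
  rw [h₁.cubeIntegral_mul h₂.inv, h₂.cubeIntegral_inv] at e
  simp only [h] at e
  rw [show ∀ a b c : ℝ, a + -(b + c) + c = a - b by intros; ring, Circle.exp_sub] at e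
  exact div_eq_one.1 e

/-- Two lifts of a curve in the extension differ by a curve `(k_ε, w_ε)` in `N`. If the form is
integral, then `w_ε` can be computed from the disc `(u, s, r) ↦ k_{uε}(s, r)`, whose integral
vanishes to second order in `ε`. -/
theorem HasVelExt.unique {B : InvariantForm I G} (hB : B.IsIntegral) {c : ℝ → LoopExt B}
    {W W' : LoopExtAlgebra E} (h : HasVelExt B c W) (h' : HasVelExt B c W') : W = W' := by
  obtain ⟨x, hs, hz, h0, hc, hv, hq⟩ := h
  obtain ⟨x', hs', -, h0', hc', hv', hq'⟩ := h'
  have hN : ∀ ε, x' ε / x ε ∈ holonomySet B := fun ε =>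
    cls_eq_iff.1 ((hc' ε).symm.trans (hc ε))
  have z0 : ∀ y, (x 0).path.1 y = 1 := fun y => by rw [h0]; rfl
  have z0' : ∀ y, (x' 0).path.1 y = 1 := fun y => by rw [h0']; rfl
  have he : ∀ ε r, (x' ε).path.1 (1, r) = (x ε).path.1 (1, r) := by
    intro ε r
    have h1 := endpointHom_eq_one (hN ε)
    rw [map_div, div_eq_one] at h1
    exact DFunLike.congr_fun (congrArg Subtype.val h1) r
  let k : ℝ → unitInterval × unitInterval → G := fun ε y => (x' ε).path.1 y * ((x ε).path.1 y)⁻¹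
  have hk : ContMDiff (𝓘(ℝ, ℝ).prod ((𝓡∂ 1).prod (𝓡∂ 1))) I ∞
      (fun y : ℝ × unitInterval × unitInterval => k y.1 y.2) := hs'.mul hs.inv
  -- a disc with boundary `k_ε`; it has fixed ends since both lifts have the same end points
  let F : ℝ → unitInterval × unitInterval × unitInterval → G := fun ε y => k (y.1 * ε) y.2
  have hF : ContMDiff (𝓘(ℝ, ℝ).prod ((𝓡∂ 1).prod ((𝓡∂ 1).prod (𝓡∂ 1)))) I ∞
      (fun y : ℝ × unitInterval × unitInterval × unitInterval => F y.1 y.2) :=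
    hk.comp (((contMDiff_subtypeVal_Icc.comp (contMDiff_fst.comp contMDiff_snd)).mul
      contMDiff_fst).prodMk (contMDiff_snd.comp contMDiff_snd))
  have hFd : ∀ ε, IsDiscMap I (F ε) := by
    intro ε
    refine ⟨hF.comp (contMDiff_const.prodMk contMDiff_id), ?_, ?_, ?_, ?_, ?_⟩
    · intro y
      simp only [F, k, Icc.coe_zero, zero_mul, z0, z0', inv_one, mul_one]
    · intro u r
      simp only [F, k, (x _).path.2.1, (x' _).path.2.1, inv_one, mul_one]
    · intro u r
      simp only [F, k, he, mul_inv_cancel]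
    · intro u s
      simp only [F, k, ((x _).path.2.2 _).1, ((x' _).path.2.2 _).1, inv_one, mul_one]
    · intro u s
      simp only [F, k, ((x _).path.2.2 _).2, ((x' _).path.2.2 _).2, inv_one, mul_one]
  have hphase : ∀ ε, (x' ε).phase = (x ε).phase * Circle.exp (cubeIntegral B (F ε) +
      squareCocycle B (x ε).path.1 (fun y => ((x ε).path.1 y)⁻¹) -
      squareCocycle B (x' ε).path.1 (fun y => ((x ε).path.1 y)⁻¹)) := by
    intro ε
    obtain ⟨F', hd, e, p⟩ := mem_holonomySet_iff.1 (hN ε)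
    rw [hB.exp_cubeIntegral_eq hd (hFd ε) (fun y => by
      refine (congrFun e y).trans ?_
      simp only [F, k, Icc.coe_one, one_mul, div_eq_mul_inv]
      rfl), div_eq_mul_inv, ExtPath.mul_phase, ExtPath.inv_phase] at p
    rw [Circle.exp_sub, Circle.exp_add, ← p]
    change _ = _ * (_ * Circle.exp (squareCocycle B (x' ε).path.1 fun y => ((x ε).path.1 y)⁻¹) *
      _ / _)
    refine Circle.ext ?_
    simp only [Circle.coe_mul, Circle.coe_div, Circle.coe_inv]
    field_simp
  have d1 := hasDerivAt_cubeIntegral_zero B hF (fun y => by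
    simp only [F, k, mul_zero, z0, z0', inv_one, mul_one])
  have d2 := hasDerivAt_squareCocycle_zero B (f₁ := fun ε => (x ε).path.1)
    (f₂ := fun ε y => ((x ε).path.1 y)⁻¹) hs hs.inv z0 (fun y => by rw [z0, inv_one])
  have d3 := hasDerivAt_squareCocycle_zero B (f₁ := fun ε => (x' ε).path.1)
    (f₂ := fun ε y => ((x ε).path.1 y)⁻¹) hs' hs.inv z0' (fun y => by rw [z0, inv_one])
  have hc0 : cubeIntegral B (F 0) + squareCocycle B (x 0).path.1 (fun y => ((x 0).path.1 y)⁻¹) -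
      squareCocycle B (x' 0).path.1 (fun y => ((x 0).path.1 y)⁻¹) = 0 := by
    have hc0 : cubeIntegral B (F 0) = 0 := cubeIntegral_eq_zero B (fun u y => by
      simp only [F, mul_zero])
    have e1 : squareCocycle B (x 0).path.1 (fun y => ((x 0).path.1 y)⁻¹) = 0 :=
      squareCocycle_eq_zero_of_left B (fun s r => by rw [z0, z0])
    have e2 : squareCocycle B (x' 0).path.1 (fun y => ((x 0).path.1 y)⁻¹) = 0 :=
      squareCocycle_eq_zero_of_left B (fun s r => by rw [z0', z0'])
    rw [hc0, e1, e2]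
    norm_num
  have d4 := hasDerivAt_circleExp ((d1.add d2).sub d3) hc0
  have d5 := ((hz.differentiable (by simp) 0).hasDerivAt.mul d4).deriv
  refine Prod.ext (Subtype.ext (DFunLike.ext _ _ fun r => ?_)) (Subtype.ext ?_)
  · rw [hv, hv']
    simp only [he]
  · rw [hq, hq']
    simp only [hphase, Circle.coe_mul]
    refine Eq.trans ?_ d5.symm
    simp only [Pi.add_apply, Pi.sub_apply, hc0, Circle.exp_zero, Circle.coe_one]
    norm_num

end Uniqueness

/-! ### The adjustment on products, and the exterior derivative behind its values on loops -/

section Adjustment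

variable {E : Type*} [NormedAddCommGroup E] [NormedSpace ℝ E]
  {H : Type*} [TopologicalSpace H] {I : ModelWithCorners ℝ E H}
  {G : Type*} [TopologicalSpace G] [ChartedSpace H G] [Group G] [LieGroup I ∞ G]

theorem linear_kappaHat (B : InvariantForm I G) (wp : C^∞⟮𝓡∂ 1, unitInterval; 𝓘(ℝ, ℝ), ℝ⟯)
    (h0 : wp 0 = 0) (h1 : wp 1 = 1) (g : PathGroup I G) :
    IsLinearMap ℝ (kappaHat B wp h0 h1 g) where
  map_add V W := by
    refine Prod.ext (Subtype.ext (DFunLike.ext _ _ fun r => ?_)) ?_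
    · change (Ad I (g.1 r) (V.1 r + W.1 r) - (V.1 r + W.1 r)) -
          wp r • (Ad I (g.1 1) (V.1 1 + W.1 1) - (V.1 1 + W.1 1)) =
        ((Ad I (g.1 r) (V.1 r) - V.1 r) - wp r • (Ad I (g.1 1) (V.1 1) - V.1 1)) +
          ((Ad I (g.1 r) (W.1 r) - W.1 r) - wp r • (Ad I (g.1 1) (W.1 1) - W.1 1))
      simp only [map_add]
      module
    · have hl := contMDiff_leftLog_path g.1.contMDiff
      have e : ∫ r, B.form (leftLog I g.1 r) ((V + W).1 r) =
          (∫ r, B.form (leftLog I g.1 r) (V.1 r)) + ∫ r, B.form (leftLog I g.1 r) (W.1 r) := by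
        rw [← integral_add (integrable_form_path B hl V.1.contMDiff)
          (integrable_form_path B hl W.1.contMDiff)]
        exact integral_congr_ae (Eventually.of_forall fun r => map_add _ (V.1 r) (W.1 r))
      change imag _ = imag _ + imag _
      rw [e, mul_add, imag_add]
  map_smul a V := by
    refine Prod.ext (Subtype.ext (DFunLike.ext _ _ fun r => ?_)) ?_
    · change (Ad I (g.1 r) (a • V.1 r) - a • V.1 r) -
          wp r • (Ad I (g.1 1) (a • V.1 1) - a • V.1 1) =
        a • ((Ad I (g.1 r) (V.1 r) - V.1 r) - wp r • (Ad I (g.1 1) (V.1 1) - V.1 1))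
      simp only [map_smul]
      module
    · have e : ∫ r, B.form (leftLog I g.1 r) ((a • V).1 r) =
          a * ∫ r, B.form (leftLog I g.1 r) (V.1 r) := by
        rw [← integral_const_mul]
        exact integral_congr_ae (Eventually.of_forall fun r => map_smul _ a (V.1 r))
      change imag _ = a • imag _
      rw [e, mul_left_comm, imag_smul]

/-- The path component telescopes; the central component is `g⁻¹ dg` of a product together with
`Ad`-invariance of the form. -/
theorem kappaHat_mul (B : InvariantForm I G) (wp : C^∞⟮𝓡∂ 1, unitInterval; 𝓘(ℝ, ℝ), ℝ⟯)
    (h0 : wp 0 = 0) (h1 : wp 1 = 1) (g₂ g₁ : PathGroup I G) (V : PathAlgebra E) :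
    kappaHat B wp h0 h1 (g₂ * g₁) V = actGroupAlg B g₂ (kappaHat B wp h0 h1 g₁ V) +
      kappaHat B wp h0 h1 g₂ (adPath g₁ V - tAlg (kappaHat B wp h0 h1 g₁ V)) := by
  have hk : ∀ r, (kappa wp h0 h1 g₁ V).1 r =
      (Ad I (g₁.1 r) (V.1 r) - V.1 r) - wp r • (Ad I (g₁.1 1) (V.1 1) - V.1 1) := fun _ => rfl
  refine Prod.ext (Subtype.ext (DFunLike.ext _ _ fun r => ?_)) ?_
  · change (Ad I (g₂.1 r * g₁.1 r) (V.1 r) - V.1 r) -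
        wp r • (Ad I (g₂.1 1 * g₁.1 1) (V.1 1) - V.1 1) =
      Ad I (g₂.1 r) ((kappa wp h0 h1 g₁ V).1 r) +
        ((Ad I (g₂.1 r) (Ad I (g₁.1 r) (V.1 r) - (kappa wp h0 h1 g₁ V).1 r) -
          (Ad I (g₁.1 r) (V.1 r) - (kappa wp h0 h1 g₁ V).1 r)) -
        wp r • (Ad I (g₂.1 1) (Ad I (g₁.1 1) (V.1 1) - (kappa wp h0 h1 g₁ V).1 1) -
          (Ad I (g₁.1 1) (V.1 1) - (kappa wp h0 h1 g₁ V).1 1)))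
    rw [(kappa wp h0 h1 g₁ V).2.2, hk, Ad_mul, Ad_mul]
    simp only [map_sub, map_smul, map_zero]
    module
  · have hl₁ := contMDiff_leftLog_path g₁.1.contMDiff
    have hl₂ := contMDiff_leftLog_path g₂.1.contMDiff
    have i1 := integrable_form_path B hl₁ V.1.contMDiff
    have i2 := integrable_form_path B (kappa wp h0 h1 g₁ V).1.contMDiff hl₂
    have i3 := integrable_form_path B hl₂
      (adPath g₁ V - tAlg (kappaHat B wp h0 h1 g₁ V)).1.contMDiff
    have e : ∫ r, B.form (leftLog I (g₂ * g₁).1 r) (V.1 r) =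
        (∫ r, B.form (leftLog I g₁.1 r) (V.1 r)) +
        (∫ r, B.form ((kappa wp h0 h1 g₁ V).1 r) (leftLog I g₂.1 r)) +
        ∫ r, B.form (leftLog I g₂.1 r)
          ((adPath g₁ V - tAlg (kappaHat B wp h0 h1 g₁ V)).1 r) := by
      refine Eq.trans ?_ ((integral_add (i1.add i2) i3).trans
        (congrArg₂ (· + ·) (integral_add i1 i2) rfl))
      refine integral_congr_ae (Eventually.of_forall fun r => ?_)
      have hm : leftLog I (g₂ * g₁).1 r = _ := leftLog_mul g₂.1.contMDiff g₁.1.contMDiff r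
      change B.form (leftLog I (g₂ * g₁).1 r) (V.1 r) = B.form (leftLog I g₁.1 r) (V.1 r) +
        B.form ((kappa wp h0 h1 g₁ V).1 r) (leftLog I g₂.1 r) + B.form (leftLog I g₂.1 r)
          (Ad I (g₁.1 r) (V.1 r) - (kappa wp h0 h1 g₁ V).1 r)
      rw [hm, map_add, add_apply, ← B.ad_invariant (g₁.1 r) (Ad I (g₁.1 r)⁻¹ _), Ad_inv_cancel,
        map_sub, B.symm ((kappa wp h0 h1 g₁ V).1 r)]
      ring
    change imag _ = imag _ + imag _ + imag _
    rw [e, mul_add, mul_add, imag_add, imag_add]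
    rfl

/-- Conjugating a path in the loop group by a path `g` that does not depend on the path parameter:
the sum of cocycles which gives the phase of `f (g ▷ f⁻¹)`. -/
theorem squareCocycle_conj_inv (B : InvariantForm I G) {f : unitInterval × unitInterval → G}
    (hf : ContMDiff ((𝓡∂ 1).prod (𝓡∂ 1)) I ∞ f) {g : unitInterval → G}
    (hg : ContMDiff (𝓡∂ 1) I ∞ g) :
    squareCocycle B (fun y => (f y)⁻¹) (fun y => (g y.2)⁻¹) +
      squareCocycle B f (fun y => g y.2 * (f y)⁻¹ * (g y.2)⁻¹) =
    squareCocycle B f (fun y => g y.2) +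
      squareCocycle B (fun y => f y * g y.2) (fun y => (f y)⁻¹) +
      squareCocycle B (fun y => f y * g y.2 * (f y)⁻¹) (fun y => (g y.2)⁻¹) := by
  have hg' : ContMDiff ((𝓡∂ 1).prod (𝓡∂ 1)) I ∞
      (fun y : unitInterval × unitInterval => g y.2) := hg.comp contMDiff_snd
  have e1 := squareCocycle_cocycle B hf (hg'.mul hf.inv) hg'.inv
  have e2 := squareCocycle_cocycle B hf hg' hf.inv
  have e3 : squareCocycle B (fun y => g y.2) (fun y => (f y)⁻¹) = 0 :=
    squareCocycle_eq_zero_of_left B fun _ _ => rfl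
  have e4 := squareCocycle_const_mul B g (fun y => (f y)⁻¹) (fun y => (g y.2)⁻¹)
  simp only [Pi.mul_apply, Pi.mul_def] at e1 e2
  simp only [mul_assoc] at *
  linarith

variable [FiniteDimensional ℝ E] [I.Boundaryless]

/-- The exterior derivative of the one-form `⟨f⁻¹ df, V⟩`, by the Maurer-Cartan equation. -/
theorem vel_form_leftLog_sub_vel_form_leftLog (B : InvariantForm I G)
    {f : unitInterval → unitInterval → G}
    (hf : ContMDiff ((𝓡∂ 1).prod (𝓡∂ 1)) I ∞ (Function.uncurry f)) {V : unitInterval → E}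
    (hV : ContMDiff (𝓡∂ 1) 𝓘(ℝ, E) ∞ V) (a b : unitInterval) :
    vel 𝓘(ℝ, ℝ) (fun s => B.form (leftLog I (fun r => f s r) b) (V b)) a -
      vel 𝓘(ℝ, ℝ) (fun r => B.form (leftLog I (fun s => f s r) a) (V r)) b =
    -(B.form (leftLog I (fun s => f s b) a) (vel 𝓘(ℝ, E) V b) +
      B.form (bracket I G (V b) (leftLog I (fun s => f s b) a))
        (leftLog I (fun r => f a r) b)) := by
  have mc := vel_leftLog_eq_vel_leftLog_add hf a b
  have v1 := (((hasVelAt_of_contMDiff (contMDiff_leftLog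
    (Φ := f) (τ := fun _ => b) hf contMDiff_const) a).clm (B.form.flip (V b)))).vel_eq
  have v2 := (HasVelAt.bilin B.form (hasVelAt_of_contMDiff (contMDiff_leftLog_fst hf a) b)
    (hasVelAt_of_contMDiff hV b)).vel_eq
  simp only [ContinuousLinearMap.flip_apply] at v1
  rw [v1, v2, mc, map_add, add_apply, B.form_bracket (V b),
    ← bracket_skew (leftLog I (fun s => f s b) a), map_neg, neg_apply, B.form_bracket,
    ← bracket_skew (V b), map_neg]
  ring

/-- Stokes' theorem for the one-form `⟨f⁻¹ df, V⟩` on the square, where `V` does not depend on `s`;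
the Maurer–Cartan equation computes its exterior derivative. -/
theorem integral_form_leftLog_eq (B : InvariantForm I G) {f : unitInterval × unitInterval → G}
    (hf : ContMDiff ((𝓡∂ 1).prod (𝓡∂ 1)) I ∞ f) (f0 : ∀ r, f (0, r) = 1)
    (l0 : ∀ s, f (s, 0) = 1) (l1 : ∀ s, f (s, 1) = 1) {V : unitInterval → E}
    (hV : ContMDiff (𝓡∂ 1) 𝓘(ℝ, E) ∞ V) :
    ∫ y : unitInterval × unitInterval,
      -(B.form (leftLog I (fun s => f (s, y.2)) y.1) (vel 𝓘(ℝ, E) V y.2) +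
        B.form (bracket I G (V y.2) (leftLog I (fun s => f (s, y.2)) y.1))
          (leftLog I (fun r => f (y.1, r)) y.2)) =
    ∫ r, B.form (leftLog I (fun r => f (1, r)) r) (V r) := by
  have hV2 : ContMDiff ((𝓡∂ 1).prod (𝓡∂ 1)) 𝓘(ℝ, E) ∞
      (fun y : unitInterval × unitInterval => V y.2) := hV.comp contMDiff_snd
  have hl : ContMDiff ((𝓡∂ 1).prod (𝓡∂ 1)) 𝓘(ℝ, E) ∞
      (fun y : unitInterval × unitInterval => leftLog I (fun r => f (y.1, r)) y.2) :=
    contMDiff_leftLog (Φ := fun (y : unitInterval × unitInterval) r => f (y.1, r))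
      (hf.comp ((contMDiff_fst.comp contMDiff_fst).prodMk contMDiff_snd)) contMDiff_snd
  have hg1 := contMDiff_form_apply B hl hV2
  have hg2 := contMDiff_form_apply B (contMDiff_leftLog_square hf) hV2
  have hc1 := contMDiff_vel_square_fst hg1
  have hc2 := contMDiff_vel_square_snd hg2
  have e := fun y : unitInterval × unitInterval =>
    vel_form_leftLog_sub_vel_form_leftLog B (f := fun s r => f (s, r)) hf hV y.1 y.2
  simp only [← e]
  refine (integral_sub (integrable_of_continuous hc1.continuous)
    (integrable_of_continuous hc2.continuous)).trans ?_
  have s1 : _ = ∫ r, B.form (leftLog I (fun r => f (1, r)) r) (V r) -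
    B.form (leftLog I (fun r => f (0, r)) r) (V r) := integral_vel_fst hg1
  have s2 : _ = ∫ s, B.form (leftLog I (fun s => f (s, 1)) s) (V 1) -
    B.form (leftLog I (fun s => f (s, 0)) s) (V 0) := integral_vel_snd hg2
  refine (congrArg₂ (· - ·) s1 s2).trans ?_
  simp only [f0, l0, l1, leftLog_const, map_zero, zero_apply, sub_zero, integral_zero]

end Adjustment

/-! ### The adjustment on the image of the central extension -/

section AdjustmentDerivative

variable {E : Type*} [NormedAddCommGroup E] [NormedSpace ℝ E]
  {H : Type*} [TopologicalSpace H] {I : ModelWithCorners ℝ E H}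
  {G : Type*} [TopologicalSpace G] [ChartedSpace H G] [Group G] [LieGroup I ∞ G]

theorem contMDiff_vel_path {V : unitInterval → E} (hV : ContMDiff (𝓡∂ 1) 𝓘(ℝ, E) ∞ V) :
    ContMDiff (𝓡∂ 1) 𝓘(ℝ, E) ∞ (vel 𝓘(ℝ, E) V) :=
  contMDiff_vel (N := unitInterval) (Ψ := fun _ => V) (τ := id) (hV.comp contMDiff_snd)
    contMDiff_id

theorem HasVelPath.smooth_square {c : ℝ → PathGroup I G} {V : PathAlgebra E}
    (h : HasVelPath c V) : ContMDiff (𝓘(ℝ, ℝ).prod ((𝓡∂ 1).prod (𝓡∂ 1))) I ∞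
      (fun y : ℝ × unitInterval × unitInterval => (c y.1).1 y.2.2) :=
  h.1.comp (contMDiff_fst.prodMk (contMDiff_snd.comp contMDiff_snd))

theorem HasVelPath.apply_zero {c : ℝ → PathGroup I G} {V : PathAlgebra E} (h : HasVelPath c V)
    (r : unitInterval) : (c 0).1 r = 1 := by
  rw [h.2.1]
  rfl

theorem HasVelPath.contMDiff_apply {c : ℝ → PathGroup I G} {V : PathAlgebra E}
    (h : HasVelPath c V) (r : unitInterval) : ContMDiff 𝓘(ℝ, ℝ) I ∞ (fun ε => (c ε).1 r) :=
  contMDiff_slice_curve (c := fun ε r => (c ε).1 r) h.1 r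

theorem HasVelPath.hasDerivAt_leftLog {c : ℝ → PathGroup I G} {V : PathAlgebra E}
    (h : HasVelPath c V) (r : unitInterval) :
    HasDerivAt (fun ε => leftLog I (c ε).1 r) (vel 𝓘(ℝ, E) V.1 r) 0 :=
  (hasDerivAt_of_contMDiff (J := 𝓡∂ 1) (Φ := fun ε r => leftLog I (c ε).1 r)
    h.leftLog_smooth 0 r).congr_deriv
    (deriv_leftLog_of_eq_one (f := fun ε r => (c ε).1 r) h.1 h.apply_zero V.1.contMDiff h.2.2 r)

theorem HasVelPath.hasDerivAt_rightLog {c : ℝ → PathGroup I G} {V : PathAlgebra E}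
    (h : HasVelPath c V) (r : unitInterval) :
    HasDerivAt (fun ε => rightLog I (c ε).1 r) (vel 𝓘(ℝ, E) V.1 r) 0 := by
  have hs : ContMDiff (𝓘(ℝ, ℝ).prod (𝓡∂ 1)) 𝓘(ℝ, E) ∞
      (fun x : ℝ × unitInterval => rightLog I (c x.1).1 x.2) :=
    contMDiff_rightLog (N := ℝ × unitInterval) (Φ := fun x r => (c x.1).1 r) (τ := fun x => x.2)
      (h.1.comp ((contMDiff_fst.comp contMDiff_fst).prodMk contMDiff_snd)) contMDiff_snd
  exact (hasDerivAt_of_contMDiff (J := 𝓡∂ 1) (Φ := fun ε r => rightLog I (c ε).1 r)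
    hs 0 r).congr_deriv
    (deriv_rightLog_of_eq_one (f := fun ε r => (c ε).1 r) h.1 h.apply_zero V.1.contMDiff h.2.2 r)

theorem hasDerivAt_squareCocycle_right (B : InvariantForm I G) (f : PathLoopGroup I G)
    {c : ℝ → PathGroup I G} {V : PathAlgebra E} (h : HasVelPath c V) :
    HasDerivAt (fun ε => squareCocycle B f.1 (fun y => (c ε).1 y.2))
      (-(1 / (2 * Real.pi)) * ∫ y : unitInterval × unitInterval,
        B.form (leftLog I (fun s => f.1 (s, y.2)) y.1) (vel 𝓘(ℝ, E) V.1 y.2)) 0 := by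
  have hd := hasDerivAt_integral (J := (𝓡∂ 1).prod (𝓡∂ 1)) (μ := volume)
    (Φ := fun ε (y : unitInterval × unitInterval) =>
      B.form (leftLog I (fun s => f.1 (s, y.2)) y.1) (rightLog I (fun r => (c ε).1 r) y.2))
    (contMDiff_form_apply B ((contMDiff_leftLog_square f.1.contMDiff).comp contMDiff_snd)
      (contMDiff_rightLog_family (f := fun ε y => (c ε).1 y.2) h.smooth_square)) 0
  refine (hd.congr_deriv ?_).const_mul _
  refine integral_congr_ae (Eventually.of_forall fun y => ?_)
  exact ((B.form _).hasFDerivAt.comp_hasDerivAt 0 (h.hasDerivAt_rightLog y.2)).deriv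

variable [FiniteDimensional ℝ E] [I.Boundaryless]

/-- As `c_ε` does not depend on `s`, it enters `(f c_ε)⁻¹ ∂ₛ(f c_ε)` through `Ad c_ε⁻¹` only, whose
derivative is a bracket. -/
theorem hasDerivAt_squareCocycle_mul_inv (B : InvariantForm I G) (f : PathLoopGroup I G)
    {c : ℝ → PathGroup I G} {V : PathAlgebra E} (h : HasVelPath c V) :
    HasDerivAt (fun ε => squareCocycle B (fun y => f.1 y * (c ε).1 y.2) (fun y => (f.1 y)⁻¹))
      (-(1 / (2 * Real.pi)) * ∫ y : unitInterval × unitInterval,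
        B.form (bracket I G (V.1 y.2) (leftLog I (fun s => f.1 (s, y.2)) y.1))
          (leftLog I (fun r => f.1 (y.1, r)) y.2)) 0 := by
  have hf2 : ContMDiff (𝓘(ℝ, ℝ).prod ((𝓡∂ 1).prod (𝓡∂ 1))) I ∞
      (fun y : ℝ × unitInterval × unitInterval => f.1 y.2) := f.1.contMDiff.comp contMDiff_snd
  have hd := hasDerivAt_integral (J := (𝓡∂ 1).prod (𝓡∂ 1)) (μ := volume)
    (Φ := fun ε (y : unitInterval × unitInterval) =>
      B.form (leftLog I (fun s => f.1 (s, y.2) * (c ε).1 y.2) y.1)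
        (rightLog I (fun r => (f.1 (y.1, r))⁻¹) y.2))
    (contMDiff_form_apply B
      (contMDiff_leftLog_family (f := fun ε y => f.1 y * (c ε).1 y.2) (hf2.mul h.smooth_square))
      (contMDiff_rightLog_family (f := fun _ y => (f.1 y)⁻¹) hf2.inv)) 0
  refine (hd.congr_deriv ?_).const_mul _
  refine integral_congr_ae (Eventually.of_forall fun y => ?_)
  have hf1 : ContMDiff (𝓡∂ 1) I ∞ (fun s => f.1 (s, y.2)) :=
    f.1.contMDiff.comp (contMDiff_id.prodMk contMDiff_const)
  have hf2 : ContMDiff (𝓡∂ 1) I ∞ (fun r => f.1 (y.1, r)) :=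
    f.1.contMDiff.comp (contMDiff_const.prodMk contMDiff_id)
  have e1 : ∀ ε, leftLog I (fun s => f.1 (s, y.2) * (c ε).1 y.2) y.1 =
      Ad I ((c ε).1 y.2)⁻¹ (leftLog I (fun s => f.1 (s, y.2)) y.1) := by
    intro ε
    rw [leftLog_mul hf1 contMDiff_const, leftLog_const, add_zero]
  have hA := deriv_Ad_apply_of_eq_one (h.contMDiff_apply y.2).inv
    (contDiff_const (c := leftLog I (fun s => f.1 (s, y.2)) y.1)) (by
      simp only [h.apply_zero, inv_one])
  rw [velZero_inv_of_eq_one (h.contMDiff_apply y.2) (h.apply_zero y.2), ← h.2.2, deriv_const,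
    add_zero, bracket_neg_left] at hA
  simp only [e1, rightLog_inv hf2, map_neg]
  have hB := ((B.form.flip (leftLog I (fun r => f.1 (y.1, r)) y.2)).hasFDerivAt.comp_hasDerivAt 0
    hA).neg.deriv
  refine Eq.trans hB ?_
  rw [map_neg, neg_neg]
  rfl

/-- The curve `h (c ▷ h⁻¹)` and its velocity, for `h = [(f, z)]`. By `squareCocycle_conj_inv` its
phase is, up to a constant, a sum of three cocycles; the last vanishes to second order, and
the derivatives of the other two add up to a boundary integral by `integral_form_leftLog_eq`. -/
theorem hasVelExt_mul_act_inv (B : InvariantForm I G)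
    (wp : C^∞⟮𝓡∂ 1, unitInterval; 𝓘(ℝ, ℝ), ℝ⟯) (h0 : wp 0 = 0) (h1 : wp 1 = 1) (x : ExtPath B)
    {c : ℝ → PathGroup I G} {V : PathAlgebra E} (h : HasVelPath c V) :
    HasVelExt B (fun ε => cls B x * (stringTwoGroup B).act (c ε) (cls B x)⁻¹)
      (kappaHat B wp h0 h1 (endpoint x.path) V) := by
  have hf2 : ContMDiff (𝓘(ℝ, ℝ).prod ((𝓡∂ 1).prod (𝓡∂ 1))) I ∞
      (fun y : ℝ × unitInterval × unitInterval => x.path.1 y.2) :=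
    x.path.1.contMDiff.comp contMDiff_snd
  have hc := h.smooth_square
  have hV2 : ContMDiff ((𝓡∂ 1).prod (𝓡∂ 1)) 𝓘(ℝ, E) ∞
      (fun y : unitInterval × unitInterval => V.1 y.2) := V.1.contMDiff.comp contMDiff_snd
  have hβ := contMDiff_leftLog_square x.path.1.contMDiff
  have hl : ContMDiff ((𝓡∂ 1).prod (𝓡∂ 1)) 𝓘(ℝ, E) ∞
      (fun y : unitInterval × unitInterval => leftLog I (fun r => x.path.1 (y.1, r)) y.2) :=
    contMDiff_leftLog (Φ := fun (y : unitInterval × unitInterval) r => x.path.1 (y.1, r))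
      (x.path.1.contMDiff.comp ((contMDiff_fst.comp contMDiff_fst).prodMk contMDiff_snd))
      contMDiff_snd
  have : IsManifold I 1 G := isManifold_one
  have i1 := integrable_form_apply B hβ (W := fun y => vel 𝓘(ℝ, E) V.1 y.2)
    ((contMDiff_vel_path V.1.contMDiff).comp contMDiff_snd)
  have i2 := integrable_form_apply B (contMDiff_bracket (I := I) (G := G) hV2 hβ) hl
  have k1 : ContMDiff (𝓘(ℝ, ℝ).prod ((𝓡∂ 1).prod (𝓡∂ 1))) I ∞
      (fun y : ℝ × unitInterval × unitInterval => x.path.1 y.2 * (c y.1).1 y.2.2) := hf2.mul hc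
  have k2 : ContMDiff (𝓘(ℝ, ℝ).prod ((𝓡∂ 1).prod (𝓡∂ 1))) I ∞
      (fun y : ℝ × unitInterval × unitInterval =>
        x.path.1 y.2 * (c y.1).1 y.2.2 * (x.path.1 y.2)⁻¹) := k1.mul hf2.inv
  have k3 : ContMDiff (𝓘(ℝ, ℝ).prod ((𝓡∂ 1).prod (𝓡∂ 1))) I ∞
      (fun y : ℝ × unitInterval × unitInterval =>
        (c y.1).1 y.2.2 * (x.path.1 y.2)⁻¹ * ((c y.1).1 y.2.2)⁻¹) := (hc.mul hf2.inv).mul hc.inv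
  have hL := (((contDiff_squareCocycle B (f₁ := fun _ => x.path.1) (f₂ := fun ε y => (c ε).1 y.2)
    hf2 hc).add (contDiff_squareCocycle B (f₁ := fun ε y => x.path.1 y * (c ε).1 y.2)
      (f₂ := fun _ y => (x.path.1 y)⁻¹) k1 hf2.inv)).add
    (contDiff_squareCocycle B (f₁ := fun ε y => x.path.1 y * (c ε).1 y.2 * (x.path.1 y)⁻¹)
      (f₂ := fun ε y => ((c ε).1 y.2)⁻¹) k2 hc.inv)).sub
    (contDiff_const (c := squareCocycle B x.path.1 (fun y => (x.path.1 y)⁻¹)))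
  have hL' := (((hasDerivAt_squareCocycle_right B x.path h).add
    (hasDerivAt_squareCocycle_mul_inv B x.path h)).add
    (hasDerivAt_squareCocycle_zero B
      (f₁ := fun ε y => x.path.1 y * (c ε).1 y.2 * (x.path.1 y)⁻¹)
      (f₂ := fun ε y => ((c ε).1 y.2)⁻¹) k2 hc.inv
      (by simp [h.apply_zero]) (by simp [h.apply_zero]))).sub_const
    (squareCocycle B x.path.1 (fun y => (x.path.1 y)⁻¹))
  rw [add_zero, ← mul_add, ← integral_add i1 i2, neg_mul, ← mul_neg, ← integral_neg,
    integral_form_leftLog_eq B x.path.1.contMDiff x.path.2.1 (fun s => (x.path.2.2 s).1)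
      (fun s => (x.path.2.2 s).2) V.1.contMDiff] at hL'
  refine hasVelExt_of_lift (x := fun ε => x * actExt B (c ε) x⁻¹) (z := fun _ => 1)
    (hf2.mul k3) ?_ contDiff_const rfl hL ?_ hL' ?_ ?_ ?_ ?_
  · rw [h.2.1, actExt_one, mul_inv_cancel]
    rfl
  · have e1 : squareCocycle B x.path.1 (fun y => (c 0).1 y.2) = 0 :=
      squareCocycle_eq_zero_of_right B (by simp [h.apply_zero])
    have e2 : squareCocycle B (fun y => x.path.1 y * (c 0).1 y.2 * (x.path.1 y)⁻¹)
        (fun y => ((c 0).1 y.2)⁻¹) = 0 :=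
      squareCocycle_eq_zero_of_right B (by simp [h.apply_zero])
    rw [e1, e2]
    simp only [h.apply_zero, mul_one]
    ring
  · intro ε
    rw [← squareCocycle_conj_inv B x.path.1.contMDiff (c ε).1.contMDiff, ExtPath.mul_phase,
      actExt_phase, ExtPath.inv_phase]
    change _ * (_ * Circle.exp (squareCocycle B (fun y => (x.path.1 y)⁻¹) _)) *
      Circle.exp (squareCocycle B x.path.1
        (fun y => (c ε).1 y.2 * (x.path.1 y)⁻¹ * ((c ε).1 y.2)⁻¹)) = _
    refine Circle.ext ?_
    simp only [Circle.exp_add, Circle.exp_sub, Circle.coe_mul, Circle.coe_div, Circle.coe_inv]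
    field_simp
    exact Circle.coe_one
  · exact fun ε => rfl
  · intro r
    have hcr := h.contMDiff_apply r
    have hk := (contMDiff_mul_mul_inv (I := I) (x.path.1 (1, r))).comp hcr
    have hv := velZero_mul_of_eq_one (hk.mdifferentiableAt (by simp))
      (hcr.inv.mdifferentiableAt (by simp)) (by simp [h.apply_zero]) (by simp [h.apply_zero])
    rw [velZero_inv_of_eq_one hcr (h.apply_zero r), ← h.2.2 r] at hv
    have hw := velZero_conj_of_eq_one (x.path.1 (1, r)) (hcr.mdifferentiableAt (by simp))
      (h.apply_zero r)
    rw [← h.2.2 r] at hw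
    -- the correction by `℘` vanishes, as `t(h)` is a loop
    have e1 : x.path.1 (1, 1) = 1 := (x.path.2.2 1).2
    have e2 : (kappa wp h0 h1 (endpoint x.path) V).1 r = Ad I (x.path.1 (1, r)) (V.1 r) +
        -V.1 r := by
      change (Ad I (x.path.1 (1, r)) (V.1 r) - V.1 r) -
        wp r • (Ad I (x.path.1 (1, 1)) (V.1 1) - V.1 1) = _
      rw [e1, Ad_one, sub_self, smul_zero, sub_zero, sub_eq_add_neg]
    refine Eq.trans e2 (Eq.trans ?_ (Eq.trans hv.symm ?_))
    · exact congrArg (· + -V.1 r) hw.symm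
    · refine congrArg (velZero I) (funext fun ε => ?_)
      change x.path.1 (1, r) * (c ε).1 r * (x.path.1 (1, r))⁻¹ * ((c ε).1 r)⁻¹ =
        x.path.1 (1, r) * ((c ε).1 r * (x.path.1 (1, r))⁻¹ * ((c ε).1 r)⁻¹)
      group
  · rw [deriv_const, zero_add, ← coe_imag]
    rfl

theorem isAdjustment_kappaHat (B : InvariantForm I G)
    (wp : C^∞⟮𝓡∂ 1, unitInterval; 𝓘(ℝ, ℝ), ℝ⟯) (h0 : wp 0 = 0) (h1 : wp 1 = 1) :
    IsAdjustment (stringTwoGroup B) (HasVelExt B) HasVelPath adPath tAlg (actGroupAlg B)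
      (kappaHat B wp h0 h1) where
  linear := linear_kappaHat B wp h0 h1
  on_image h V c hc := by
    obtain ⟨x, rfl⟩ := cls_surjective B h
    exact hasVelExt_mul_act_inv B wp h0 h1 x hc
  on_mul := kappaHat_mul B wp h0 h1

end AdjustmentDerivative

/-! ### Linearisation of the adjustment -/

section Limits

variable {E : Type*} [NormedAddCommGroup E] [NormedSpace ℝ E]
  {H : Type*} [TopologicalSpace H] {I : ModelWithCorners ℝ E H}
  {G : Type*} [TopologicalSpace G] [ChartedSpace H G] [Group G] [LieGroup I ∞ G]

theorem tendsto_smul_imag {a : ℝ → ℝ} {a' : ℝ} (h : HasDerivAt a a' 0) (h0 : a 0 = 0) :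
    Tendsto (fun ε => ε⁻¹ • imag (a ε)) (𝓝[≠] 0) (𝓝 (imag a')) := by
  have hc : Continuous imag :=
    Continuous.subtype_mk (Complex.continuous_ofReal.mul continuous_const) _
  have h1 := h.tendsto_slope_zero
  simp only [zero_add, h0, sub_zero, smul_eq_mul] at h1
  refine ((hc.tendsto a').comp h1).congr fun ε => ?_
  exact imag_smul _ _

theorem HasVelPath.hasDerivAt_integral_form_leftLog (B : InvariantForm I G)
    {c : ℝ → PathGroup I G} {V : PathAlgebra E} (h : HasVelPath c V) {X : unitInterval → E}
    (hX : ContMDiff (𝓡∂ 1) 𝓘(ℝ, E) ∞ X) :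
    HasDerivAt (fun ε => 1 / (2 * Real.pi) * ∫ r, B.form (leftLog I (c ε).1 r) (X r))
      (1 / (2 * Real.pi) * ∫ r, B.form (vel 𝓘(ℝ, E) V.1 r) (X r)) 0 := by
  have hd := hasDerivAt_integral (J := 𝓡∂ 1) (μ := volume)
    (Φ := fun ε (r : unitInterval) => B.form (leftLog I (c ε).1 r) (X r))
    (contMDiff_form_apply B h.leftLog_smooth (hX.comp contMDiff_snd)) 0
  refine (hd.congr_deriv ?_).const_mul _
  refine integral_congr_ae (Eventually.of_forall fun r => ?_)
  exact ((B.form.flip (X r)).hasFDerivAt.comp_hasDerivAt 0 (h.hasDerivAt_leftLog r)).deriv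

theorem HasVelPath.integral_form_leftLog_zero (B : InvariantForm I G)
    {c : ℝ → PathGroup I G} {V : PathAlgebra E} (h : HasVelPath c V) (X : unitInterval → E) :
    1 / (2 * Real.pi) * ∫ r, B.form (leftLog I (c 0).1 r) (X r) = 0 := by
  have e : ∀ r, leftLog I (c 0).1 r = 0 := by
    intro r
    rw [h.2.1]
    exact leftLog_const 1 r
  simp only [e, map_zero, zero_apply, integral_zero, mul_zero]

variable [I.Boundaryless]

theorem HasVelPath.hasDerivAt_Ad_sub {c : ℝ → PathGroup I G} {V : PathAlgebra E}
    (h : HasVelPath c V) (X : E) (r : unitInterval) :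
    HasDerivAt (fun ε => Ad I ((c ε).1 r) X - X) (bracket I G (V.1 r) X) 0 := by
  have h1 := deriv_Ad_apply_of_eq_one (h.contMDiff_apply r) (contDiff_const (c := X))
    (h.apply_zero r)
  rw [deriv_const, add_zero, ← h.2.2] at h1
  exact h1.sub_const X

theorem HasVelPath.smoothTendsto_Ad_sub {c : ℝ → PathGroup I G} {V : PathAlgebra E}
    (h : HasVelPath c V) {X : unitInterval → E} (hX : ContMDiff (𝓡∂ 1) 𝓘(ℝ, E) ∞ X) :
    SmoothTendsto (𝓝[≠] (0 : ℝ)) (fun ε => ε⁻¹ • fun r => Ad I ((c ε).1 r) (X r) - X r)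
      (fun r => bracket I G (V.1 r) (X r)) := by
  have : IsManifold I 1 G := isManifold_one
  have hX2 : ContMDiff (𝓘(ℝ, ℝ).prod (𝓡∂ 1)) 𝓘(ℝ, E) ∞ (fun y : ℝ × unitInterval => X y.2) :=
    hX.comp contMDiff_snd
  exact smoothTendsto_slope ((contMDiff_Ad_apply h.1 hX2).sub hX2)
    (fun r => by rw [h.apply_zero, Ad_one, sub_self]) fun r => h.hasDerivAt_Ad_sub (X r) r

variable [FiniteDimensional ℝ E]

theorem tendstoPath_adPath {c : ℝ → PathGroup I G} {V₁ : PathAlgebra E} (h : HasVelPath c V₁)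
    (V₂ : PathAlgebra E) : TendstoPath (𝓝[≠] (0 : ℝ)) (fun ε => ε⁻¹ • (adPath (c ε) V₂ - V₂))
      (pathBracket I G V₁ V₂) :=
  h.smoothTendsto_Ad_sub V₂.1.contMDiff

theorem tendstoExt_actGroupAlg (B : InvariantForm I G) {c : ℝ → PathGroup I G}
    {V : PathAlgebra E} (h : HasVelPath c V) (W : LoopExtAlgebra E) :
    TendstoExt (𝓝[≠] (0 : ℝ)) (fun ε => ε⁻¹ • (actGroupAlg B (c ε) W - W)) (actAlg B V W) := by
  refine ⟨h.smoothTendsto_Ad_sub W.1.1.contMDiff, ?_⟩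
  refine (tendsto_smul_imag (h.hasDerivAt_integral_form_leftLog B W.1.1.contMDiff)
    (h.integral_form_leftLog_zero B _)).congr fun ε => ?_
  change _ = ε⁻¹ • (W.2 + imag _ - W.2)
  rw [add_sub_cancel_left]
  simp only [B.symm (leftLog I _ _)]

theorem tendstoExt_kappaHat (B : InvariantForm I G)
    (wp : C^∞⟮𝓡∂ 1, unitInterval; 𝓘(ℝ, ℝ), ℝ⟯) (h0 : wp 0 = 0) (h1 : wp 1 = 1)
    {c : ℝ → PathGroup I G} {V₁ : PathAlgebra E} (h : HasVelPath c V₁) (V₂ : PathAlgebra E) :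
    TendstoExt (𝓝[≠] (0 : ℝ)) (fun ε => ε⁻¹ • kappaHat B wp h0 h1 (c ε) V₂)
      (kappaHatAlg B wp h0 h1 V₁ V₂) := by
  have : IsManifold I 1 G := isManifold_one
  have hV : ContMDiff (𝓘(ℝ, ℝ).prod (𝓡∂ 1)) 𝓘(ℝ, E) ∞ (fun y : ℝ × unitInterval => V₂.1 y.2) :=
    V₂.1.contMDiff.comp contMDiff_snd
  have hc : ContMDiff (𝓘(ℝ, ℝ).prod (𝓡∂ 1)) I ∞ (fun y : ℝ × unitInterval => (c y.1).1 1) :=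
    h.1.comp (contMDiff_fst.prodMk contMDiff_const)
  refine ⟨smoothTendsto_slope
    (Ψ := fun ε r => (Ad I ((c ε).1 r) (V₂.1 r) - V₂.1 r) -
      wp r • (Ad I ((c ε).1 1) (V₂.1 1) - V₂.1 1))
    (((contMDiff_Ad_apply h.1 hV).sub hV).sub ((wp.contMDiff.comp contMDiff_snd).smul
      ((contMDiff_Ad_apply hc contMDiff_const).sub contMDiff_const))) (fun r => ?_) fun r => ?_,
    tendsto_smul_imag (h.hasDerivAt_integral_form_leftLog B V₂.1.contMDiff)
      (h.integral_form_leftLog_zero B _)⟩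
  · rw [h.apply_zero, h.apply_zero, Ad_one, Ad_one, sub_self, sub_self, smul_zero, sub_zero]
  · exact (h.hasDerivAt_Ad_sub (V₂.1 r) r).sub ((h.hasDerivAt_Ad_sub (V₂.1 1) 1).const_smul (wp r))

end Limits

/-! ### The crossed module of Lie algebras -/

section LieAlgebra

variable {E : Type*} [NormedAddCommGroup E] [NormedSpace ℝ E]
  {H : Type*} [TopologicalSpace H] {I : ModelWithCorners ℝ E H}
  {G : Type*} [TopologicalSpace G] [ChartedSpace H G] [Group G]

/-- The bilinear form `(1/2π) ∫ ⟨∂V/∂r, W⟩ dr`. -/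
noncomputable def velPairing (B : InvariantForm I G) :
    C^∞⟮𝓡∂ 1, unitInterval; 𝓘(ℝ, E), E⟯ →ₗ[ℝ] C^∞⟮𝓡∂ 1, unitInterval; 𝓘(ℝ, E), E⟯ →ₗ[ℝ] ℝ :=
  LinearMap.mk₂ ℝ (fun V W => 1 / (2 * Real.pi) * ∫ r, B.form (vel 𝓘(ℝ, E) V r) (W r))
    (fun V₁ V₂ W => by
      rw [← mul_add, ← integral_add
        (integrable_form_path B (contMDiff_vel_path V₁.contMDiff) W.contMDiff)
        (integrable_form_path B (contMDiff_vel_path V₂.contMDiff) W.contMDiff)]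
      refine congrArg _ (integral_congr_ae (Eventually.of_forall fun r => ?_))
      have e : vel 𝓘(ℝ, E) (V₁ + V₂) r = vel 𝓘(ℝ, E) V₁ r + vel 𝓘(ℝ, E) V₂ r :=
        ((hasVelAt_of_contMDiff V₁.contMDiff r).add
          (hasVelAt_of_contMDiff V₂.contMDiff r)).vel_eq
      change B.form (vel 𝓘(ℝ, E) ⇑(V₁ + V₂) r) (W r) = _
      rw [e, map_add, add_apply])
    (fun a V W => by
      rw [smul_eq_mul, mul_left_comm, ← integral_const_mul a]
      refine congrArg _ (integral_congr_ae (Eventually.of_forall fun r => ?_))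
      have e : vel 𝓘(ℝ, E) (a • V) r = a • vel 𝓘(ℝ, E) V r :=
        ((hasVelAt_of_contMDiff V.contMDiff r).clm (a • ContinuousLinearMap.id ℝ E)).vel_eq
      change B.form (vel 𝓘(ℝ, E) ⇑(a • V) r) (W r) = _
      rw [e, map_smul, smul_apply, smul_eq_mul])
    (fun V W₁ W₂ => by
      rw [← mul_add, ← integral_add
        (integrable_form_path B (contMDiff_vel_path V.contMDiff) W₁.contMDiff)
        (integrable_form_path B (contMDiff_vel_path V.contMDiff) W₂.contMDiff)]
      exact congrArg _ (integral_congr_ae (Eventually.of_forall fun r => map_add _ (W₁ r) (W₂ r))))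
    (fun a V W => by
      rw [smul_eq_mul, mul_left_comm, ← integral_const_mul a]
      exact congrArg _ (integral_congr_ae (Eventually.of_forall fun r => map_smul _ a (W r))))

theorem velPairing_apply (B : InvariantForm I G) (V W : C^∞⟮𝓡∂ 1, unitInterval; 𝓘(ℝ, E), E⟯) :
    velPairing B V W = 1 / (2 * Real.pi) * ∫ r, B.form (vel 𝓘(ℝ, E) V r) (W r) := rfl

/-- Integration by parts. -/
theorem velPairing_comm (B : InvariantForm I G) {V W : C^∞⟮𝓡∂ 1, unitInterval; 𝓘(ℝ, E), E⟯}
    (h0 : W 0 = 0) (h1 : W 1 = 0) : velPairing B V W = -velPairing B W V := by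
  have hi := integral_vel (contMDiff_form_apply B V.contMDiff W.contMDiff)
  have e : ∀ r, vel 𝓘(ℝ, ℝ) (fun r => B.form (V r) (W r)) r =
      B.form (vel 𝓘(ℝ, E) V r) (W r) + B.form (vel 𝓘(ℝ, E) W r) (V r) := by
    intro r
    rw [(HasVelAt.bilin B.form (hasVelAt_of_contMDiff V.contMDiff r)
      (hasVelAt_of_contMDiff W.contMDiff r)).vel_eq, B.symm (V r)]
  simp only [e, h0, h1, map_zero, sub_zero] at hi
  rw [integral_add (integrable_form_path B (contMDiff_vel_path V.contMDiff) W.contMDiff)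
    (integrable_form_path B (contMDiff_vel_path W.contMDiff) V.contMDiff)] at hi
  rw [velPairing_apply, velPairing_apply, eq_neg_of_add_eq_zero_left hi, mul_neg]

variable [LieGroup I ∞ G] [FiniteDimensional ℝ E]

theorem isLieBracket_pathBracket : IsLieBracket (pathBracket (E := E) I G) where
  bilinear := ⟨fun _ => ⟨fun _ _ => Subtype.ext (DFunLike.ext _ _ fun _ => bracket_add_right _ _ _),
      fun _ _ => Subtype.ext (DFunLike.ext _ _ fun _ => bracket_smul_right _ _ _)⟩,
    fun _ => ⟨fun _ _ => Subtype.ext (DFunLike.ext _ _ fun _ => bracket_add_left _ _ _),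
      fun _ _ => Subtype.ext (DFunLike.ext _ _ fun _ => bracket_smul_left _ _ _)⟩⟩
  alternating _ := Subtype.ext (DFunLike.ext _ _ fun _ => bracket_self _)
  jacobi _ _ _ := Subtype.ext (DFunLike.ext _ _ fun _ => bracket_jacobi _ _ _)

theorem bilinear_actAlg (B : InvariantForm I G) : IsBilinear (actAlg B) := by
  refine ⟨fun V => ⟨fun W₁ W₂ => Prod.ext
    (Subtype.ext (DFunLike.ext _ _ fun _ => bracket_add_right _ _ _)) ?_, fun a W => Prod.ext
    (Subtype.ext (DFunLike.ext _ _ fun _ => bracket_smul_right _ _ _)) ?_⟩,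
    fun W => ⟨fun V₁ V₂ => Prod.ext
    (Subtype.ext (DFunLike.ext _ _ fun _ => bracket_add_left _ _ _)) ?_, fun a V => Prod.ext
    (Subtype.ext (DFunLike.ext _ _ fun _ => bracket_smul_left _ _ _)) ?_⟩⟩
  · exact (congrArg imag (map_add (velPairing B V.1) W₁.1.1 W₂.1.1)).trans (imag_add _ _)
  · exact (congrArg imag (map_smul (velPairing B V.1) a W.1.1)).trans (imag_smul _ _)
  · exact (congrArg imag ((velPairing B).map_add₂ V₁.1 V₂.1 W.1.1)).trans (imag_add _ _)
  · exact (congrArg imag ((velPairing B).map_smul₂ a V.1 W.1.1)).trans (imag_smul _ _)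

theorem imag_neg (x : ℝ) : imag (-x) = -imag x := by
  have h := imag_add (-x) x
  rw [neg_add_cancel, imag_zero] at h
  exact eq_neg_of_add_eq_zero_left h.symm

theorem imag_sub (x y : ℝ) : imag (x - y) = imag x - imag y := by
  rw [sub_eq_add_neg, imag_add, imag_neg, ← sub_eq_add_neg]

/-- By integration by parts, the bracket of the central extension is the action of the image
of `t`. -/
theorem bracketExt_eq_actAlg (B : InvariantForm I G) (W₁ W₂ : LoopExtAlgebra E) :
    bracketExt B W₁ W₂ = actAlg B (tAlg W₁) W₂ := by
  have e : velPairing B W₁.1.1 W₂.1.1 = -(1 / (2 * Real.pi)) *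
      ∫ r, B.form (W₁.1.1 r) (vel 𝓘(ℝ, E) W₂.1.1 r) := by
    rw [velPairing_comm B W₂.1.2.1 W₂.1.2.2, velPairing_apply]
    simp only [B.symm (W₁.1.1 _)]
    ring
  exact Prod.ext rfl (congrArg imag e.symm)

variable [I.Boundaryless]

/-- The cocycle property of the pairing, a pointwise consequence of the Leibniz rule for the bracket
and of the invariance of the form. -/
theorem velPairing_pathBracket (B : InvariantForm I G) (V₁ V₂ V₃ : PathAlgebra E) :
    velPairing B (pathBracket I G V₁ V₂).1 V₃.1 = velPairing B V₁.1 (pathBracket I G V₂ V₃).1 -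
      velPairing B V₂.1 (pathBracket I G V₁ V₃).1 := by
  rw [velPairing_apply, velPairing_apply, velPairing_apply, ← mul_sub, ← integral_sub
    (integrable_form_path B (contMDiff_vel_path V₁.1.contMDiff) (ContMDiffMap.contMDiff _))
    (integrable_form_path B (contMDiff_vel_path V₂.1.contMDiff) (ContMDiffMap.contMDiff _))]
  refine congrArg _ (integral_congr_ae (Eventually.of_forall fun r => ?_))
  have e : vel 𝓘(ℝ, E) (pathBracket I G V₁ V₂).1 r = bracket I G (vel 𝓘(ℝ, E) V₁.1 r) (V₂.1 r) +
      bracket I G (V₁.1 r) (vel 𝓘(ℝ, E) V₂.1 r) :=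
    ((hasVelAt_of_contMDiff V₁.1.contMDiff r).bracket
      (hasVelAt_of_contMDiff V₂.1.contMDiff r)).vel_eq
  change B.form (vel 𝓘(ℝ, E) (pathBracket I G V₁ V₂).1 r) (V₃.1 r) =
    B.form (vel 𝓘(ℝ, E) V₁.1 r) (bracket I G (V₂.1 r) (V₃.1 r)) -
      B.form (vel 𝓘(ℝ, E) V₂.1 r) (bracket I G (V₁.1 r) (V₃.1 r))
  rw [e, map_add, add_apply, B.form_bracket (V₁.1 r), ← bracket_skew (vel 𝓘(ℝ, E) V₁.1 r), map_neg,
    neg_apply, B.form_bracket, neg_neg, sub_eq_add_neg]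

theorem actAlg_pathBracket (B : InvariantForm I G) (V₁ V₂ : PathAlgebra E)
    (W : LoopExtAlgebra E) : actAlg B (pathBracket I G V₁ V₂) W =
      actAlg B V₁ (actAlg B V₂ W) - actAlg B V₂ (actAlg B V₁ W) := by
  refine Prod.ext (Subtype.ext (DFunLike.ext _ _ fun r => ?_)) ?_
  · exact eq_sub_of_add_eq (bracket_jacobi _ _ _).symm
  · have e := velPairing_pathBracket B V₁ V₂ (loopIncl W.1)
    refine (congrArg imag e).trans ?_
    rw [imag_sub]
    rfl

/-- Elements of `P₀𝔤` act by derivations, by `bracketExt_eq_actAlg`. -/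
theorem actAlg_tAlg_actAlg (B : InvariantForm I G) (V : PathAlgebra E) (W₁ W₂ : LoopExtAlgebra E) :
    actAlg B V (actAlg B (tAlg W₁) W₂) =
      actAlg B (tAlg (actAlg B V W₁)) W₂ + actAlg B (tAlg W₁) (actAlg B V W₂) :=
  (sub_eq_iff_eq_add.1 (actAlg_pathBracket B V (tAlg W₁) W₂).symm)

theorem isLieBracket_bracketExt (B : InvariantForm I G) : IsLieBracket (bracketExt B) where
  bilinear := by
    obtain ⟨h1, h2⟩ := bilinear_actAlg B
    simp only [IsBilinear, funext fun W => funext (bracketExt_eq_actAlg B W)]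
    exact ⟨fun W => h1 _, fun W => ⟨fun W₁ W₂ => (h2 W).map_add (tAlg W₁) (tAlg W₂),
      fun a W₁ => (h2 W).map_smul a (tAlg W₁)⟩⟩
  alternating W := by
    rw [bracketExt_eq_actAlg]
    have e : velPairing B W.1.1 W.1.1 = 0 := by
      linarith [velPairing_comm B (V := W.1.1) W.1.2.1 W.1.2.2]
    refine Prod.ext (Subtype.ext (DFunLike.ext _ _ fun _ => bracket_self _)) ?_
    exact (congrArg imag e).trans imag_zero
  jacobi W₁ W₂ W₃ := by
    simp only [bracketExt_eq_actAlg]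
    exact actAlg_tAlg_actAlg B _ _ _

theorem isLieCrossedModule (B : InvariantForm I G) :
    IsLieCrossedModule (bracketExt B) (pathBracket I G) tAlg (actAlg B) where
  lie_H := isLieBracket_bracketExt B
  lie_G := isLieBracket_pathBracket
  linear_t := linear_tAlg
  bilinear_act := bilinear_actAlg B
  t_bracket _ _ := rfl
  bracket_act := actAlg_pathBracket B
  act_bracket V W₁ W₂ := by
    simp only [bracketExt_eq_actAlg]
    exact actAlg_tAlg_actAlg B _ _ _
  t_act _ _ := rfl
  peiffer _ _ := (bracketExt_eq_actAlg B _ _).symm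

theorem isLieAdjustment_kappaHatAlg (B : InvariantForm I G)
    (wp : C^∞⟮𝓡∂ 1, unitInterval; 𝓘(ℝ, ℝ), ℝ⟯) (h0 : wp 0 = 0) (h1 : wp 1 = 1) :
    IsLieAdjustment (pathBracket I G) tAlg (actAlg B) (kappaHatAlg B wp h0 h1) where
  bilinear := by
    refine ⟨fun V => ⟨fun W₁ W₂ => Prod.ext (Subtype.ext (DFunLike.ext _ _ fun r => ?_)) ?_,
      fun a W => Prod.ext (Subtype.ext (DFunLike.ext _ _ fun r => ?_)) ?_⟩,
      fun W => ⟨fun V₁ V₂ => Prod.ext (Subtype.ext (DFunLike.ext _ _ fun r => ?_)) ?_,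
      fun a V => Prod.ext (Subtype.ext (DFunLike.ext _ _ fun r => ?_)) ?_⟩⟩
    · change bracket I G (V.1 r) (W₁.1 r + W₂.1 r) -
          wp r • bracket I G (V.1 1) (W₁.1 1 + W₂.1 1) =
        (bracket I G (V.1 r) (W₁.1 r) - wp r • bracket I G (V.1 1) (W₁.1 1)) +
          (bracket I G (V.1 r) (W₂.1 r) - wp r • bracket I G (V.1 1) (W₂.1 1))
      rw [bracket_add_right, bracket_add_right]
      module
    · exact (congrArg imag (map_add (velPairing B V.1) W₁.1 W₂.1)).trans (imag_add _ _)
    · change bracket I G (V.1 r) (a • W.1 r) - wp r • bracket I G (V.1 1) (a • W.1 1) =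
        a • (bracket I G (V.1 r) (W.1 r) - wp r • bracket I G (V.1 1) (W.1 1))
      rw [bracket_smul_right, bracket_smul_right]
      module
    · exact (congrArg imag (map_smul (velPairing B V.1) a W.1)).trans (imag_smul _ _)
    · change bracket I G (V₁.1 r + V₂.1 r) (W.1 r) -
          wp r • bracket I G (V₁.1 1 + V₂.1 1) (W.1 1) =
        (bracket I G (V₁.1 r) (W.1 r) - wp r • bracket I G (V₁.1 1) (W.1 1)) +
          (bracket I G (V₂.1 r) (W.1 r) - wp r • bracket I G (V₂.1 1) (W.1 1))
      rw [bracket_add_left, bracket_add_left]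
      module
    · exact (congrArg imag ((velPairing B).map_add₂ V₁.1 V₂.1 W.1)).trans (imag_add _ _)
    · change bracket I G (a • V.1 r) (W.1 r) - wp r • bracket I G (a • V.1 1) (W.1 1) =
        a • (bracket I G (V.1 r) (W.1 r) - wp r • bracket I G (V.1 1) (W.1 1))
      rw [bracket_smul_left, bracket_smul_left]
      module
    · exact (congrArg imag ((velPairing B).map_smul₂ a V.1 W.1)).trans (imag_smul _ _)
  on_image W V := by
    refine Prod.ext (Subtype.ext (DFunLike.ext _ _ fun r => ?_)) ?_
    · change bracket I G (W.1.1 r) (V.1 r) - wp r • bracket I G (W.1.1 1) (V.1 1) =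
        -bracket I G (V.1 r) (W.1.1 r)
      rw [W.1.2.2, bracket_zero_left, smul_zero, sub_zero, bracket_skew]
    · have e := velPairing_comm B (V := V.1) W.1.2.1 W.1.2.2
      refine (congrArg imag (neg_eq_iff_eq_neg.1 e.symm)).trans ?_
      exact imag_neg _
  on_bracket V₁ V₂ V₃ := by
    -- `P[V, γ] = [V, γ]` for a loop `γ`, so the terms with a loop as an entry cancel.
    refine Prod.ext (Subtype.ext (DFunLike.ext _ _ fun r => ?_)) ?_
    · change bracket I G (bracket I G (V₁.1 r) (V₂.1 r)) (V₃.1 r) -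
          wp r • bracket I G (bracket I G (V₁.1 1) (V₂.1 1)) (V₃.1 1) =
        bracket I G (V₁.1 r) ((loopPart wp h0 h1 (pathBracket I G V₂ V₃)).1 r) -
          bracket I G (V₂.1 r) ((loopPart wp h0 h1 (pathBracket I G V₁ V₃)).1 r) +
          (bracket I G (V₁.1 r) (bracket I G (V₂.1 r) (V₃.1 r)) -
            wp r • bracket I G (V₁.1 1) (bracket I G (V₂.1 1) (V₃.1 1))) -
          (bracket I G (V₂.1 r) (bracket I G (V₁.1 r) (V₃.1 r)) -
            wp r • bracket I G (V₂.1 1) (bracket I G (V₁.1 1) (V₃.1 1))) -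
          (bracket I G (V₁.1 r) ((loopPart wp h0 h1 (pathBracket I G V₂ V₃)).1 r) -
            wp r • bracket I G (V₁.1 1) ((loopPart wp h0 h1 (pathBracket I G V₂ V₃)).1 1)) +
          (bracket I G (V₂.1 r) ((loopPart wp h0 h1 (pathBracket I G V₁ V₃)).1 r) -
            wp r • bracket I G (V₂.1 1) ((loopPart wp h0 h1 (pathBracket I G V₁ V₃)).1 1))
      rw [(loopPart wp h0 h1 (pathBracket I G V₂ V₃)).2.2,
        (loopPart wp h0 h1 (pathBracket I G V₁ V₃)).2.2, bracket_zero_right, bracket_zero_right,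
        bracket_jacobi (V₁.1 r), bracket_jacobi (V₁.1 1)]
      module
    · set γ := loopIncl (loopPart wp h0 h1 (pathBracket I G V₂ V₃))
      set δ := loopIncl (loopPart wp h0 h1 (pathBracket I G V₁ V₃))
      have e : velPairing B (pathBracket I G V₁ V₂).1 V₃.1 =
          velPairing B V₁.1 γ.1 - velPairing B V₂.1 δ.1 +
          velPairing B V₁.1 (pathBracket I G V₂ V₃).1 -
          velPairing B V₂.1 (pathBracket I G V₁ V₃).1 - velPairing B V₁.1 γ.1 +
          velPairing B V₂.1 δ.1 := by
        rw [velPairing_pathBracket]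
        ring
      refine (congrArg imag e).trans ?_
      simp only [imag_add, imag_sub]
      rfl

end LieAlgebra

end StringTwoGroup

theorem mainTheorem4
    {E : Type*} [NormedAddCommGroup E] [NormedSpace ℝ E] [FiniteDimensional ℝ E]
    {H : Type*} [TopologicalSpace H] {I : ModelWithCorners ℝ E H} [I.Boundaryless]
    {G : Type*} [TopologicalSpace G] [ChartedSpace H G] [Group G] [LieGroup I ∞ G]
    (B : InvariantForm I G)
    (wp : C^∞⟮𝓡∂ 1, unitInterval; 𝓘(ℝ, ℝ), ℝ⟯) (h0 : wp 0 = 0) (h1 : wp 1 = 1) :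
    (Subgroup.normalClosure (holonomySet B) : Set (ExtPath B)) = holonomySet B ∧
    ∃ X : CrossedModule (LoopExt B) (PathGroup I G),
      IsStringTwoGroup B X ∧
      IsLinearisation X (HasVelExt B) HasVelPath adPath tAlg (actGroupAlg B) ∧
      (B.IsIntegral → ∀ c W W', HasVelExt B c W → HasVelExt B c W' → W = W') ∧
      IsAdjustment X (HasVelExt B) HasVelPath adPath tAlg (actGroupAlg B)
        (kappaHat B wp h0 h1) ∧
      (∀ c V₁, HasVelPath c V₁ →
        (∀ V₂, TendstoPath (𝓝[≠] (0 : ℝ)) (fun ε => ε⁻¹ • (adPath (c ε) V₂ - V₂))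
          (pathBracket I G V₁ V₂)) ∧
        (∀ W, TendstoExt (𝓝[≠] (0 : ℝ)) (fun ε => ε⁻¹ • (actGroupAlg B (c ε) W - W))
          (actAlg B V₁ W)) ∧
        (∀ V₂, TendstoExt (𝓝[≠] (0 : ℝ)) (fun ε => ε⁻¹ • kappaHat B wp h0 h1 (c ε) V₂)
          (kappaHatAlg B wp h0 h1 V₁ V₂))) ∧
      IsLieCrossedModule (bracketExt B) (pathBracket I G) tAlg (actAlg B) ∧
      IsLieAdjustment (pathBracket I G) tAlg (actAlg B) (kappaHatAlg B wp h0 h1) :=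
  ⟨congrArg (fun N : Subgroup (ExtPath B) => (N : Set (ExtPath B))) (normalClosure_holonomySet B),
    stringTwoGroup B, isStringTwoGroup_stringTwoGroup B, isLinearisation_stringTwoGroup B,
    fun hB _ _ _ h h' => h.unique hB h', isAdjustment_kappaHat B wp h0 h1,
    fun _ _ h =>
      ⟨tendstoPath_adPath h, tendstoExt_actGroupAlg B h, tendstoExt_kappaHat B wp h0 h1 h⟩,
    isLieCrossedModule B, isLieAdjustment_kappaHatAlg B wp h0 h1⟩
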